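/- Let $q\ge 2$ be an even integer. A symmetric signed digit expansion (SSDE) of length $\ell$ to the base $q$ is a word $(x_{\ell-1}\ldots x_0)$ of integers $x_j\in\{-\frac q2,\ldots,\frac q2\}$ (leading zeros allowed) such that, for $0\le j<\ell-1$, $|x_j|=\frac q2$ implies $0\le \operatorname{sgn}(x_j)\,x_{j+1}\le \frac q2-1$. Standard addition of two SSDEs $x,y$ of length $\ell$ is the following procedure: put $s_j=x_j+y_j$ for $0\le j<\ell$, $s_\ell=0$, $c_0=0$, and for $j=0,\ldots,\ell-1$ put $a=s_j+c_j$ and $$c_{j+1}=\begin{cases}1&\text{if } a>\frac q2,\text{ or } a=\frac q2\text{ and } (-\frac q2\le s_{j+1}<0\text{ or }\frac q2\le s_{j+1}<q),\\ -1&\text{if } a<-\frac q2,\text{ or } a=-\frac q2\text{ and }(-q<s_{j+1}\le-\frac q2\text{ or }0<s_{j+1}\le\frac q2),\\ 0&\text{otherwise.}\end{cases}$$ For each $\ell$ let $x$ and $y$ be independent and uniformly distributed on the SSDEs of length $\ell$, and let $M_\ell$ and $N_\ell$ be the numbers of carries among $c_1,\ldots,c_\ell$ that are equal to $1$ and to $-1$,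 respectively. Put $$e=\frac{q^2+2q+4}{8(q+1)^2},\qquad v=\frac{7q^6+48q^5+159q^4+128q^3-48q^2-12q-8}{64(q+1)^5(q-1)},$$ $$c=-\frac{q^6+24q^5+33q^4+80q^3+120q^2-12q-8}{64(q+1)^5(q-1)}.$$ Then, for fixed $q$ and $\ell\to\infty$, $$\mathbb E M_\ell=e\,\ell+O(1),\quad \mathbb V M_\ell=v\,\ell+O(1),\quad \mathbb E N_\ell=e\,\ell+O(1),\quad \mathbb V N_\ell=v\,\ell+O(1),\quad \operatorname{Cov}(M_\ell,N_\ell)=c\,\ell+O(1).$$ Moreover $M_\ell$ and $N_\ell$ are asymptotically jointly normally distributed: the matrix $\Sigma=\begin{pmatrix}v&c\\c&v\end{pmatrix}$ is positive definite, and $\ell^{-1/2}(M_\ell-e\ell,\;N_\ell-e\ell)$ converges in distribution to the centred bivariate normal distribution with covariance matrix $\Sigma$. -/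

import Mathlib

open MeasureTheory ProbabilityTheory Filter Asymptotics
open scoped Topology

noncomputable section

namespace SSDE

/-- A word `x = (x_{ℓ-1} … x_0)` of `ℓ` integer digits (`x 0` is the least significant one) is a
symmetric signed digit expansion to the even base `q`: all digits lie in `{-q/2, …, q/2}` and
`|x_j| = q/2` implies `0 ≤ sgn(x_j) x_{j+1} ≤ q/2 - 1`. Leading zeros are allowed. -/
def IsSSDE (q : ℕ) {ℓ : ℕ} (x : Fin ℓ → ℤ) : Prop :=
  (∀ j : Fin ℓ, -((q : ℤ) / 2) ≤ x j ∧ x j ≤ (q : ℤ) / 2) ∧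
  ∀ (j : ℕ) (hj : j + 1 < ℓ), |x ⟨j, by omega⟩| = (q : ℤ) / 2 →
    0 ≤ (x ⟨j, by omega⟩).sign * x ⟨j + 1, hj⟩ ∧
      (x ⟨j, by omega⟩).sign * x ⟨j + 1, hj⟩ ≤ (q : ℤ) / 2 - 1

/-- The set of all symmetric signed digit expansions of length `ℓ` to the base `q`. -/
def expansions (q ℓ : ℕ) : Set (Fin ℓ → ℤ) := {x | IsSSDE q x}

/-- A word padded with zeros on the left. -/
def pad {ℓ : ℕ} (x : Fin ℓ → ℤ) (j : ℕ) : ℤ := if h : j < ℓ then x ⟨j, h⟩ else 0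

/-- One step of standard addition: the outgoing carry at a position where the digitwise sum plus
the incoming carry is `a`, and the digitwise sum at the next position is `s`. -/
def nextCarry (q : ℕ) (a s : ℤ) : ℤ :=
  let h : ℤ := (q : ℤ) / 2
  if h < a then 1
  else if a < -h then -1
  else if a = h ∧ ((-h ≤ s ∧ s < 0) ∨ (h ≤ s ∧ s < q)) then 1
  else if a = -h ∧ ((-(q : ℤ) < s ∧ s ≤ -h) ∨ (0 < s ∧ s ≤ h)) then -1
  else 0

/-- The carry `c_j` into position `j` when standard addition is applied to the sequence `s` of
digitwise sums. -/
def carry (q : ℕ) (s : ℕ → ℤ) : ℕ → ℤ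
  | 0 => 0
  | j + 1 => nextCarry q (s j + carry q s j) (s (j + 1))

/-- The number of the carries `c_1, …, c_ℓ` that are equal to `c` in the standard addition of the
words `x` and `y` of length `ℓ`. -/
def numCarries (q : ℕ) (c : ℤ) {ℓ : ℕ} (x y : Fin ℓ → ℤ) : ℕ :=
  ((Finset.range ℓ).filter
    (fun j => carry q (fun i => pad x i + pad y i) (j + 1) = c)).card

/-- The constant in the expected value. -/
def meanConst (q : ℕ) : ℝ := ((q : ℝ) ^ 2 + 2 * q + 4) / (8 * ((q : ℝ) + 1) ^ 2)

/-- The constant in the variance. -/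
def varConst (q : ℕ) : ℝ :=
  (7 * (q : ℝ) ^ 6 + 48 * (q : ℝ) ^ 5 + 159 * (q : ℝ) ^ 4 + 128 * (q : ℝ) ^ 3
    - 48 * (q : ℝ) ^ 2 - 12 * q - 8) / (64 * ((q : ℝ) + 1) ^ 5 * ((q : ℝ) - 1))

/-- The constant in the covariance. -/
def covConst (q : ℕ) : ℝ :=
  -(((q : ℝ) ^ 6 + 24 * (q : ℝ) ^ 5 + 33 * (q : ℝ) ^ 4 + 80 * (q : ℝ) ^ 3
    + 120 * (q : ℝ) ^ 2 - 12 * q - 8) / (64 * ((q : ℝ) + 1) ^ 5 * ((q : ℝ) - 1)))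

/-- The asymptotic variance-covariance matrix per digit. -/
def covMatrix (q : ℕ) : Matrix (Fin 2) (Fin 2) ℝ :=
  !![varConst q, covConst q; covConst q, varConst q]

end SSDE

end

noncomputable section

namespace SSDE

/-! Write `h = q/2`. Read from the least significant digit, the triple (digit of the first word,
digit of the second word, incoming carry) is a finite automaton, and the number of continuations of
an expansion after a digit is governed by the eigenvector `digitWeight` of the digit adjacency
relation: weight 1/2 at `±h`, weight 1 elsewhere, eigenvalue `q`. Conjugating the counting operator
by this eigenvector (Doob transform) gives a Markov chain, `carryChain`. A uniform pair of
expansions of length `ℓ` becomes a path of `ℓ` moves from `(0, 0, 0)`, weighted at its end by the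
inverse eigenvector and then normalised (`sum_words_eq_pathSum`, `pairAvg_eq_pathSum`).

From every state two pairs of zero digits lead to `(0, 0, 0)`, so two steps of the transition
operator contract oscillations by a fixed factor (`Osc.op_op`). The limit theorems follow by the
martingale method. Suppose that a cost has a corrector `g₁` such that the cost plus the increment of
`g₁` has mean zero at every state, and that a second corrector `g₂` absorbs the dependence of the
conditional variance on the state, up to a constant `σ2`. Then the first moment is bounded and the
second is `σ2 * k + O(1)` (`exists_moment_bounds`). Moreover `1 - θ² g₂ / 2` is, up to `O(|θ|³)`, an
eigenfunction of the operator twisted by `exp (iθ · cost)` with eigenvalue `1 - θ² σ2 / 2`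
(`exists_approx_eigen`). With `θ = 1/√k` the errors of `k` steps add up to `O(1/√k)`, which gives
the Gaussian characteristic function (`tendsto_pathSum_exp`, `asymptotics`).

For the carries the correctors are explicit. They depend only on whether each digit is `-h`, `h` or
in between, and on the position of the sum (incoming carry included) relative to `±h`. The
transition counts between these classes are polynomials in `h`, obtained by summing unit steps over
rectangles, so the corrector equations are polynomial identities, checked in eight cases and
extended by the symmetries of negation and exchange of summands (`balancedAt_of_reachable`).

All linear combinations `t₁ M + t₂ N` are treated at once: their limiting variance is the quadratic
form `sigma2` of the covariance matrix. Polarisation gives the covariance, and convergence of the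
characteristic functions gives joint normality. -/

/-- A Markov chain with finitely many moves from each state, on a closed set `R` of states, all of
which reach the state `base` in two steps with probability at least `δ`. -/
structure Chain (S ι : Type*) where
  moves : S → Finset ι
  weight : S → ι → ℝ
  next : S → ι → S
  R : Set S
  base : S
  δ : ℝ
  base_mem : base ∈ R
  weight_nonneg : ∀ s ∈ R, ∀ i ∈ moves s, 0 ≤ weight s i
  sum_weight : ∀ s ∈ R, ∑ i ∈ moves s, weight s i = 1
  next_mem : ∀ s ∈ R, ∀ i ∈ moves s, next s i ∈ R
  δ_pos : 0 < δ
  minorization : ∀ f : S → ℝ, (∀ s ∈ R, 0 ≤ f s) → ∀ s ∈ R,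
    δ * f base ≤ ∑ i ∈ moves s, weight s i *
      ∑ j ∈ moves (next s i), weight (next s i) j * f (next (next s i) j)

/-! ### Contraction of oscillations and perturbed evolution equations. -/

namespace Chain

variable {S ι : Type*} (C : Chain S ι)

/-- The average of a function of the move from the state `s`. -/
def avg {V : Type*} [AddCommMonoid V] [Module ℝ V] (s : S) (F : ι → V) : V :=
  ∑ i ∈ C.moves s, C.weight s i • F i

/-- The transition operator. -/
def op (f : S → ℝ) (s : S) : ℝ := C.avg s (fun i => f (C.next s i))

variable {C}

lemma avg_add {V : Type*} [AddCommMonoid V] [Module ℝ V] (s : S) (F G : ι → V) :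
    C.avg s (fun i => F i + G i) = C.avg s F + C.avg s G := by
  simp [avg, Finset.sum_add_distrib]

lemma avg_sub {V : Type*} [AddCommGroup V] [Module ℝ V] (s : S) (F G : ι → V) :
    C.avg s (fun i => F i - G i) = C.avg s F - C.avg s G := by
  simp [avg, smul_sub]

lemma avg_const_mul (s : S) (c : ℝ) (F : ι → ℝ) :
    C.avg s (fun i => c * F i) = c * C.avg s F := by
  simp only [avg, Finset.mul_sum, smul_eq_mul]
  exact Finset.sum_congr rfl fun i _ => by ring

lemma avg_mul_const (s : S) (c : ℝ) (F : ι → ℝ) :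
    C.avg s (fun i => F i * c) = C.avg s F * c := by
  simp only [avg, Finset.sum_mul, smul_eq_mul]
  exact Finset.sum_congr rfl fun i _ => by ring

lemma avg_const_mul_complex (s : S) (c : ℂ) (F : ι → ℂ) :
    C.avg s (fun i => c * F i) = c * C.avg s F := by
  simp only [avg, Finset.mul_sum, mul_smul_comm]

lemma avg_ofReal (s : S) (F : ι → ℝ) :
    C.avg s (fun i => (F i : ℂ)) = ((C.avg s F : ℝ) : ℂ) := by
  simp [avg]

lemma avg_const {V : Type*} [AddCommGroup V] [Module ℝ V] {s : S} (hs : s ∈ C.R) (c : V) :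
    C.avg s (fun _ => c) = c := by
  simp [avg, ← Finset.sum_smul, C.sum_weight s hs]

lemma avg_congr {V : Type*} [AddCommMonoid V] [Module ℝ V] {s : S} {F G : ι → V}
    (h : ∀ i ∈ C.moves s, F i = G i) : C.avg s F = C.avg s G :=
  Finset.sum_congr rfl fun i hi => by rw [h i hi]

lemma avg_mono {s : S} (hs : s ∈ C.R) {F G : ι → ℝ} (h : ∀ i ∈ C.moves s, F i ≤ G i) :
    C.avg s F ≤ C.avg s G :=
  Finset.sum_le_sum fun i hi => mul_le_mul_of_nonneg_left (h i hi) (C.weight_nonneg s hs i hi)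

lemma norm_avg_le {V : Type*} [NormedAddCommGroup V] [NormedSpace ℝ V] {s : S} (hs : s ∈ C.R)
    {F : ι → V} {B : ℝ} (h : ∀ i ∈ C.moves s, ‖F i‖ ≤ B) : ‖C.avg s F‖ ≤ B := by
  calc ‖C.avg s F‖ ≤ ∑ i ∈ C.moves s, ‖C.weight s i • F i‖ := norm_sum_le _ _
    _ ≤ ∑ i ∈ C.moves s, C.weight s i * B := Finset.sum_le_sum fun i hi => by
        rw [norm_smul, Real.norm_of_nonneg (C.weight_nonneg s hs i hi)]
        exact mul_le_mul_of_nonneg_left (h i hi) (C.weight_nonneg s hs i hi)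
    _ = B := by rw [← Finset.sum_mul, C.sum_weight s hs, one_mul]

lemma op_mono {f g : S → ℝ} (h : ∀ s ∈ C.R, f s ≤ g s) {s : S} (hs : s ∈ C.R) :
    C.op f s ≤ C.op g s :=
  avg_mono hs fun i hi => h _ (C.next_mem s hs i hi)

lemma op_const_add {s : S} (hs : s ∈ C.R) (c : ℝ) (f : S → ℝ) :
    C.op (fun t => c + f t) s = c + C.op f s := by
  rw [op, avg_add, avg_const hs]; rfl

lemma op_op_minorization {f : S → ℝ} (hf : ∀ s ∈ C.R, 0 ≤ f s) {s : S} (hs : s ∈ C.R) :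
    C.δ * f C.base ≤ C.op (C.op f) s :=
  C.minorization f hf s hs

lemma op_congr {f g : S → ℝ} (h : ∀ s ∈ C.R, f s = g s) {s : S} (hs : s ∈ C.R) :
    C.op f s = C.op g s :=
  avg_congr fun i hi => h _ (C.next_mem s hs i hi)

lemma op_op_const {s : S} (hs : s ∈ C.R) (c : ℝ) : C.op (C.op fun _ => c) s = c := by
  have h1 : C.op (C.op fun _ => c) s = C.op (fun _ => c) s :=
    op_congr (fun t ht => avg_const ht c) hs
  rw [h1]
  exact avg_const hs c

lemma op_add (f g : S → ℝ) (s : S) : C.op (fun t => f t + g t) s = C.op f s + C.op g s :=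
  avg_add _ _ _

lemma op_const_mul (c : ℝ) (f : S → ℝ) (s : S) : C.op (fun t => c * f t) s = c * C.op f s :=
  avg_const_mul _ _ _

lemma δ_le_one : C.δ ≤ 1 := by
  have := op_op_minorization (C := C) (f := fun _ => 1) (fun _ _ => zero_le_one) C.base_mem
  rwa [op_op_const C.base_mem, mul_one] at this

variable (C) in
/-- The values of `f` on `R` lie in an interval of length `O`. -/
def Osc (f : S → ℝ) (O : ℝ) : Prop := ∃ m, ∀ s ∈ C.R, m ≤ f s ∧ f s ≤ m + O

lemma osc_of_abs_le {f : S → ℝ} {B : ℝ} (h : ∀ s ∈ C.R, |f s| ≤ B) : C.Osc f (2 * B) :=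
  ⟨-B, fun s hs => by have := abs_le.1 (h s hs); constructor <;> linarith⟩

lemma Osc.add {f g : S → ℝ} {A B : ℝ} (hf : C.Osc f A) (hg : C.Osc g B) :
    C.Osc (fun s => f s + g s) (A + B) := by
  obtain ⟨m, hm⟩ := hf
  obtain ⟨n, hn⟩ := hg
  exact ⟨m + n, fun s hs => by
    have h1 := hm s hs
    have h2 := hn s hs
    constructor <;> linarith⟩

lemma Osc.congr {f g : S → ℝ} {A : ℝ} (hf : C.Osc f A) (h : ∀ s ∈ C.R, g s = f s) :
    C.Osc g A := by
  obtain ⟨m, hm⟩ := hf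
  exact ⟨m, fun s hs => by rw [h s hs]; exact hm s hs⟩

lemma op_mem_Icc {f : S → ℝ} {a b : ℝ} (h : ∀ s ∈ C.R, a ≤ f s ∧ f s ≤ b) :
    ∀ s ∈ C.R, a ≤ C.op f s ∧ C.op f s ≤ b := fun s hs => by
  have h1 := op_mono (f := fun _ => a) (fun t ht => (h t ht).1) hs
  have h2 := op_mono (g := fun _ => b) (fun t ht => (h t ht).2) hs
  rw [op, avg_const hs] at h1
  rw [op, op, avg_const hs] at h2
  exact ⟨h1, h2⟩

lemma Osc.op {f : S → ℝ} {A : ℝ} (hf : C.Osc f A) : C.Osc (C.op f) A := by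
  obtain ⟨m, hm⟩ := hf
  exact ⟨m, op_mem_Icc hm⟩

/-- Doeblin's argument: the minorization, applied to the nonnegative functions `f - m` and `m + A -
f`, raises the lower bound and lowers the upper bound. The two gains add up to `δ * A`, whatever the
value of `f` at `base` is. -/
lemma Osc.op_op {f : S → ℝ} {A : ℝ} (hf : C.Osc f A) :
    C.Osc (C.op (C.op f)) ((1 - C.δ) * A) := by
  obtain ⟨m, hm⟩ := hf
  refine ⟨m + C.δ * (f C.base - m), fun s hs => ?_⟩
  have lin : ∀ c d : ℝ, C.op (C.op fun t => c + d * f t) s = c + d * C.op (C.op f) s := by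
    intro c d
    rw [op_congr (g := fun t => c + d * C.op f t) (fun t ht => ?_) hs, op_const_add hs,
      op_const_mul]
    rw [op_const_add ht, op_const_mul]
  have h1 := op_op_minorization (f := fun t => -m + 1 * f t)
    (fun t ht => by linarith [(hm t ht).1]) hs
  have h2 := op_op_minorization (f := fun t => (m + A) + (-1) * f t)
    (fun t ht => by linarith [(hm t ht).2]) hs
  rw [lin] at h1 h2
  constructor <;> nlinarith

lemma op_abs_le {f : S → ℝ} {B : ℝ} (h : ∀ s ∈ C.R, |f s| ≤ B) : ∀ s ∈ C.R, |C.op f s| ≤ B :=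
  fun s hs => by
    rw [← Real.norm_eq_abs]
    exact norm_avg_le hs fun i hi => h _ (C.next_mem s hs i hi)

/-- Solutions of a perturbed evolution equation with summable perturbations are bounded. -/
lemma bounded_of_summable {u e : ℕ → S → ℝ} {η : ℕ → ℝ} {B : ℝ}
    (h0 : ∀ s ∈ C.R, |u 0 s| ≤ B) (hu : ∀ k, ∀ s ∈ C.R, u (k + 1) s = C.op (u k) s + e k s)
    (he : ∀ k, ∀ s ∈ C.R, |e k s| ≤ η k) (hη : Summable η) :
    ∀ k, ∀ s ∈ C.R, |u k s| ≤ B + ∑' j, η j := by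
  have hη0 : ∀ k, 0 ≤ η k := fun k => (abs_nonneg _).trans (he k _ C.base_mem)
  have key : ∀ k, ∀ s ∈ C.R, |u k s| ≤ B + ∑ j ∈ Finset.range k, η j := by
    intro k
    induction k with
    | zero => simpa using h0
    | succ k ih =>
      intro s hs
      rw [hu k s hs, Finset.sum_range_succ]
      have := op_abs_le ih s hs
      linarith [abs_add_le (C.op (u k) s) (e k s), he k s hs]
  intro k s hs
  linarith [key k s hs, hη.sum_le_tsum (Finset.range k) (fun i _ => hη0 i)]

/-- Solutions of a perturbed evolution equation with summable perturbations have summable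
oscillations. -/
lemma summable_osc {u e : ℕ → S → ℝ} {η : ℕ → ℝ} {B : ℝ}
    (h0 : ∀ s ∈ C.R, |u 0 s| ≤ B) (hu : ∀ k, ∀ s ∈ C.R, u (k + 1) s = C.op (u k) s + e k s)
    (he : ∀ k, ∀ s ∈ C.R, |e k s| ≤ η k) (hη : Summable η) :
    ∃ O : ℕ → ℝ, (∀ k, 0 ≤ O k) ∧ Summable O ∧ ∀ k, C.Osc (u k) (O k) := by
  have hη0 : ∀ k, 0 ≤ η k := fun k => (abs_nonneg _).trans (he k _ C.base_mem)
  have hB : 0 ≤ B := (abs_nonneg _).trans (h0 _ C.base_mem)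
  have hδ := C.δ_pos
  have hδ1 := C.δ_le_one
  have step : ∀ k A, C.Osc (u k) A → C.Osc (u (k + 1)) (A + 2 * η k) := fun k A hA =>
    ((hA.op).add (osc_of_abs_le (he k))).congr (hu k)
  have step2 : ∀ k A, C.Osc (u k) A →
      C.Osc (u (k + 2)) ((1 - C.δ) * A + (2 * η k + 2 * η (k + 1))) := fun k A hA => by
    have h1 : C.Osc (fun s => C.op (e k) s + e (k + 1) s) (2 * η k + 2 * η (k + 1)) :=
      (osc_of_abs_le (op_abs_le (he k))).add (osc_of_abs_le (he (k + 1)))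
    refine (hA.op_op.add h1).congr fun s hs => ?_
    rw [hu (k + 1) s hs, op_congr (hu k) hs, op_add]
    ring
  -- Contraction takes two steps, so the bound is propagated from `k` to `k + 2`, separately for
  -- even and odd indices.
  let O : ℕ → ℝ := fun n => Nat.twoStepInduction (motive := fun _ => ℝ) (2 * B)
    (2 * B + 2 * η 0) (fun k A _ => (1 - C.δ) * A + (2 * η k + 2 * η (k + 1))) n
  have O2 : ∀ k, O (k + 2) = (1 - C.δ) * O k + (2 * η k + 2 * η (k + 1)) := fun k => rfl
  have Onn : ∀ k, 0 ≤ O k := fun k => by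
    induction k using Nat.twoStepInduction with
    | zero => exact mul_nonneg zero_le_two hB
    | one => have := hη0 0; change 0 ≤ 2 * B + 2 * η 0; linarith
    | more k h1 h2 =>
      rw [O2]
      have := mul_nonneg (sub_nonneg.2 hδ1) h1
      linarith [hη0 k, hη0 (k + 1)]
  refine ⟨O, Onn, ?_, fun k => ?_⟩
  -- Summing the recursion bounds the partial sum `S` by `(1 - δ) * S` plus a constant, hence `δ *
  -- S` by that constant.
  · have bound : ∀ n, ∑ k ∈ Finset.range n, O k ≤ (O 0 + O 1 + 4 * ∑' j, η j) / C.δ := by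
      intro n
      rw [le_div_iff₀ hδ]
      have h1 : ∑ k ∈ Finset.range n, O k ≤ ∑ k ∈ Finset.range (n + 2), O k :=
        Finset.sum_le_sum_of_subset_of_nonneg (Finset.range_mono (by omega)) fun k _ _ => Onn k
      have h2 : ∑ k ∈ Finset.range (n + 2), O k = O 0 + O 1 +
          ((1 - C.δ) * ∑ k ∈ Finset.range n, O k + (2 * ∑ k ∈ Finset.range n, η k +
            2 * ∑ k ∈ Finset.range n, η (k + 1))) := by
        rw [Finset.sum_range_succ', Finset.sum_range_succ']
        simp only [O2, Finset.sum_add_distrib, ← Finset.mul_sum]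
        ring
      have h3 := hη.sum_le_tsum (Finset.range n) (fun i _ => hη0 i)
      have h4 := hη.sum_le_tsum (Finset.range (n + 1)) (fun i _ => hη0 i)
      rw [Finset.sum_range_succ'] at h4
      have := hη0 0
      nlinarith
    exact summable_of_sum_range_le Onn bound
  · induction k using Nat.twoStepInduction with
    | zero => exact osc_of_abs_le h0
    | one => exact step 0 _ (osc_of_abs_le h0)
    | more k h1 h2 => rw [O2]; exact step2 k _ h1

/-- The iterates of the transition operator converge to a constant. -/
lemma exists_limit {u : ℕ → S → ℝ} {A B : ℝ} (h0 : ∀ s ∈ C.R, A ≤ u 0 s ∧ u 0 s ≤ B)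
    (hu : ∀ k, ∀ s ∈ C.R, u (k + 1) s = C.op (u k) s) :
    ∃ (α : ℝ) (O : ℕ → ℝ), A ≤ α ∧ (∀ k, 0 ≤ O k) ∧ Summable O ∧
      (∀ k, ∀ s ∈ C.R, |u k s - α| ≤ O k) ∧
      ∃ D, ∀ k : ℕ, ∀ s ∈ C.R, k * |u k s - α| ≤ D := by
  have hu' : ∀ k, ∀ s ∈ C.R, u (k + 1) s = C.op (u k) s + (fun _ _ => 0 : ℕ → S → ℝ) k s := by
    simpa using hu
  have he : ∀ k, ∀ s ∈ C.R, |(fun _ _ => 0 : ℕ → S → ℝ) k s| ≤ (fun _ => 0 : ℕ → ℝ) k := by simp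
  have h0' : ∀ s ∈ C.R, |u 0 s| ≤ max |A| |B| := fun s hs =>
    abs_le_max_abs_abs (h0 s hs).1 (h0 s hs).2
  obtain ⟨O, Onn, Osum, hO⟩ := summable_osc h0' hu' he summable_zero
  have stay : ∀ k a b, (∀ s ∈ C.R, a ≤ u k s ∧ u k s ≤ b) → ∀ j, ∀ s ∈ C.R,
      a ≤ u (k + j) s ∧ u (k + j) s ≤ b := fun k a b h j => by
    induction j with
    | zero => exact h
    | succ j ih =>
      intro s hs
      rw [← add_assoc, hu _ s hs]
      exact op_mem_Icc ih s hs
  -- An interval that contains the values of `u k` on `R` contains those of all later iterates.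
  have dist_le : ∀ k j, ∀ s ∈ C.R, ∀ t ∈ C.R, |u k s - u (k + j) t| ≤ O k := by
    intro k j s hs t ht
    obtain ⟨m, hm⟩ := hO k
    have h1 := hm s hs
    have h2 := stay k _ _ hm j t ht
    rw [abs_le]
    constructor <;> linarith
  have cau : CauchySeq (fun k => u k C.base) := by
    refine cauchySeq_of_summable_dist (Osum.of_nonneg_of_le (fun _ => dist_nonneg) fun k => ?_)
    exact dist_le k 1 _ C.base_mem _ C.base_mem
  obtain ⟨α, hα⟩ := cauchySeq_tendsto_of_complete cau
  have close : ∀ k, ∀ s ∈ C.R, |u k s - α| ≤ O k := by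
    intro k s hs
    have h1 : Tendsto (fun j => |u k s - u (k + j) C.base|) atTop (𝓝 |u k s - α|) := by
      have := (tendsto_add_atTop_iff_nat k).2 hα
      simp_rw [add_comm _ k] at this
      exact (tendsto_const_nhds.sub this).abs
    exact le_of_tendsto' h1 fun j => dist_le k j s hs _ C.base_mem
  refine ⟨α, O, ge_of_tendsto' hα fun k => ?_, Onn, Osum, close, ?_⟩
  · have := (stay 0 _ _ h0 k C.base C.base_mem).1
    rwa [zero_add] at this
  -- The function `k * (u k - α)` satisfies the evolution equation with perturbation `u (k + 1) -
  -- α`, which is summable; hence it is bounded.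
  · have hO' : Summable fun k => O (k + 1) := (summable_nat_add_iff 1).2 Osum
    have := bounded_of_summable (C := C) (u := fun k s => k * (u k s - α))
      (e := fun k s => u (k + 1) s - α) (B := 0) (by simp) (fun k s hs => ?_)
      (fun k s hs => close (k + 1) s hs) hO'
    · refine ⟨0 + ∑' j, O (j + 1), fun k s hs => ?_⟩
      have := this k s hs
      rwa [abs_mul, Nat.abs_cast] at this
    · have : C.op (fun t => (k : ℝ) * (u k t - α)) s = k * (u (k + 1) s - α) := by
        rw [op_const_mul, hu k s hs, op, avg_sub, avg_const hs]; rfl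
      rw [this]
      push_cast
      ring

end Chain

/-! ### Path sums and their moments. -/

namespace Chain

variable {S ι : Type*}

/-- The weighted sum, over all paths of length `k` from the state `s`, of the value of `φ` at the
total cost; `r` is the terminal weight and `b` the terminal cost. -/
def pathSum (C : Chain S ι) {V : Type*} [AddCommGroup V] [Module ℝ V]
    (ζ : S → ι → ℝ) (r b : S → ℝ) : ℕ → S → (ℝ → V) → V
  | 0, s, φ => r s • φ (b s)
  | k + 1, s, φ =>
    C.avg s fun i => pathSum C ζ r b k (C.next s i) fun z => φ (ζ s i + z)

variable {C : Chain S ι} {ζ : S → ι → ℝ} {r b : S → ℝ}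

lemma pathSum_add {V : Type*} [AddCommGroup V] [Module ℝ V] (k : ℕ) (s : S) (φ ψ : ℝ → V) :
    C.pathSum ζ r b k s (fun z => φ z + ψ z) = C.pathSum ζ r b k s φ + C.pathSum ζ r b k s ψ := by
  induction k generalizing s φ ψ with
  | zero => simp [pathSum]
  | succ k ih => simp only [pathSum, ih, avg_add]

lemma pathSum_const_mul (k : ℕ) (s : S) (c : ℝ) (φ : ℝ → ℝ) :
    C.pathSum ζ r b k s (fun z => c * φ z) = c * C.pathSum ζ r b k s φ := by
  induction k generalizing s φ with
  | zero => simp [pathSum, mul_left_comm]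
  | succ k ih => simp only [pathSum, ih, avg_const_mul]

lemma pathSum_const_mul_complex (k : ℕ) (s : S) (c : ℂ) (φ : ℝ → ℂ) :
    C.pathSum ζ r b k s (fun z => c * φ z) = c * C.pathSum ζ r b k s φ := by
  induction k generalizing s φ with
  | zero => simp only [pathSum, mul_smul_comm]
  | succ k ih => simp only [pathSum, ih, avg_const_mul_complex]

/-- Replacing the cost by a cohomologous one. -/
lemma pathSum_corrector {V : Type*} [AddCommGroup V] [Module ℝ V] (g : S → ℝ) (k : ℕ) (s : S)
    (φ : ℝ → V) :
    C.pathSum ζ r b k s φ =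
      C.pathSum (fun s i => ζ s i + g (C.next s i) - g s) r (fun s => b s - g s) k s
        (fun z => φ (g s + z)) := by
  induction k generalizing s φ with
  | zero => simp [pathSum]
  | succ k ih =>
    simp only [pathSum]
    refine avg_congr fun i _ => ?_
    rw [ih]
    congr 1
    funext z
    congr 1
    ring

/-- The second order moment assertion for path sums of a cost that is centred at every state. -/
lemma exists_moment_bounds {K σ2 : ℝ} {g : S → ℝ}
    (hζ : ∀ s ∈ C.R, ∀ i ∈ C.moves s, |ζ s i| ≤ K) (hb : ∀ s ∈ C.R, |b s| ≤ K)
    (hg : ∀ s ∈ C.R, |g s| ≤ K) (hr : ∀ s ∈ C.R, 1 ≤ r s ∧ r s ≤ K)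
    (hmean : ∀ s ∈ C.R, C.avg s (ζ s) = 0)
    (hvar : ∀ s ∈ C.R, C.avg s (fun i => ζ s i ^ 2 + g (C.next s i)) = σ2 + g s) :
    ∃ α D : ℝ, 1 ≤ α ∧
      (∀ ε > 0, ∀ᶠ k in atTop, ∀ s ∈ C.R, |C.pathSum ζ r b k s (fun _ => (1 : ℝ)) - α| ≤ ε) ∧
      (∀ k : ℕ, ∀ s ∈ C.R, k * |C.pathSum ζ r b k s (fun _ => (1 : ℝ)) - α| ≤ D) ∧
      (∀ k : ℕ, ∀ s ∈ C.R, |C.pathSum ζ r b k s (fun z => z)| ≤ D) ∧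
      (∀ k : ℕ, ∀ s ∈ C.R,
        |C.pathSum ζ r b k s (fun z => z ^ 2) - α * σ2 * k| ≤ D) := by
  set a : ℕ → S → ℝ := fun k s => C.pathSum ζ r b k s (fun _ => (1 : ℝ)) with ha
  set d : ℕ → S → ℝ := fun k s => C.pathSum ζ r b k s (fun z => z) with hd
  set n : ℕ → S → ℝ := fun k s => C.pathSum ζ r b k s (fun z => z ^ 2) with hn
  have hK : 0 ≤ K := (abs_nonneg _).trans (hb _ C.base_mem)
  have a0 : ∀ s, a 0 s = r s := fun s => by simp [ha, pathSum]
  have d0 : ∀ s, d 0 s = r s * b s := fun s => by simp [hd, pathSum]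
  have n0 : ∀ s, n 0 s = r s * b s ^ 2 := fun s => by simp [hn, pathSum]
  have a1 : ∀ k s, a (k + 1) s = C.op (a k) s := fun k s => rfl
  have d1 : ∀ k s, d (k + 1) s = C.op (d k) s +
      C.avg s (fun i => ζ s i * a k (C.next s i)) := fun k s => by
    rw [op, ← avg_add]
    refine avg_congr fun i _ => ?_
    rw [pathSum_add k _ (fun _ => ζ s i) (fun z => z),
      ← mul_one (ζ s i), pathSum_const_mul, add_comm, mul_one]
  have n1 : ∀ k s, n (k + 1) s = C.op (n k) s + (C.avg s (fun i => ζ s i ^ 2 * a k (C.next s i)) +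
      C.avg s (fun i => 2 * ζ s i * d k (C.next s i))) := fun k s => by
    rw [op, ← avg_add, ← avg_add]
    refine avg_congr fun i _ => ?_
    simp only [ha, hd, hn]
    rw [← pathSum_const_mul, ← pathSum_const_mul, ← pathSum_add, ← pathSum_add]
    congr 1
    funext z
    ring
  obtain ⟨α, O, hα, Onn, Osum, hO, Da, hDa⟩ :=
    exists_limit (C := C) (u := a) (A := 1) (B := K) (fun s hs => by rw [a0]; exact hr s hs)
      (fun k s _ => a1 k s)
  have hrb : ∀ s ∈ C.R, |r s * b s| ≤ K * K := fun s hs => by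
    rw [abs_mul]
    have := hr s hs
    exact mul_le_mul (abs_le.2 ⟨by linarith, this.2⟩) (hb s hs) (abs_nonneg _) hK
  have he : ∀ k, ∀ s ∈ C.R,
      |C.avg s (fun i => ζ s i * a k (C.next s i))| ≤ K * O k := fun k s hs => by
    -- As `ζ` is centred, `a k` may be replaced by its deviation from `α`, which is summable in `k`.
    have h1 : C.avg s (fun i => ζ s i * a k (C.next s i)) =
        C.avg s (fun i => ζ s i * (a k (C.next s i) - α)) := by
      simp only [mul_sub]
      rw [avg_sub, avg_mul_const, hmean s hs]
      ring
    rw [h1, ← Real.norm_eq_abs]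
    refine norm_avg_le hs fun i hi => ?_
    rw [Real.norm_eq_abs, abs_mul]
    exact mul_le_mul (hζ s hs i hi) (hO k _ (C.next_mem s hs i hi)) (abs_nonneg _) hK
  have hd0 : ∀ s ∈ C.R, |d 0 s| ≤ K * K := fun s hs => by rw [d0]; exact hrb s hs
  have dB := bounded_of_summable hd0 (fun k s _ => d1 k s) he (Osum.mul_left K)
  obtain ⟨P, Pnn, Psum, hP⟩ := summable_osc hd0 (fun k s _ => d1 k s) he (Osum.mul_left K)
  -- Besides the linear growth, `α * g` is subtracted: by `hvar` the main part of the increment then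
  -- cancels, and only summable perturbations remain.
  set n' : ℕ → S → ℝ := fun k s => n k s - α * (σ2 * k + g s) with hn'
  have n'0 : ∀ s ∈ C.R, |n' 0 s| ≤ K * K * K + α * K := fun s hs => by
    have h1 : n' 0 s = r s * b s * b s - α * g s := by simp [hn', n0]; ring
    rw [h1]
    refine (abs_sub _ _).trans (add_le_add ?_ ?_)
    · rw [abs_mul]
      exact mul_le_mul (hrb s hs) (hb s hs) (abs_nonneg _) (mul_nonneg hK hK)
    · rw [abs_mul, abs_of_nonneg (by linarith : 0 ≤ α)]
      exact mul_le_mul_of_nonneg_left (hg s hs) (by linarith)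
  have n'1 : ∀ k, ∀ s ∈ C.R, n' (k + 1) s = C.op (n' k) s +
      (C.avg s (fun i => ζ s i ^ 2 * (a k (C.next s i) - α)) +
      C.avg s (fun i => 2 * ζ s i * d k (C.next s i))) := fun k s hs => by
    have h1 : C.op (n' k) s = C.op (n k) s - α * (σ2 * k + C.op g s) := by
      rw [op, avg_sub, avg_const_mul, avg_add, avg_const hs]; rfl
    have h2 : C.avg s (fun i => ζ s i ^ 2 * (a k (C.next s i) - α)) =
        C.avg s (fun i => ζ s i ^ 2 * a k (C.next s i)) - C.avg s (fun i => ζ s i ^ 2) * α := by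
      simp only [mul_sub]
      rw [avg_sub, avg_mul_const]
    have h3 := hvar s hs
    rw [avg_add] at h3
    change _ + C.op g s = _ at h3
    rw [h1, h2, hn']
    simp only
    rw [n1]
    push_cast
    linear_combination α * h3
  have hen : ∀ k, ∀ s ∈ C.R, |C.avg s (fun i => ζ s i ^ 2 * (a k (C.next s i) - α)) +
      C.avg s (fun i => 2 * ζ s i * d k (C.next s i))| ≤ K ^ 2 * O k + 2 * K * P k := by
    intro k s hs
    refine (abs_add_le _ _).trans (add_le_add ?_ ?_)
    · rw [← Real.norm_eq_abs]
      refine norm_avg_le hs fun i hi => ?_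
      rw [Real.norm_eq_abs, abs_mul, abs_pow]
      exact mul_le_mul (pow_le_pow_left₀ (abs_nonneg _) (hζ s hs i hi) 2)
        (hO k _ (C.next_mem s hs i hi)) (abs_nonneg _) (sq_nonneg K)
    -- Centring again: only the oscillation of `d k` enters, which is summable although `d k` itself
    -- is merely bounded.
    · obtain ⟨m, hm⟩ := hP k
      have h1 : C.avg s (fun i => 2 * ζ s i * d k (C.next s i)) =
          C.avg s (fun i => 2 * ζ s i * (d k (C.next s i) - m)) := by
        simp only [mul_sub]
        rw [avg_sub, avg_mul_const, avg_const_mul, hmean s hs]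
        ring
      rw [h1, ← Real.norm_eq_abs]
      refine norm_avg_le hs fun i hi => ?_
      rw [Real.norm_eq_abs, abs_mul, abs_mul, abs_two]
      have h2 := hm _ (C.next_mem s hs i hi)
      refine mul_le_mul (by linarith [hζ s hs i hi]) ?_ (abs_nonneg _) (by linarith)
      rw [abs_le]
      constructor <;> linarith
  have n'B := bounded_of_summable n'0 n'1 hen ((Osum.mul_left _).add (Psum.mul_left _))
  set B1 := K * K + ∑' j, K * O j
  set B2 := K * K * K + α * K + ∑' j, (K ^ 2 * O j + 2 * K * P j)
  refine ⟨α, max Da (max B1 (B2 + α * K)), hα, fun ε hε => ?_,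
    fun k s hs => (hDa k s hs).trans (le_max_left _ _),
    fun k s hs => (dB k s hs).trans ((le_max_left _ _).trans (le_max_right _ _)),
    fun k s hs => le_trans ?_ ((le_max_right _ _).trans (le_max_right _ _))⟩
  · have := Osum.tendsto_atTop_zero.eventually (ge_mem_nhds hε)
    filter_upwards [this] with k hk s hs
    exact (hO k s hs).trans hk
  · have h1 : n k s - α * σ2 * k = n' k s + α * g s := by simp only [hn']; ring
    change |n k s - α * σ2 * k| ≤ _
    rw [h1]
    refine (abs_add_le _ _).trans (add_le_add (n'B k s hs) ?_)
    rw [abs_mul, abs_of_nonneg (by linarith : 0 ≤ α)]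
    exact mul_le_mul_of_nonneg_left (hg s hs) (by linarith)

end Chain

/-! ### The characteristic function by perturbation of the transition operator. -/

namespace Chain

variable {S ι : Type*} {C : Chain S ι} {ζ : S → ι → ℝ} {r b : S → ℝ}

lemma norm_exp_mul_I (x : ℝ) : ‖Complex.exp (x * Complex.I)‖ = 1 :=
  Complex.norm_exp_ofReal_mul_I x

lemma pathSum_exp_succ (θ : ℝ) (k : ℕ) (s : S) :
    C.pathSum ζ r b (k + 1) s (fun z => Complex.exp ((θ * z : ℝ) * Complex.I)) =
      C.avg s fun i => Complex.exp ((θ * ζ s i : ℝ) * Complex.I) *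
        C.pathSum ζ r b k (C.next s i) (fun z => Complex.exp ((θ * z : ℝ) * Complex.I)) := by
  refine avg_congr fun i _ => ?_
  rw [← pathSum_const_mul_complex]
  congr 1
  funext z
  rw [← Complex.exp_add]
  push_cast
  ring_nf

/-- Third order Taylor bound for the exponential on the imaginary axis. -/
lemma norm_exp_taylor_le (x : ℝ) :
    ‖Complex.exp (x * Complex.I) - (1 + x * Complex.I - (x ^ 2 / 2 : ℝ))‖ ≤
      |x| ^ 3 * Real.exp |x| := by
  have h := Complex.norm_exp_sub_sum_le_norm_mul_exp (x * Complex.I) 3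
  have h1 : ∑ m ∈ Finset.range 3, (x * Complex.I : ℂ) ^ m / m.factorial =
      1 + x * Complex.I - (x ^ 2 / 2 : ℝ) := by
    simp only [Finset.sum_range_succ, Finset.sum_range_zero, Nat.factorial]
    push_cast
    linear_combination (x ^ 2 / 2 : ℂ) * Complex.I_sq
  rw [h1] at h
  simpa using h

lemma norm_exp_sub_one_le (x : ℝ) : ‖Complex.exp (x * Complex.I) - 1‖ ≤ |x| := by
  have := Real.norm_exp_I_mul_ofReal_sub_one_le (x := x)
  rwa [mul_comm, Real.norm_eq_abs] at this

/-- The quadratic corrector makes the constant function an approximate eigenfunction of the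
perturbed transition operator. -/
lemma exists_approx_eigen {K σ2 : ℝ} {g : S → ℝ}
    (hζ : ∀ s ∈ C.R, ∀ i ∈ C.moves s, |ζ s i| ≤ K) (hg : ∀ s ∈ C.R, |g s| ≤ K)
    (hmean : ∀ s ∈ C.R, C.avg s (ζ s) = 0)
    (hvar : ∀ s ∈ C.R, C.avg s (fun i => ζ s i ^ 2 + g (C.next s i)) = σ2 + g s) :
    ∃ B : ℝ, 0 ≤ B ∧ ∀ θ : ℝ, |θ| ≤ 1 → ∀ s ∈ C.R,
      ‖C.avg s (fun i => Complex.exp ((θ * ζ s i : ℝ) * Complex.I) *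
          ((1 - θ ^ 2 / 2 * g (C.next s i) : ℝ) : ℂ)) -
        ((1 - θ ^ 2 / 2 * σ2 : ℝ) : ℂ) * ((1 - θ ^ 2 / 2 * g s : ℝ) : ℂ)‖ ≤ B * |θ| ^ 3 := by
  have hK : 0 ≤ K := (abs_nonneg _).trans (hg _ C.base_mem)
  refine ⟨K ^ 3 * Real.exp K * (1 + K) + (K + K ^ 2) * K + |σ2| * K, by positivity,
    fun θ hθ s hs => ?_⟩
  set E : ι → ℂ := fun i => Complex.exp ((θ * ζ s i : ℝ) * Complex.I) -
    (1 + (θ * ζ s i : ℝ) * Complex.I - ((θ * ζ s i) ^ 2 / 2 : ℝ)) with hE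
  have hE3 : ∀ i ∈ C.moves s, ‖E i‖ ≤ |θ| ^ 3 * (K ^ 3 * Real.exp K) := fun i hi => by
    refine (norm_exp_taylor_le _).trans ?_
    rw [abs_mul, mul_pow, mul_assoc]
    refine mul_le_mul_of_nonneg_left ?_ (by positivity)
    have h1 := hζ s hs i hi
    refine mul_le_mul (pow_le_pow_left₀ (abs_nonneg _) h1 3) (Real.exp_le_exp.2 ?_)
      (Real.exp_nonneg _) (by positivity)
    calc |θ| * |ζ s i| ≤ 1 * K := mul_le_mul hθ h1 (abs_nonneg _) zero_le_one
      _ = K := one_mul K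
  -- The first bracket is the part that `hmean` and `hvar` average exactly; each remaining term is
  -- `O(|θ|³)`.
  have split : ∀ i, Complex.exp ((θ * ζ s i : ℝ) * Complex.I) *
      ((1 - θ ^ 2 / 2 * g (C.next s i) : ℝ) : ℂ) =
      (1 + (θ * Complex.I) * (ζ s i : ℂ) +
        (-(θ ^ 2 / 2 : ℝ)) * ((ζ s i ^ 2 + g (C.next s i) : ℝ) : ℂ)) +
      (E i * ((1 - θ ^ 2 / 2 * g (C.next s i) : ℝ) : ℂ) +
      ((θ ^ 3 / 2 : ℝ) : ℂ) * (((θ / 2 * ζ s i ^ 2 : ℝ) - ζ s i * Complex.I) *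
        (g (C.next s i) : ℂ))) := fun i => by
    simp only [hE]
    push_cast
    ring
  have main : C.avg s (fun i => 1 + (θ * Complex.I) * (ζ s i : ℂ) +
      (-(θ ^ 2 / 2 : ℝ)) * ((ζ s i ^ 2 + g (C.next s i) : ℝ) : ℂ)) =
      1 - ((θ ^ 2 / 2 * (σ2 + g s) : ℝ) : ℂ) := by
    rw [avg_add, avg_add, avg_const hs, avg_const_mul_complex, avg_const_mul_complex,
      avg_ofReal, avg_ofReal, hvar s hs]
    rw [show C.avg s (fun i => ζ s i) = 0 from hmean s hs]
    push_cast
    ring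
  have hθ2 : θ ^ 2 ≤ 1 := by rw [← sq_abs]; exact pow_le_one₀ (abs_nonneg _) hθ
  simp only [split]
  rw [avg_add, main, avg_add]
  have b1 : ‖C.avg s (fun i => E i * ((1 - θ ^ 2 / 2 * g (C.next s i) : ℝ) : ℂ))‖ ≤
      |θ| ^ 3 * (K ^ 3 * Real.exp K) * (1 + K) := by
    refine norm_avg_le hs fun i hi => ?_
    rw [norm_mul]
    refine mul_le_mul (hE3 i hi) ?_ (norm_nonneg _) (by positivity)
    rw [Complex.norm_real, Real.norm_eq_abs]
    have h1 := abs_le.1 (hg _ (C.next_mem s hs i hi))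
    rw [abs_le]
    constructor <;> nlinarith [sq_nonneg θ]
  have b2 : ‖C.avg s (fun i => ((θ ^ 3 / 2 : ℝ) : ℂ) *
      (((θ / 2 * ζ s i ^ 2 : ℝ) - ζ s i * Complex.I) * (g (C.next s i) : ℂ)))‖ ≤
      |θ| ^ 3 * ((K ^ 2 + K) * K) := by
    refine norm_avg_le hs fun i hi => ?_
    have h1 := hζ s hs i hi
    have h2 := hg _ (C.next_mem s hs i hi)
    rw [norm_mul, norm_mul, Complex.norm_real, Complex.norm_real, Real.norm_eq_abs,
      Real.norm_eq_abs, abs_div, abs_pow, abs_two]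
    have h3 : ‖((θ / 2 * ζ s i ^ 2 : ℝ) : ℂ) - ζ s i * Complex.I‖ ≤ K ^ 2 + K := by
      refine (norm_sub_le _ _).trans (add_le_add ?_ ?_)
      · rw [Complex.norm_real, Real.norm_eq_abs, abs_mul, abs_div, abs_two, abs_pow]
        calc |θ| / 2 * |ζ s i| ^ 2 ≤ 1 * K ^ 2 := mul_le_mul (by linarith)
              (pow_le_pow_left₀ (abs_nonneg _) h1 2) (by positivity) zero_le_one
          _ = K ^ 2 := one_mul _
      · simpa using h1
    refine mul_le_mul ?_ (mul_le_mul h3 h2 (abs_nonneg _) (by positivity)) (by positivity)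
      (by positivity)
    have : 0 ≤ |θ| ^ 3 := by positivity
    linarith
  -- The cross term of the product of `1 - θ² σ2 / 2` and `1 - θ² g / 2`.
  have b3 : ‖((θ ^ 4 / 4 * (σ2 * g s) : ℝ) : ℂ)‖ ≤ |θ| ^ 3 * (|σ2| * K) := by
    rw [Complex.norm_real, Real.norm_eq_abs, abs_mul, abs_mul, abs_div, abs_pow]
    refine mul_le_mul ?_ (mul_le_mul_of_nonneg_left (hg s hs) (abs_nonneg _)) (by positivity)
      (by positivity)
    have h4 : |θ| ^ 4 ≤ |θ| ^ 3 := pow_le_pow_of_le_one (abs_nonneg _) hθ (by norm_num)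
    have : |(4 : ℝ)| = 4 := by norm_num
    rw [this]
    have : 0 ≤ |θ| ^ 4 := by positivity
    linarith
  calc _ = ‖C.avg s (fun i => E i * ((1 - θ ^ 2 / 2 * g (C.next s i) : ℝ) : ℂ)) +
      C.avg s (fun i => ((θ ^ 3 / 2 : ℝ) : ℂ) *
        (((θ / 2 * ζ s i ^ 2 : ℝ) - ζ s i * Complex.I) * (g (C.next s i) : ℂ))) -
      ((θ ^ 4 / 4 * (σ2 * g s) : ℝ) : ℂ)‖ := by
        congr 1
        push_cast
        ring
    _ ≤ _ := by
        refine (norm_sub_le _ _).trans ((add_le_add ((norm_add_le _ _).trans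
          (add_le_add b1 b2)) b3).trans (le_of_eq ?_))
        ring

/-- The characteristic function of the normalised total cost converges to that of the normal
distribution. -/
lemma tendsto_pathSum_exp {K σ2 α : ℝ} {g : S → ℝ}
    (hζ : ∀ s ∈ C.R, ∀ i ∈ C.moves s, |ζ s i| ≤ K) (hb : ∀ s ∈ C.R, |b s| ≤ K)
    (hg : ∀ s ∈ C.R, |g s| ≤ K) (hr : ∀ s ∈ C.R, 1 ≤ r s ∧ r s ≤ K)
    (hmean : ∀ s ∈ C.R, C.avg s (ζ s) = 0)
    (hvar : ∀ s ∈ C.R, C.avg s (fun i => ζ s i ^ 2 + g (C.next s i)) = σ2 + g s)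
    (hσ : 0 ≤ σ2)
    (hα : ∀ ε > 0, ∀ᶠ k in atTop, ∀ s ∈ C.R,
      |C.pathSum ζ r b k s (fun _ => (1 : ℝ)) - α| ≤ ε) {s : S} (hs : s ∈ C.R) :
    Tendsto (fun k : ℕ => C.pathSum ζ r b k s
      (fun z => Complex.exp (((√(k : ℝ))⁻¹ * z : ℝ) * Complex.I))) atTop
      (𝓝 ((α * Real.exp (-σ2 / 2) : ℝ) : ℂ)) := by
  have hK : 0 ≤ K := (abs_nonneg _).trans (hg _ C.base_mem)
  obtain ⟨B, hB, hB3⟩ := exists_approx_eigen hζ hg hmean hvar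
  set Φ : ℝ → ℕ → S → ℂ := fun θ k s =>
    C.pathSum ζ r b k s (fun z => Complex.exp ((θ * z : ℝ) * Complex.I)) with hΦ
  set a : ℕ → S → ℝ := fun k s => C.pathSum ζ r b k s (fun _ => (1 : ℝ)) with ha
  have Φ1 : ∀ θ k s, Φ θ (k + 1) s = C.avg s fun i =>
      Complex.exp ((θ * ζ s i : ℝ) * Complex.I) * Φ θ k (C.next s i) :=
    fun θ k s => pathSum_exp_succ θ k s
  have abound : ∀ k, ∀ s ∈ C.R, |a k s| ≤ K := fun k => by
    induction k with
    | zero =>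
      intro s hs
      have h1 := hr s hs
      have : a 0 s = r s := by simp [ha, pathSum]
      rw [this, abs_le]
      exact ⟨by linarith, h1.2⟩
    | succ k ih => exact op_abs_le ih
  -- Crude comparison of the exponential with 1. It is good only for boundedly many steps, and is
  -- used for the last `k0` steps of a path.
  have Φa : ∀ θ k, ∀ s ∈ C.R, ‖Φ θ k s - a k s‖ ≤ |θ| * (K ^ 2 * (k + 1)) := fun θ k => by
    induction k with
    | zero =>
      intro s hs
      have h0 : Φ θ 0 s - a 0 s = r s * (Complex.exp ((θ * b s : ℝ) * Complex.I) - 1) := by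
        simp [hΦ, ha, pathSum]; ring
      rw [h0, norm_mul, Complex.norm_real, Real.norm_eq_abs]
      have h1 := hr s hs
      have h2 := norm_exp_sub_one_le (θ * b s)
      rw [abs_mul] at h2
      calc |r s| * _ ≤ K * (|θ| * K) := mul_le_mul (abs_le.2 ⟨by linarith, h1.2⟩)
            (h2.trans (mul_le_mul_of_nonneg_left (hb s hs) (abs_nonneg _))) (norm_nonneg _) hK
        _ = _ := by push_cast; ring
    | succ k ih =>
      intro s hs
      have h0 : Φ θ (k + 1) s - a (k + 1) s = C.avg s fun i =>
          Complex.exp ((θ * ζ s i : ℝ) * Complex.I) * (Φ θ k (C.next s i) - a k (C.next s i)) +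
          (Complex.exp ((θ * ζ s i : ℝ) * Complex.I) - 1) * a k (C.next s i) := by
        have h1 : a (k + 1) s = C.avg s fun i => a k (C.next s i) := rfl
        rw [Φ1, h1, ← avg_ofReal, ← avg_sub]
        refine avg_congr fun i _ => ?_
        ring
      rw [h0]
      refine norm_avg_le hs fun i hi => ?_
      have hn := C.next_mem s hs i hi
      refine (norm_add_le _ _).trans ?_
      rw [norm_mul, norm_mul, norm_exp_mul_I, one_mul, Complex.norm_real, Real.norm_eq_abs]
      have h2 := norm_exp_sub_one_le (θ * ζ s i)
      rw [abs_mul] at h2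
      have h3 : ‖Complex.exp ((θ * ζ s i : ℝ) * Complex.I) - 1‖ * |a k (C.next s i)| ≤
          |θ| * K * K := mul_le_mul
        (h2.trans (mul_le_mul_of_nonneg_left (hζ s hs i hi) (abs_nonneg _))) (abound k _ hn)
        (abs_nonneg _) (by positivity)
      have h4 := ih _ hn
      rw [Nat.cast_succ]
      linarith
  set ψ : ℝ → S → ℂ := fun θ s => ((1 - θ ^ 2 / 2 * g s : ℝ) : ℂ) with hψ
  set lam : ℝ → ℂ := fun θ => ((1 - θ ^ 2 / 2 * σ2 : ℝ) : ℂ) with hlam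
  -- All other steps use the approximate eigenfunction. The twisted operator does not increase the
  -- sup norm, so an initial error persists without growing and each step adds at most `|α| * B *
  -- |θ|³`.
  have Φψ : ∀ θ, |θ| ≤ 1 → ‖lam θ‖ ≤ 1 → ∀ k ε, (∀ s ∈ C.R, ‖Φ θ k s - α * ψ θ s‖ ≤ ε) →
      ∀ j : ℕ, ∀ s ∈ C.R, ‖Φ θ (k + j) s - α * lam θ ^ j * ψ θ s‖ ≤
        ε + |α| * (B * |θ| ^ 3) * j := by
    intro θ hθ hl k ε h0 j
    induction j with
    | zero => simpa using h0
    | succ j ih =>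
      intro s hs
      have h1 : Φ θ (k + (j + 1)) s - α * lam θ ^ (j + 1) * ψ θ s =
          C.avg s (fun i => Complex.exp ((θ * ζ s i : ℝ) * Complex.I) *
            (Φ θ (k + j) (C.next s i) - α * lam θ ^ j * ψ θ (C.next s i))) +
          α * lam θ ^ j * (C.avg s (fun i => Complex.exp ((θ * ζ s i : ℝ) * Complex.I) *
            ψ θ (C.next s i)) - lam θ * ψ θ s) := by
        rw [← add_assoc, Φ1]
        simp only [mul_sub]
        rw [avg_sub, ← avg_const_mul_complex]
        have : ∀ i, Complex.exp ((θ * ζ s i : ℝ) * Complex.I) *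
            (α * lam θ ^ j * ψ θ (C.next s i)) = α * lam θ ^ j *
            (Complex.exp ((θ * ζ s i : ℝ) * Complex.I) * ψ θ (C.next s i)) := fun i => by ring
        simp only [this]
        ring
      rw [h1]
      refine (norm_add_le _ _).trans ?_
      have h2 : ‖C.avg s (fun i => Complex.exp ((θ * ζ s i : ℝ) * Complex.I) *
            (Φ θ (k + j) (C.next s i) - α * lam θ ^ j * ψ θ (C.next s i)))‖ ≤
          ε + |α| * (B * |θ| ^ 3) * j := by
        refine norm_avg_le hs fun i hi => ?_
        rw [norm_mul, norm_exp_mul_I, one_mul]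
        exact ih _ (C.next_mem s hs i hi)
      have h3 : ‖(α : ℂ) * lam θ ^ j * (C.avg s (fun i =>
          Complex.exp ((θ * ζ s i : ℝ) * Complex.I) * ψ θ (C.next s i)) - lam θ * ψ θ s)‖ ≤
          |α| * (B * |θ| ^ 3) := by
        rw [norm_mul, norm_mul, norm_pow, Complex.norm_real, Real.norm_eq_abs]
        refine mul_le_mul ?_ (hB3 θ hθ s hs) (norm_nonneg _) (abs_nonneg _)
        exact mul_le_of_le_one_right (abs_nonneg _) (pow_le_one₀ (norm_nonneg _) hl)
      rw [Nat.cast_succ]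
      linarith
  set θ : ℕ → ℝ := fun k => (√(k : ℝ))⁻¹ with hθ
  have θ0 : Tendsto θ atTop (𝓝 0) := tendsto_inv_atTop_zero.comp
    (Real.tendsto_sqrt_atTop.comp tendsto_natCast_atTop_atTop)
  have θnn : ∀ k, 0 ≤ θ k := fun k => inv_nonneg.2 (Real.sqrt_nonneg _)
  have θsq : ∀ k : ℕ, 0 < k → θ k ^ 2 = 1 / (k : ℝ) := fun k hk => by
    simp [hθ, Real.sq_sqrt]
  have hlim : ∀ k0 : ℕ, Tendsto (fun k => (α : ℂ) * lam (θ k) ^ (k - k0)) atTop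
      (𝓝 ((α * Real.exp (-σ2 / 2) : ℝ) : ℂ)) := by
    intro k0
    have h1 : Tendsto (fun k : ℕ => (1 - θ k ^ 2 / 2 * σ2) ^ k) atTop
        (𝓝 (Real.exp (-σ2 / 2))) := by
      refine (Real.tendsto_one_add_div_pow_exp (-σ2 / 2)).congr' ?_
      filter_upwards [eventually_gt_atTop 0] with k hk
      rw [θsq k hk]
      congr 1
      ring
    have h2 : Tendsto (fun k : ℕ => 1 - θ k ^ 2 / 2 * σ2) atTop (𝓝 1) := by
      have := ((θ0.pow 2).div_const 2).mul_const σ2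
      simpa using tendsto_const_nhds.sub this
    have h3 : Tendsto (fun k : ℕ => α * ((1 - θ k ^ 2 / 2 * σ2) ^ k /
        (1 - θ k ^ 2 / 2 * σ2) ^ k0)) atTop (𝓝 (α * Real.exp (-σ2 / 2))) := by
      have := (h1.div (h2.pow k0) (by simp)).const_mul α
      simpa using this
    have h4 : Tendsto (fun k : ℕ => α * (1 - θ k ^ 2 / 2 * σ2) ^ (k - k0)) atTop
        (𝓝 (α * Real.exp (-σ2 / 2))) := by
      refine h3.congr' ?_
      filter_upwards [h2.eventually_ne one_ne_zero, eventually_ge_atTop k0] with k hk hk0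
      rw [pow_sub₀ _ hk hk0, div_eq_mul_inv]
    have h5 := (Complex.continuous_ofReal.tendsto _).comp h4
    refine h5.congr fun k => ?_
    simp [hlam]
  rw [Metric.tendsto_atTop']
  intro ε hε
  -- The number `k0` is fixed before `k` tends to infinity: it makes the effect of the terminal
  -- weight almost constant, and for fixed `k0` the phases of these steps disappear as `θ k → 0`.
  obtain ⟨k0, hk0⟩ := (hα (ε / 4) (by positivity)).exists
  have e1 : Tendsto (fun k => θ k * (K ^ 2 * (k0 + 1)) + |α| * (θ k ^ 2 / 2 * K) +
      |α| * B * θ k + |α| * (θ k ^ 2 / 2 * K)) atTop (𝓝 0) := by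
    have := (((θ0.mul_const (K ^ 2 * (k0 + 1))).add
      ((((θ0.pow 2).div_const 2).mul_const K).const_mul |α|)).add (θ0.const_mul (|α| * B))).add
      ((((θ0.pow 2).div_const 2).mul_const K).const_mul |α|)
    simpa using this
  have e2 : ∀ᶠ k in atTop, θ k ^ 2 / 2 * σ2 ≤ 1 := by
    have : Tendsto (fun k => θ k ^ 2 / 2 * σ2) atTop (𝓝 0) := by
      simpa using ((θ0.pow 2).div_const 2).mul_const σ2
    exact this.eventually (ge_mem_nhds one_pos)
  have e3 := Metric.tendsto_atTop'.1 (hlim k0) (ε / 4) (by positivity)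
  obtain ⟨n3, hn3⟩ := e3
  obtain ⟨N, hN⟩ := eventually_atTop.1 ((e1.eventually (gt_mem_nhds (show (0 : ℝ) < ε / 4 by
    positivity))).and (e2.and ((θ0.eventually (ge_mem_nhds one_pos)).and
    ((eventually_gt_atTop n3).and (eventually_gt_atTop k0)))))
  refine ⟨N, fun k hk => ?_⟩
  obtain ⟨h1, h2, h3, h4, h5⟩ := hN k hk.le
  have hθk : |θ k| = θ k := abs_of_nonneg (θnn k)
  have hψ1 : ∀ s ∈ C.R, ‖1 - ψ (θ k) s‖ ≤ θ k ^ 2 / 2 * K := fun s hs => by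
    have : 1 - ψ (θ k) s = ((θ k ^ 2 / 2 * g s : ℝ) : ℂ) := by simp [hψ]
    rw [this, Complex.norm_real, Real.norm_eq_abs, abs_mul, abs_of_nonneg (by positivity)]
    exact mul_le_mul_of_nonneg_left (hg s hs) (by positivity)
  have hl1 : ‖lam (θ k)‖ ≤ 1 := by
    rw [Complex.norm_real, Real.norm_eq_abs, abs_le]
    have : 0 ≤ θ k ^ 2 / 2 * σ2 := by positivity
    constructor <;> linarith
  have start : ∀ s ∈ C.R, ‖Φ (θ k) k0 s - α * ψ (θ k) s‖ ≤
      θ k * (K ^ 2 * (k0 + 1)) + ε / 4 + |α| * (θ k ^ 2 / 2 * K) := fun s hs => by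
    have : Φ (θ k) k0 s - α * ψ (θ k) s = (Φ (θ k) k0 s - a k0 s) + ((a k0 s - α : ℝ) : ℂ) +
        α * (1 - ψ (θ k) s) := by push_cast; ring
    rw [this]
    refine (norm_add₃_le).trans (add_le_add (add_le_add ?_ ?_) ?_)
    · have := Φa (θ k) k0 s hs
      rwa [hθk] at this
    · rw [Complex.norm_real]
      exact hk0 s hs
    · rw [norm_mul, Complex.norm_real, Real.norm_eq_abs]
      exact mul_le_mul_of_nonneg_left (hψ1 s hs) (abs_nonneg _)
  have fin := Φψ (θ k) (by rw [hθk]; exact h3) hl1 k0 _ start (k - k0) s hs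
  rw [Nat.add_sub_cancel' h5.le, hθk] at fin
  have d3 := hn3 k h4
  rw [dist_eq_norm] at d3 ⊢
  -- Fewer than `k` errors of order `k ^ (-3/2)`.
  have cube : |α| * (B * θ k ^ 3) * ((k - k0 : ℕ) : ℝ) ≤ |α| * B * θ k := by
    have hkpos : 0 < k := by omega
    have h6 : θ k ^ 2 * ((k - k0 : ℕ) : ℝ) ≤ 1 := by
      rw [θsq k hkpos, div_mul_eq_mul_div, one_mul,
        div_le_one (by exact_mod_cast hkpos)]
      exact_mod_cast Nat.sub_le _ _
    have h7 : 0 ≤ |α| * B * θ k := by have := θnn k; positivity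
    calc |α| * (B * θ k ^ 3) * ((k - k0 : ℕ) : ℝ) =
        |α| * B * θ k * (θ k ^ 2 * ((k - k0 : ℕ) : ℝ)) := by ring
      _ ≤ |α| * B * θ k * 1 := mul_le_mul_of_nonneg_left h6 h7
      _ = _ := mul_one _
  have last : ‖(α : ℂ) * lam (θ k) ^ (k - k0) * ψ (θ k) s - α * lam (θ k) ^ (k - k0)‖ ≤
      |α| * (θ k ^ 2 / 2 * K) := by
    have : (α : ℂ) * lam (θ k) ^ (k - k0) * ψ (θ k) s - α * lam (θ k) ^ (k - k0) =
      -(α * lam (θ k) ^ (k - k0) * (1 - ψ (θ k) s)) := by ring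
    rw [this, norm_neg, norm_mul, norm_mul, norm_pow, Complex.norm_real, Real.norm_eq_abs]
    refine mul_le_mul ?_ (hψ1 s hs) (norm_nonneg _) (abs_nonneg _)
    exact mul_le_of_le_one_right (abs_nonneg _) (pow_le_one₀ (norm_nonneg _) hl1)
  calc ‖Φ (θ k) k s - ((α * Real.exp (-σ2 / 2) : ℝ) : ℂ)‖ =
      ‖(Φ (θ k) k s - α * lam (θ k) ^ (k - k0) * ψ (θ k) s) +
      (α * lam (θ k) ^ (k - k0) * ψ (θ k) s - α * lam (θ k) ^ (k - k0)) +
      (α * lam (θ k) ^ (k - k0) - ((α * Real.exp (-σ2 / 2) : ℝ) : ℂ))‖ := by congr 1; ring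
    _ ≤ _ := norm_add₃_le
    _ < ε := by linarith

end Chain

/-! ### Normalised path sums of a cost with correctors. -/

namespace Chain

variable {S ι : Type*} {C : Chain S ι} {ζ : S → ι → ℝ} {r b : S → ℝ}

lemma one_le_pathSum_one (hr : ∀ s ∈ C.R, 1 ≤ r s) (k : ℕ) :
    ∀ s ∈ C.R, 1 ≤ C.pathSum ζ r b k s (fun _ => (1 : ℝ)) := by
  induction k with
  | zero => simpa [pathSum] using hr
  | succ k ih =>
    intro s hs
    have h1 := avg_mono hs (F := fun _ => (1 : ℝ)) fun i hi => ih _ (C.next_mem s hs i hi)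
    rw [avg_const hs] at h1
    exact h1

/-- Mean, second moment and limiting characteristic function of an additive functional of a chain
for which the first and second order corrector equations have been solved. -/
theorem asymptotics {K σ2 : ℝ} {g₁ g₂ : S → ℝ}
    (hζ : ∀ s ∈ C.R, ∀ i ∈ C.moves s, |ζ s i + g₁ (C.next s i) - g₁ s| ≤ K)
    (hb : ∀ s ∈ C.R, |b s - g₁ s| ≤ K) (hg₁ : ∀ s ∈ C.R, |g₁ s| ≤ K) (hg₂ : ∀ s ∈ C.R, |g₂ s| ≤ K)
    (hr : ∀ s ∈ C.R, 1 ≤ r s ∧ r s ≤ K)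
    (hmean : ∀ s ∈ C.R, C.avg s (fun i => ζ s i + g₁ (C.next s i) - g₁ s) = 0)
    (hvar : ∀ s ∈ C.R, C.avg s (fun i => (ζ s i + g₁ (C.next s i) - g₁ s) ^ 2 +
      g₂ (C.next s i)) = σ2 + g₂ s) (hσ : 0 ≤ σ2) {s : S} (hs : s ∈ C.R) :
    (∃ D : ℝ, ∀ k : ℕ,
      |C.pathSum ζ r b k s (fun z => z) / C.pathSum ζ r b k s (fun _ => (1 : ℝ))| ≤ D ∧
      |C.pathSum ζ r b k s (fun z => z ^ 2) / C.pathSum ζ r b k s (fun _ => (1 : ℝ)) -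
        σ2 * k| ≤ D) ∧
    Tendsto (fun k : ℕ => C.pathSum ζ r b k s
      (fun z => Complex.exp (((√(k : ℝ))⁻¹ * z : ℝ) * Complex.I)) /
        (C.pathSum ζ r b k s (fun _ => (1 : ℝ)) : ℝ)) atTop (𝓝 (Real.exp (-σ2 / 2) : ℝ)) := by
  have hK : 0 ≤ K := (abs_nonneg _).trans (hg₁ _ C.base_mem)
  obtain ⟨α, D, hα1, hα, ha, hd, hn⟩ := exists_moment_bounds hζ hb hg₂ hr hmean hvar
  have hexp := tendsto_pathSum_exp hζ hb hg₂ hr hmean hvar hσ hα hs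
  have hD : 0 ≤ D := (abs_nonneg _).trans (hd 0 s hs)
  have a1 := fun k => one_le_pathSum_one (ζ := fun s i => ζ s i + g₁ (C.next s i) - g₁ s)
    (b := fun s => b s - g₁ s) (fun s hs => (hr s hs).1) k s hs
  set ζ' : S → ι → ℝ := fun s i => ζ s i + g₁ (C.next s i) - g₁ s
  set b' : S → ℝ := fun s => b s - g₁ s
  set a : ℕ → ℝ := fun k => C.pathSum ζ' r b' k s (fun _ => (1 : ℝ)) with hadef
  set d : ℕ → ℝ := fun k => C.pathSum ζ' r b' k s (fun z => z) with hddef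
  set n : ℕ → ℝ := fun k => C.pathSum ζ' r b' k s (fun z => z ^ 2) with hndef
  have e0 : ∀ k, C.pathSum ζ r b k s (fun _ => (1 : ℝ)) = a k := fun k => pathSum_corrector g₁ k s _
  have e1 : ∀ k, C.pathSum ζ r b k s (fun z => z) = g₁ s * a k + d k := fun k => by
    rw [pathSum_corrector g₁ k s, pathSum_add k s (fun _ => g₁ s), hadef]
    simp only
    rw [← pathSum_const_mul]
    simp only [mul_one]
    rfl
  have e2 : ∀ k, C.pathSum ζ r b k s (fun z => z ^ 2) =
      g₁ s ^ 2 * a k + (2 * g₁ s * d k + n k) := fun k => by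
    rw [pathSum_corrector g₁ k s]
    simp only [hadef, hddef, hndef]
    rw [← pathSum_const_mul, ← pathSum_const_mul, ← pathSum_add, ← pathSum_add]
    congr 1
    funext z
    ring
  have e3 : ∀ k, C.pathSum ζ r b k s
      (fun z => Complex.exp (((√(k : ℝ))⁻¹ * z : ℝ) * Complex.I)) =
      Complex.exp (((√(k : ℝ))⁻¹ * g₁ s : ℝ) * Complex.I) * C.pathSum ζ' r b' k s
      (fun z => Complex.exp (((√(k : ℝ))⁻¹ * z : ℝ) * Complex.I)) := fun k => by
    rw [pathSum_corrector g₁ k s, ← pathSum_const_mul_complex]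
    congr 1
    funext z
    rw [← Complex.exp_add]
    push_cast
    ring_nf
  have hga := hg₁ s hs
  have div_le : ∀ k x B, |x| ≤ B → |x / a k| ≤ B := fun k x B hx => by
    rw [abs_div, abs_of_pos (by linarith [a1 k] : 0 < a k)]
    exact (div_le_self (abs_nonneg _) (a1 k)).trans hx
  refine ⟨⟨max (K + D) (K ^ 2 + (2 * K * D + D + σ2 * D)), fun k => ⟨?_, ?_⟩⟩, ?_⟩
  · have hk : a k ≠ 0 := by linarith [a1 k]
    rw [e1, e0, add_div, mul_div_cancel_right₀ _ hk]
    refine le_trans ((abs_add_le _ _).trans (add_le_add hga ?_)) (le_max_left _ _)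
    exact div_le _ _ _ (hd k s hs)
  · have hk : a k ≠ 0 := by linarith [a1 k]
    -- The second moment is known relative to `α * σ2 * k`, while the normalisation is by `a k`. The
    -- difference `σ2 * k * (a k - α)` is bounded since `a k - α = O(1/k)`.
    have h1 : (g₁ s ^ 2 * a k + (2 * g₁ s * d k + n k)) / a k - σ2 * k =
        g₁ s ^ 2 + (2 * g₁ s * d k + (n k - α * σ2 * k) + -(σ2 * (k * (a k - α)))) / a k := by
      field_simp
      ring
    rw [e2, e0, h1]
    refine le_trans ((abs_add_le _ _).trans (add_le_add ?_ (div_le _ _ _ ?_))) (le_max_right _ _)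
    · rw [abs_pow]
      exact pow_le_pow_left₀ (abs_nonneg _) hga 2
    · refine (abs_add_three _ _ _).trans (add_le_add (add_le_add ?_ (hn k s hs)) ?_)
      · rw [abs_mul, abs_mul, abs_two]
        exact mul_le_mul (by linarith) (hd k s hs) (abs_nonneg _) (by positivity)
      · rw [abs_neg, abs_mul, abs_of_nonneg hσ, abs_mul, Nat.abs_cast]
        exact mul_le_mul_of_nonneg_left (ha k s hs) hσ
  · have ta : Tendsto a atTop (𝓝 α) := by
      rw [Metric.tendsto_atTop']
      intro ε hε
      obtain ⟨N, hN⟩ := eventually_atTop.1 (hα (ε / 2) (half_pos hε))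
      exact ⟨N, fun k hk => (hN k hk.le s hs).trans_lt (half_lt_self hε)⟩
    have ta' : Tendsto (fun k => (a k : ℂ)) atTop (𝓝 (α : ℂ)) :=
      (Complex.continuous_ofReal.tendsto _).comp ta
    have tθ : Tendsto (fun k : ℕ => Complex.exp (((√(k : ℝ))⁻¹ * g₁ s : ℝ) * Complex.I)) atTop
        (𝓝 1) := by
      have h1 : Tendsto (fun k : ℕ => (√(k : ℝ))⁻¹ * g₁ s) atTop (𝓝 0) := by
        have : Tendsto (fun k : ℕ => (√(k : ℝ))⁻¹) atTop (𝓝 0) := tendsto_inv_atTop_zero.comp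
          (Real.tendsto_sqrt_atTop.comp tendsto_natCast_atTop_atTop)
        simpa using this.mul_const (g₁ s)
      have h2 : Continuous fun x : ℝ => Complex.exp ((x : ℂ) * Complex.I) := by fun_prop
      have h3 := (h2.tendsto 0).comp h1
      simp only [Complex.ofReal_zero, zero_mul, Complex.exp_zero] at h3
      exact h3
    have hα0 : (α : ℂ) ≠ 0 := by
      rw [Complex.ofReal_ne_zero]
      linarith
    have := (tθ.mul hexp).div ta' hα0
    rw [one_mul, Complex.ofReal_mul, mul_div_cancel_left₀ _ hα0] at this
    refine this.congr fun k => ?_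
    rw [Pi.div_apply, e3, e0]

end Chain

/-! ### The digit automaton and the Markov chain of digits and carries. -/

section

/-- The digits that may follow the digit `x` (at the next more significant position). -/
def allowed (q : ℕ) (x : ℤ) : Finset ℤ :=
  (Finset.Icc (-((q : ℤ) / 2)) ((q : ℤ) / 2)).filter fun d =>
    |x| = (q : ℤ) / 2 → 0 ≤ x.sign * d ∧ x.sign * d ≤ (q : ℤ) / 2 - 1

lemma mem_allowed {q : ℕ} {x d : ℤ} : d ∈ allowed q x ↔
    (-((q : ℤ) / 2) ≤ d ∧ d ≤ (q : ℤ) / 2) ∧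
      (|x| = (q : ℤ) / 2 → 0 ≤ x.sign * d ∧ x.sign * d ≤ (q : ℤ) / 2 - 1) := by
  simp [allowed]

/-- The words of length `ℓ` that may follow the digit `x` in a symmetric signed digit expansion. -/
def words (q : ℕ) : (ℓ : ℕ) → ℤ → Finset (Fin ℓ → ℤ)
  | 0, _ => Finset.univ
  | ℓ + 1, x => (allowed q x).biUnion fun d =>
      (words q ℓ d).map ⟨Fin.cons (α := fun _ => ℤ) d, Fin.cons_right_injective (α := fun _ => ℤ) d⟩

lemma mem_words_succ {q ℓ : ℕ} {x : ℤ} {w : Fin (ℓ + 1) → ℤ} :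
    w ∈ words q (ℓ + 1) x ↔ w 0 ∈ allowed q x ∧ Fin.tail w ∈ words q ℓ (w 0) := by
  simp only [words, Finset.mem_biUnion, Finset.mem_map, Function.Embedding.coeFn_mk]
  constructor
  · rintro ⟨d, hd, v, hv, rfl⟩
    simpa using ⟨hd, hv⟩
  · rintro ⟨h1, h2⟩
    exact ⟨w 0, h1, Fin.tail w, h2, Fin.cons_self_tail w⟩

lemma sum_words_succ {q ℓ : ℕ} {x : ℤ} {V : Type*} [AddCommMonoid V]
    (F : (Fin (ℓ + 1) → ℤ) → V) :
    ∑ w ∈ words q (ℓ + 1) x, F w =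
      ∑ d ∈ allowed q x, ∑ w ∈ words q ℓ d, F (Fin.cons (α := fun _ => ℤ) d w) := by
  rw [words, Finset.sum_biUnion]
  · simp
  · intro d _ e _ hde
    rw [Function.onFun, Finset.disjoint_left]
    intro w hw hw'
    simp only [Finset.mem_map, Function.Embedding.coeFn_mk] at hw hw'
    obtain ⟨v, _, rfl⟩ := hw
    obtain ⟨u, _, hu⟩ := hw'
    have := congrFun hu 0
    simp at this
    exact hde this.symm

lemma mem_words_iff {q ℓ : ℕ} {x : ℤ} {w : Fin ℓ → ℤ} :
    w ∈ words q ℓ x ↔ IsSSDE q w ∧ ∀ hℓ : 0 < ℓ, w ⟨0, hℓ⟩ ∈ allowed q x := by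
  induction ℓ generalizing x with
  | zero =>
    simp only [words, IsSSDE, Finset.mem_univ, true_iff]
    exact ⟨⟨fun j => j.elim0, fun j hj => by omega⟩, fun hℓ => by omega⟩
  | succ ℓ ih =>
    rw [mem_words_succ, ih]
    constructor
    · rintro ⟨h0, ⟨h1, h2⟩, h3⟩
      refine ⟨⟨fun j => ?_, fun j hj hh => ?_⟩, fun _ => h0⟩
      · refine Fin.cases ?_ (fun j => h1 j) j
        exact (mem_allowed.1 h0).1
      · rcases j with _ | j
        · exact (mem_allowed.1 (h3 (by omega))).2 hh
        · exact h2 j (by omega) hh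
    · rintro ⟨⟨h1, h2⟩, h3⟩
      refine ⟨h3 (by omega), ⟨fun j => h1 j.succ, fun j hj hh => h2 (j + 1) (by omega) hh⟩,
        fun hℓ => mem_allowed.2 ⟨h1 (Fin.succ ⟨0, hℓ⟩), fun hh => h2 0 (by omega) hh⟩⟩

/-- The digit 0 is not of absolute value `q/2`, so it puts no constraint on its successor. -/
lemma coe_words_zero {q ℓ : ℕ} (hq : 2 ≤ q) : (words q ℓ 0 : Set (Fin ℓ → ℤ)) = expansions q ℓ := by
  ext w
  rw [Finset.mem_coe, mem_words_iff, expansions, Set.mem_ofPred_eq]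
  refine ⟨fun h => h.1, fun h => ⟨h, fun hℓ => mem_allowed.2 ⟨h.1 _, fun h0 => ?_⟩⟩⟩
  simp only [abs_zero] at h0
  omega

/-- The relative number of continuations of an expansion after the digit `x`. -/
def digitWeight (q : ℕ) (x : ℤ) : ℝ := if |x| = (q : ℤ) / 2 then 1 / 2 else 1

lemma digitWeight_pos (q : ℕ) (x : ℤ) : 0 < digitWeight q x := by
  unfold digitWeight; split_ifs <;> norm_num

lemma digitWeight_le_one (q : ℕ) (x : ℤ) : digitWeight q x ≤ 1 := by
  unfold digitWeight; split_ifs <;> norm_num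

lemma half_le_digitWeight (q : ℕ) (x : ℤ) : 1 / 2 ≤ digitWeight q x := by
  unfold digitWeight; split_ifs <;> norm_num

lemma digitWeight_zero {q : ℕ} (hq : 2 ≤ q) : digitWeight q 0 = 1 := by
  rw [digitWeight, if_neg]
  rw [abs_zero]
  omega

lemma digitWeight_neg (q : ℕ) (x : ℤ) : digitWeight q (-x) = digitWeight q x := by
  simp [digitWeight]

variable {h : ℕ}

lemma two_mul_ediv (h : ℕ) : (((2 * h : ℕ) : ℤ)) / 2 = h := by omega

lemma sum_allowed_interior (h1 : 1 ≤ h) {x : ℤ} (hx : |x| < h) (f : ℤ → ℝ) :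
    ∑ d ∈ allowed (2 * h) x, digitWeight (2 * h) d * f d =
      ∑ d ∈ Finset.Icc (-(h : ℤ) + 1) (h - 1), f d + (f h + f (-h)) / 2 := by
  have e : allowed (2 * h) x = insert (h : ℤ) (insert (-(h : ℤ))
      (Finset.Icc (-(h : ℤ) + 1) (h - 1))) := by
    ext d
    rw [mem_allowed, two_mul_ediv]
    simp only [Finset.mem_insert, Finset.mem_Icc]
    constructor
    · omega
    · intro hd
      exact ⟨by omega, fun hh => by omega⟩
  rw [e, Finset.sum_insert, Finset.sum_insert]
  · have e2 : ∀ d ∈ Finset.Icc (-(h : ℤ) + 1) (h - 1), digitWeight (2 * h) d * f d = f d := by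
      intro d hd
      rw [Finset.mem_Icc] at hd
      rw [digitWeight, two_mul_ediv, if_neg, one_mul]
      rw [abs_eq (by omega)]
      omega
    rw [Finset.sum_congr rfl e2, digitWeight_neg]
    have : digitWeight (2 * h) h = 1 / 2 := by simp [digitWeight]
    rw [this]
    ring
  · simp
  · simp only [Finset.mem_insert, Finset.mem_Icc]
    omega

lemma sum_allowed_pos (h1 : 1 ≤ h) (f : ℤ → ℝ) :
    ∑ d ∈ allowed (2 * h) h, digitWeight (2 * h) d * f d =
      ∑ d ∈ Finset.Icc (0 : ℤ) (h - 1), f d := by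
  have e : allowed (2 * h) h = Finset.Icc (0 : ℤ) (h - 1) := by
    ext d
    rw [mem_allowed, two_mul_ediv, Int.sign_eq_one_of_pos (by omega)]
    simp only [Finset.mem_Icc, Nat.abs_cast, one_mul, true_implies]
    omega
  rw [e]
  refine Finset.sum_congr rfl fun d hd => ?_
  rw [Finset.mem_Icc] at hd
  rw [digitWeight, two_mul_ediv, if_neg, one_mul]
  rw [abs_eq (by omega)]
  omega

lemma mem_allowed_neg {q : ℕ} {x d : ℤ} : -d ∈ allowed q (-x) ↔ d ∈ allowed q x := by
  rw [mem_allowed, mem_allowed, abs_neg, Int.sign_neg, neg_mul_neg]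
  refine and_congr_left fun _ => ?_
  omega

lemma sum_allowed_neg {q : ℕ} {x : ℤ} {V : Type*} [AddCommMonoid V] (f : ℤ → V) :
    ∑ d ∈ allowed q (-x), f d = ∑ d ∈ allowed q x, f (-d) := by
  refine Finset.sum_nbij' (fun d => -d) (fun d => -d) (fun d hd => ?_) (fun d hd => ?_)
    (fun _ _ => neg_neg _) (fun _ _ => neg_neg _) (fun d _ => by rw [neg_neg])
  · rw [← mem_allowed_neg, neg_neg]; exact hd
  · exact mem_allowed_neg.2 hd

/-- The eigenvector equation with eigenvalue `q = 2 * h`, which makes the transition weights sum to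
1. After an interior digit come `2 * h - 1` digits of weight 1 and two of weight 1/2; after `±h`
come `h` digits of weight 1, half as much. -/
lemma sum_digitWeight (h1 : 1 ≤ h) {x : ℤ} (hx : |x| ≤ h) :
    ∑ d ∈ allowed (2 * h) x, digitWeight (2 * h) d = 2 * h * digitWeight (2 * h) x := by
  have key : ∑ d ∈ allowed (2 * h) (h : ℤ), digitWeight (2 * h) d = 2 * h * (1 / 2) := by
    have := sum_allowed_pos h1 (fun _ => 1)
    simp only [mul_one] at this
    rw [this]
    simp
    ring
  have hw : digitWeight (2 * h) h = 1 / 2 := by simp [digitWeight]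
  rcases lt_or_eq_of_le hx with hx | hx
  · have := sum_allowed_interior h1 hx (fun _ => 1)
    simp only [mul_one] at this
    rw [this, digitWeight, two_mul_ediv, if_neg (by omega)]
    have hc : ((2 * h - 1 : ℕ) : ℝ) = 2 * h - 1 := by
      rw [Nat.cast_sub (by omega)]; push_cast; ring
    have hc' : (Finset.Icc (-(h : ℤ) + 1) (h - 1)).card = 2 * h - 1 := by
      rw [Int.card_Icc]; omega
    rw [Finset.sum_const, hc', nsmul_eq_mul, hc]
    ring
  · rcases (abs_eq (by omega)).1 hx with rfl | rfl
    · rw [key, hw]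
    · rw [sum_allowed_neg, digitWeight_neg, hw, ← key]
      exact Finset.sum_congr rfl fun d _ => digitWeight_neg _ d

lemma zero_mem_allowed {q : ℕ} (hq : 2 ≤ q) (x : ℤ) : 0 ∈ allowed q x := by
  rw [mem_allowed]
  refine ⟨⟨by omega, by omega⟩, fun _ => ?_⟩
  rw [mul_zero]
  exact ⟨le_rfl, by omega⟩

lemma abs_nextCarry_le (q : ℕ) (a s : ℤ) : |nextCarry q a s| ≤ 1 := by
  simp only [nextCarry]
  split_ifs <;> simp

lemma nextCarry_neg {q : ℕ} (hq : 2 ≤ q) (a s : ℤ) : nextCarry q (-a) (-s) = -nextCarry q a s := by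
  simp only [nextCarry]
  split_ifs <;> omega

/-- The triples of a pair of digits and a carry into their position that can occur. -/
def reachable (h : ℕ) : Set (ℤ × ℤ × ℤ) :=
  {s | |s.1| ≤ h ∧ |s.2.1| ≤ h ∧ |s.2.2| ≤ 1 ∧ (h = 1 → |s.1| = 1 → |s.2.1| = 1 → s.2.2 = 0)}

/-- Only `h = 1` needs an argument. There two nonzero digits at one position are preceded by two
zeros, so the previous sum is just a carry. The new digitwise sum is `-2`, `0` or `2`, and for these
values the rule for sums `±h` produces no carry. -/
lemma reachable_next {s : ℤ × ℤ × ℤ} (hs : s ∈ reachable h) {i : ℤ × ℤ}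
    (hi : i ∈ allowed (2 * h) s.1 ×ˢ allowed (2 * h) s.2.1) :
    ((i.1, i.2, nextCarry (2 * h) (s.1 + s.2.1 + s.2.2) (i.1 + i.2)) : ℤ × ℤ × ℤ) ∈
      reachable h := by
  obtain ⟨x, y, c⟩ := s
  obtain ⟨x', y'⟩ := i
  simp only [reachable, Finset.mem_product, mem_allowed, two_mul_ediv, Set.mem_ofPred_eq] at hs hi ⊢
  obtain ⟨⟨hx', hxx⟩, hy', hyy⟩ := hi
  refine ⟨abs_le.2 hx', abs_le.2 hy', abs_nextCarry_le _ _ _, fun hh ex ey => ?_⟩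
  subst hh
  have aux : ∀ x x' : ℤ, |x| ≤ 1 → |x'| = 1 →
      (|x| = 1 → 0 ≤ x.sign * x' ∧ x.sign * x' ≤ 1 - 1) → x = 0 := by
    intro x x' b1 b2 b3
    by_contra hne
    have b4 : |x| = 1 := by
      have := Int.one_le_abs hne
      omega
    have b5 : x.sign * x' = 0 := by
      have := b3 b4
      omega
    rcases mul_eq_zero.1 b5 with b6 | b6
    · exact hne (Int.sign_eq_zero_iff_zero.1 b6)
    · simp [b6] at b2
  have hx0 := aux x x' (by simpa using hs.1) ex (by simpa using hxx)
  have hy0 := aux y y' (by simpa using hs.2.1) ey (by simpa using hyy)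
  have hc := abs_le.1 hs.2.2.1
  subst hx0 hy0
  rw [abs_eq zero_le_one] at ex ey
  simp only [nextCarry]
  split_ifs <;> omega

/-- The Markov chain of the pairs of digits together with the carry into their position, started
at the states that can occur. -/
def carryChain (h : ℕ) (h1 : 1 ≤ h) : Chain (ℤ × ℤ × ℤ) (ℤ × ℤ) where
  moves s := allowed (2 * h) s.1 ×ˢ allowed (2 * h) s.2.1
  weight s i := digitWeight (2 * h) i.1 * digitWeight (2 * h) i.2 /
    ((2 * h) ^ 2 * (digitWeight (2 * h) s.1 * digitWeight (2 * h) s.2.1))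
  next s i := (i.1, i.2, nextCarry (2 * h) (s.1 + s.2.1 + s.2.2) (i.1 + i.2))
  R := reachable h
  base := (0, 0, 0)
  δ := 1 / (2 * h) ^ 2 * (1 / (2 * h) ^ 2)
  base_mem := by simp [reachable]
  weight_nonneg s _ i _ := by
    have := digitWeight_pos (2 * h)
    have a1 := this i.1
    have a2 := this i.2
    have a3 := this s.1
    have a4 := this s.2.1
    positivity
  sum_weight s hs := by
    have h0 : (0 : ℝ) < h := by exact_mod_cast h1
    have a3 := digitWeight_pos (2 * h) s.1
    have a4 := digitWeight_pos (2 * h) s.2.1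
    rw [← Finset.sum_div, Finset.sum_product, ← Finset.sum_mul_sum, sum_digitWeight h1 hs.1,
      sum_digitWeight h1 hs.2.1]
    field_simp
  next_mem s hs i hi := reachable_next hs hi
  δ_pos := by
    have h0 : (0 : ℝ) < h := by exact_mod_cast h1
    positivity
  minorization f hf s hs := by
    have hq : 2 ≤ 2 * h := by omega
    have h0 : (0 : ℝ) < h := by exact_mod_cast h1
    have wnn : ∀ s i : ℤ × ℤ, 0 ≤ digitWeight (2 * h) i.1 * digitWeight (2 * h) i.2 /
        ((2 * h) ^ 2 * (digitWeight (2 * h) s.1 * digitWeight (2 * h) s.2)) := fun s i => by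
      have := digitWeight_pos (2 * h)
      have a1 := this i.1
      have a2 := this i.2
      have a3 := this s.1
      have a4 := this s.2
      positivity
    have wle : ∀ x y : ℤ, 1 / (2 * (h : ℝ)) ^ 2 ≤ digitWeight (2 * h) 0 *
        digitWeight (2 * h) 0 / ((2 * h) ^ 2 * (digitWeight (2 * h) x * digitWeight (2 * h) y)) := by
      intro x y
      have a3 := digitWeight_pos (2 * h) x
      have a4 := digitWeight_pos (2 * h) y
      rw [digitWeight_zero hq, one_mul]
      refine one_div_le_one_div_of_le (by positivity) (mul_le_of_le_one_right (by positivity) ?_)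
      exact mul_le_one₀ (digitWeight_le_one _ _) a4.le (digitWeight_le_one _ _)
    -- A carry that meets zero digits dies out, even for `h = 1`, where it equals `±h` but the next
    -- digitwise sum is 0. This is why two steps suffice.
    have nc : ∀ a, nextCarry (2 * h) (nextCarry (2 * h) a 0) 0 = 0 := fun a => by
      simp only [nextCarry]
      split_ifs <;> omega
    have z : ∀ s : ℤ × ℤ × ℤ, ((0, 0) : ℤ × ℤ) ∈
        allowed (2 * h) s.1 ×ˢ allowed (2 * h) s.2.1 := fun s =>
      Finset.mem_product.2 ⟨zero_mem_allowed hq _, zero_mem_allowed hq _⟩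
    have step : ∀ F : ℤ × ℤ × ℤ → ℝ, (∀ s ∈ reachable h, 0 ≤ F s) → ∀ s ∈ reachable h,
        1 / (2 * (h : ℝ)) ^ 2 * F (0, 0, nextCarry (2 * h) (s.1 + s.2.1 + s.2.2) 0) ≤
        ∑ i ∈ allowed (2 * h) s.1 ×ˢ allowed (2 * h) s.2.1,
          digitWeight (2 * h) i.1 * digitWeight (2 * h) i.2 /
          ((2 * h) ^ 2 * (digitWeight (2 * h) s.1 * digitWeight (2 * h) s.2.1)) *
          F (i.1, i.2, nextCarry (2 * h) (s.1 + s.2.1 + s.2.2) (i.1 + i.2)) := by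
      intro F hF s hs
      refine le_trans ?_ (Finset.single_le_sum (fun i hi => mul_nonneg (wnn (s.1, s.2.1) i)
        (hF _ (reachable_next hs hi))) (z s))
      exact mul_le_mul_of_nonneg_right (wle _ _) (hF _ (reachable_next hs (z s)))
    have s1 := step _ (fun t ht => le_trans (mul_nonneg (by positivity) (hf _
      (reachable_next ht (z t)))) (step f hf t ht)) s hs
    refine le_trans ?_ s1
    rw [mul_assoc]
    refine mul_le_mul_of_nonneg_left ?_ (by positivity)
    have s2 := step f hf _ (reachable_next hs (z s))
    simp only [zero_add, add_zero, nc] at s2 ⊢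
    exact s2

end

/-! ### From pairs of words to path sums. -/

section

/-- The carries when addition is started with the carry `c` into position `0`. -/
def carryFrom (q : ℕ) (c : ℤ) (s : ℕ → ℤ) : ℕ → ℤ
  | 0 => c
  | j + 1 => nextCarry q (s j + carryFrom q c s j) (s (j + 1))

lemma carryFrom_zero (q : ℕ) (s : ℕ → ℤ) (j : ℕ) : carryFrom q 0 s j = carry q s j := by
  induction j with
  | zero => rfl
  | succ j ih => rw [carryFrom, carry, ih]

lemma carryFrom_shift (q : ℕ) (c : ℤ) (s : ℕ → ℤ) (j : ℕ) :
    carryFrom q c s (j + 1) =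
      carryFrom q (nextCarry q (s 0 + c) (s 1)) (fun i => s (i + 1)) j := by
  induction j with
  | zero => rfl
  | succ j ih => rw [carryFrom, ih]; rfl

/-- The accumulated values of the carries: `Z` is summed over the carries into the positions
`1, …, ℓ`, and `b` is evaluated at the carry into the position `ℓ + 1`. -/
def carryTotal (q : ℕ) (Z b : ℤ → ℝ) (ℓ : ℕ) (c : ℤ) (s : ℕ → ℤ) : ℝ :=
  ∑ j ∈ Finset.range ℓ, Z (carryFrom q c s (j + 1)) + b (carryFrom q c s (ℓ + 1))

lemma carryTotal_succ (q : ℕ) (Z b : ℤ → ℝ) (ℓ : ℕ) (c : ℤ) (s : ℕ → ℤ) :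
    carryTotal q Z b (ℓ + 1) c s = Z (nextCarry q (s 0 + c) (s 1)) +
      carryTotal q Z b ℓ (nextCarry q (s 0 + c) (s 1)) (fun i => s (i + 1)) := by
  simp only [carryTotal]
  rw [Finset.sum_range_succ', carryFrom_shift q c s (ℓ + 1)]
  simp only [fun j => carryFrom_shift q c s (j + 1)]
  have : carryFrom q c s (0 + 1) = nextCarry q (s 0 + c) (s 1) := rfl
  rw [this]
  ring

lemma pad_cons_zero {ℓ : ℕ} (x : ℤ) (w : Fin ℓ → ℤ) :
    pad (Fin.cons (α := fun _ => ℤ) x w) 0 = x := by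
  simp [pad]

lemma pad_cons_succ {ℓ : ℕ} (x : ℤ) (w : Fin ℓ → ℤ) (j : ℕ) :
    pad (Fin.cons (α := fun _ => ℤ) x w) (j + 1) = pad w j := by
  by_cases hj : j < ℓ
  · have h1 : j + 1 < ℓ + 1 := by omega
    rw [pad, dif_pos h1, pad, dif_pos hj]
    exact Fin.cons_succ (α := fun _ => ℤ) x w ⟨j, hj⟩
  · rw [pad, dif_neg (by omega), pad, dif_neg hj]

variable {h : ℕ}

/-- Sums over pairs of words are path sums of the carry chain. -/
lemma sum_words_eq_pathSum (h1 : 1 ≤ h) {V : Type*} [AddCommGroup V] [Module ℝ V] (Z b : ℤ → ℝ)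
    (ℓ : ℕ) (x y c : ℤ) (φ : ℝ → V) :
    ∑ u ∈ words (2 * h) ℓ x, ∑ v ∈ words (2 * h) ℓ y,
      φ (carryTotal (2 * h) Z b ℓ c fun j => pad (Fin.cons (α := fun _ => ℤ) x u) j +
        pad (Fin.cons (α := fun _ => ℤ) y v) j) =
    (((2 * h : ℝ) ^ 2) ^ ℓ * (digitWeight (2 * h) x * digitWeight (2 * h) y)) •
      (carryChain h h1).pathSum
        (fun s i => Z (nextCarry (2 * h) (s.1 + s.2.1 + s.2.2) (i.1 + i.2)))
        (fun s => (digitWeight (2 * h) s.1 * digitWeight (2 * h) s.2.1)⁻¹)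
        (fun s => b (nextCarry (2 * h) (s.1 + s.2.1 + s.2.2) 0)) ℓ (x, y, c) φ := by
  induction ℓ generalizing x y c φ with
  | zero =>
    have a1 := (digitWeight_pos (2 * h) x).ne'
    have a2 := (digitWeight_pos (2 * h) y).ne'
    simp only [words, Finset.univ_unique, Finset.sum_singleton, Chain.pathSum, smul_smul, pow_zero,
      one_mul]
    rw [mul_inv_cancel₀ (mul_ne_zero a1 a2), one_smul]
    congr 1
    simp only [carryTotal, Finset.range_zero, Finset.sum_empty, zero_add, carryFrom, pad_cons_zero]
    simp [pad]
  | succ ℓ ih =>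
    have h0 : (h : ℝ) ≠ 0 := by exact_mod_cast (by omega : h ≠ 0)
    simp only [Chain.pathSum, Chain.avg, Finset.smul_sum, smul_smul]
    have e1 : (carryChain h h1).moves (x, y, c) = allowed (2 * h) x ×ˢ allowed (2 * h) y := rfl
    rw [e1, Finset.sum_product, sum_words_succ]
    refine Finset.sum_congr rfl fun x' _ => ?_
    simp only [sum_words_succ (x := y)]
    rw [Finset.sum_comm]
    refine Finset.sum_congr rfl fun y' _ => ?_
    have e2 : (carryChain h h1).next (x, y, c) (x', y') =
      (x', y', nextCarry (2 * h) (x + y + c) (x' + y')) := rfl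
    have e3 : (carryChain h h1).weight (x, y, c) (x', y') =
      digitWeight (2 * h) x' * digitWeight (2 * h) y' /
        ((2 * h) ^ 2 * (digitWeight (2 * h) x * digitWeight (2 * h) y)) := rfl
    have a1 := (digitWeight_pos (2 * h) x).ne'
    have a2 := (digitWeight_pos (2 * h) y).ne'
    have e4 : ((2 * h : ℝ) ^ 2) ^ (ℓ + 1) * (digitWeight (2 * h) x * digitWeight (2 * h) y) *
        (digitWeight (2 * h) x' * digitWeight (2 * h) y' /
        ((2 * h) ^ 2 * (digitWeight (2 * h) x * digitWeight (2 * h) y))) =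
        ((2 * h : ℝ) ^ 2) ^ ℓ * (digitWeight (2 * h) x' * digitWeight (2 * h) y') := by
      field_simp
      ring
    rw [e2, e3, e4, ← ih]
    refine Finset.sum_congr rfl fun u _ => Finset.sum_congr rfl fun v _ => ?_
    rw [carryTotal_succ]
    simp only [pad_cons_succ, pad_cons_zero]

/-- A leading state `(0, 0, 0)` amounts to an extra zero digit on the least significant side of both
words. The `ℓ` moves then see the carries `c_0, …, c_{ℓ-1}`, of which `c_0 = 0` is never counted,
and the terminal cost supplies `c_ℓ`. The centring occurs exactly `ℓ` times since only the moves are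
centred. -/
lemma carryTotal_words {q ℓ : ℕ} (hq : 2 ≤ q) (e t₁ t₂ : ℝ) (u v : Fin ℓ → ℤ) :
    carryTotal q
      (fun c => t₁ * ((if c = 1 then 1 else 0) - e) + t₂ * ((if c = -1 then 1 else 0) - e))
      (fun c => t₁ * (if c = 1 then 1 else 0) + t₂ * (if c = -1 then 1 else 0)) ℓ 0
      (fun j => pad (Fin.cons (α := fun _ => ℤ) 0 u) j + pad (Fin.cons (α := fun _ => ℤ) 0 v) j) =
    t₁ * (numCarries q 1 u v - e * ℓ) + t₂ * (numCarries q (-1) u v - e * ℓ) := by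
  have nc : ∀ s, nextCarry q 0 s = 0 := fun s => by
    simp only [nextCarry]
    split_ifs <;> omega
  have shift : ∀ j, carryFrom q 0 (fun j => pad (Fin.cons (α := fun _ => ℤ) 0 u) j +
      pad (Fin.cons (α := fun _ => ℤ) 0 v) j) (j + 1) = carry q (fun i => pad u i + pad v i) j := by
    intro j
    rw [carryFrom_shift]
    simp only [pad_cons_zero, pad_cons_succ, add_zero, nc, carryFrom_zero]
  have cnt : ∀ k : ℤ, k ≠ 0 → ∑ j ∈ Finset.range ℓ,
      (if carry q (fun i => pad u i + pad v i) j = k then (1 : ℝ) else 0) +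
      (if carry q (fun i => pad u i + pad v i) ℓ = k then (1 : ℝ) else 0) =
      numCarries q k u v := fun k hk => by
    rw [← Finset.sum_range_succ (fun j => if carry q (fun i => pad u i + pad v i) j = k then (1 : ℝ)
      else 0), Finset.sum_range_succ', numCarries, Finset.card_filter]
    have : carry q (fun i => pad u i + pad v i) 0 ≠ k := hk.symm
    rw [if_neg this]
    push_cast
    ring
  simp only [carryTotal, shift]
  rw [← cnt 1 one_ne_zero, ← cnt (-1) (by norm_num), Finset.sum_add_distrib, ← Finset.mul_sum,
    ← Finset.mul_sum, Finset.sum_sub_distrib, Finset.sum_sub_distrib]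
  simp only [Finset.sum_const, Finset.card_range, nsmul_eq_mul]
  ring

end

/-! ### Transition counts between classes of states. -/

section

/-- The unit step at `θ`. -/
def step (θ s : ℤ) : ℝ := if θ ≤ s then 1 else 0

/-- The positive part, the first summation of the unit step. -/
def ramp (n : ℤ) : ℝ := if 0 ≤ n then n else 0

/-- The second summation of the unit step. -/
def tri (n : ℤ) : ℝ := if 0 ≤ n then n * (n - 1) / 2 else 0

lemma step_of_le {θ s : ℤ} (hs : θ ≤ s) : step θ s = 1 := if_pos hs

lemma step_of_lt {θ s : ℤ} (hs : s < θ) : step θ s = 0 := if_neg hs.not_ge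

lemma ramp_of_nonneg {n : ℤ} (hn : 0 ≤ n) : ramp n = n := if_pos hn

lemma ramp_of_nonpos {n : ℤ} (hn : n ≤ 0) : ramp n = 0 := by
  rcases hn.lt_or_eq with hn | rfl
  · exact if_neg hn.not_ge
  · simp [ramp]

lemma tri_of_nonneg {n : ℤ} (hn : 0 ≤ n) : tri n = n * (n - 1) / 2 := if_pos hn

lemma tri_of_le_one {n : ℤ} (hn : n ≤ 1) : tri n = 0 := by
  rcases lt_or_ge n 0 with h0 | h0
  · exact if_neg h0.not_ge
  · have : n = 0 ∨ n = 1 := by omega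
    rcases this with rfl | rfl <;> simp [tri]

lemma toNat_cast_of_nonneg {n : ℤ} (hn : 0 ≤ n) : ((n.toNat : ℕ) : ℝ) = n := by
  rw [← Int.cast_natCast, Int.toNat_of_nonneg hn]

lemma sum_telescope (F : ℤ → ℝ) {a b : ℤ} (hab : a ≤ b + 1) :
    ∑ x ∈ Finset.Icc a b, (F (x + 1) - F x) = F (b + 1) - F a := by
  obtain ⟨n, hn⟩ : ∃ n : ℕ, b = a - 1 + n := ⟨(b + 1 - a).toNat, by omega⟩
  subst hn
  clear hab
  induction n with
  | zero => simp
  | succ n ih =>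
    have : Finset.Icc a (a - 1 + ((n + 1 : ℕ) : ℤ)) =
        insert (a + n) (Finset.Icc a (a - 1 + (n : ℤ))) := by
      ext z
      simp only [Finset.mem_insert, Finset.mem_Icc]
      omega
    rw [this, Finset.sum_insert (by simp only [Finset.mem_Icc]; omega), ih]
    have e1 : a - 1 + (n : ℤ) + 1 = a + n := by ring
    have e2 : a - 1 + ((n + 1 : ℕ) : ℤ) + 1 = a + n + 1 := by push_cast; ring
    rw [e1, e2]
    ring

lemma step_eq_ramp_sub (θ s : ℤ) : step θ s = ramp (s + 1 - θ) - ramp (s - θ) := by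
  rcases le_or_gt θ s with hs | hs
  · rw [step_of_le hs, ramp_of_nonneg (by omega), ramp_of_nonneg (by omega)]
    push_cast
    ring
  · rw [step_of_lt hs, ramp_of_nonpos (by omega), ramp_of_nonpos (by omega), sub_zero]

lemma ramp_eq_tri_sub (n : ℤ) : ramp n = tri (n + 1) - tri n := by
  rcases le_or_gt 0 n with hn | hn
  · rw [ramp_of_nonneg hn, tri_of_nonneg (by omega), tri_of_nonneg (by omega)]
    push_cast
    ring
  · rw [ramp_of_nonpos hn.le, tri_of_le_one (by omega), tri_of_le_one (by omega), sub_zero]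

lemma sum_step (θ k : ℤ) {c d : ℤ} (hcd : c ≤ d + 1) :
    ∑ y ∈ Finset.Icc c d, step θ (k + y) = ramp (k + d + 1 - θ) - ramp (k + c - θ) := by
  rw [show k + d + 1 - θ = k + (d + 1) - θ by ring,
    ← sum_telescope (fun y => ramp (k + y - θ)) hcd]
  refine Finset.sum_congr rfl fun y _ => ?_
  rw [step_eq_ramp_sub, add_assoc]

lemma sum_step' (θ k : ℤ) {c d : ℤ} (hcd : c ≤ d + 1) :
    ∑ y ∈ Finset.Icc c d, step θ (y + k) = ramp (k + d + 1 - θ) - ramp (k + c - θ) := by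
  simp only [fun y => add_comm y k]
  exact sum_step θ k hcd

lemma sum_ramp (k : ℤ) {a b : ℤ} (hab : a ≤ b + 1) :
    ∑ x ∈ Finset.Icc a b, ramp (x + k) = tri (b + 1 + k) - tri (a + k) := by
  rw [← sum_telescope (fun x => tri (x + k)) hab]
  refine Finset.sum_congr rfl fun x _ => ?_
  rw [ramp_eq_tri_sub, add_right_comm]

/-- Summing a unit step twice telescopes to a mixed second difference of triangular numbers: the
number of lattice points of a rectangle in a half-plane. -/
lemma sum_sum_step (θ : ℤ) {a b c d : ℤ} (hab : a ≤ b + 1) (hcd : c ≤ d + 1) :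
    ∑ x ∈ Finset.Icc a b, ∑ y ∈ Finset.Icc c d, step θ (x + y) =
      tri (b + d + 2 - θ) - tri (a + d + 1 - θ) - tri (b + c + 1 - θ) + tri (a + c - θ) := by
  simp only [fun x => sum_step θ x hcd]
  have e1 : ∀ x, x + d + 1 - θ = x + (d + 1 - θ) := fun x => by ring
  have e2 : ∀ x, x + c - θ = x + (c - θ) := fun x => by ring
  simp only [e1, e2]
  rw [Finset.sum_sub_distrib, sum_ramp _ hab, sum_ramp _ hab]
  rw [show b + 1 + (d + 1 - θ) = b + d + 2 - θ by ring,
    show a + (d + 1 - θ) = a + d + 1 - θ by ring,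
    show b + 1 + (c - θ) = b + c + 1 - θ by ring]
  ring_nf

/-- The classes of digits: `-q/2`, the digits in between, and `q/2`. -/
inductive DigitClass
  | minus
  | inner
  | plus

/-- The position of a digitwise sum with respect to `-q/2` and `q/2`. -/
inductive SumClass
  | below
  | lower
  | inner
  | upper
  | above

/-- The class of a digit to the base `2 * h`. -/
def digitClass (h : ℕ) (x : ℤ) : DigitClass :=
  if x = h then .plus else if x = -h then .minus else .inner

/-- The class of a digitwise sum to the base `2 * h`. -/
def sumClass (h : ℕ) (a : ℤ) : SumClass :=
  if (h : ℤ) < a then .above else if a < -h then .below else if a = h then .upper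
  else if a = -h then .lower else .inner

/-- The value of `G` at the class of the next sum and the outgoing carry, when `a` is the sum at
the present position and `s` the digitwise sum at the next one. -/
def val (h : ℕ) (a : ℤ) (G : SumClass → ℤ → ℝ) (s : ℤ) : ℝ :=
  G (sumClass h (s + nextCarry (2 * h) a s)) (nextCarry (2 * h) a s)

variable {h : ℕ}

/-- With a carry that does not depend on `s`, the value is a step function of `s` that jumps where
the class of the next sum changes. In this form it can be summed over rectangles of digits. -/
lemma val_of_inner {a : ℤ} (ha : |a| < h) (G : SumClass → ℤ → ℝ) (s : ℤ) :
    val h a G s = G .below 0 + (G .lower 0 - G .below 0) * step (-h) s +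
      (G .inner 0 - G .lower 0) * step (-h + 1) s + (G .upper 0 - G .inner 0) * step h s +
      (G .above 0 - G .upper 0) * step (h + 1) s := by
  rw [abs_lt] at ha
  have hc : nextCarry (2 * h) a s = 0 := by
    simp only [nextCarry]
    split_ifs <;> omega
  simp only [val, hc, sumClass, step, add_zero]
  split_ifs <;> first | omega | ring

lemma val_of_above (h1 : 1 ≤ h) {a : ℤ} (ha : h < a) (G : SumClass → ℤ → ℝ) (s : ℤ) :
    val h a G s = G .below 1 + (G .lower 1 - G .below 1) * step (-h - 1) s +
      (G .inner 1 - G .lower 1) * step (-h) s + (G .upper 1 - G .inner 1) * step (h - 1) s +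
      (G .above 1 - G .upper 1) * step h s := by
  have hc : nextCarry (2 * h) a s = 1 := by
    simp only [nextCarry]
    split_ifs <;> omega
  simp only [val, hc, sumClass, step]
  split_ifs <;> first | omega | ring

/-- Here the carry depends on the next digitwise sum: it is 1 on `[-h, 0)` and `[h, 2h)`. The rule
is made so that the next sum is never `±h`; hence the classes `lower` and `upper` are absent. -/
lemma val_of_upper (h1 : 1 ≤ h) {a : ℤ} (ha : a = h) (G : SumClass → ℤ → ℝ) (s : ℤ) :
    val h a G s = G .below 0 + (G .inner 1 - G .below 0) * step (-h) s +
      (G .inner 0 - G .inner 1) * step 0 s + (G .above 1 - G .inner 0) * step h s +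
      (G .above 0 - G .above 1) * step (2 * h) s := by
  by_cases h2 : (-(h : ℤ) ≤ s ∧ s < 0) ∨ ((h : ℤ) ≤ s ∧ s < 2 * h)
  · have hc : nextCarry (2 * h) a s = 1 := by
      simp only [nextCarry]
      split_ifs <;> omega
    simp only [val, hc, sumClass, step]
    split_ifs <;> first | omega | ring
  · have hc : nextCarry (2 * h) a s = 0 := by
      simp only [nextCarry]
      split_ifs <;> omega
    simp only [val, hc, sumClass, step, add_zero]
    split_ifs <;> first | omega | ring

/-- The weighted sum of `Φ` over the moves from a state with digits `x` and `y` and sum `a`. -/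
def transitionSum (h : ℕ) (x y a : ℤ) (Φ : DigitClass → DigitClass → SumClass → ℤ → ℝ) : ℝ :=
  ∑ x' ∈ allowed (2 * h) x, digitWeight (2 * h) x' * ∑ y' ∈ allowed (2 * h) y,
    digitWeight (2 * h) y' * val h a (Φ (digitClass h x') (digitClass h y')) (x' + y')

lemma digitClass_of_mem {x : ℤ} (hx : x ∈ Finset.Icc (-(h : ℤ) + 1) (h - 1)) :
    digitClass h x = .inner := by
  rw [Finset.mem_Icc] at hx
  rw [digitClass, if_neg (by omega), if_neg (by omega)]

lemma digitClass_pos : digitClass h h = .plus := if_pos rfl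

lemma digitClass_neg (h1 : 1 ≤ h) : digitClass h (-h) = .minus := by
  rw [digitClass, if_neg (by omega), if_pos rfl]

lemma sum_allowed_minus (h1 : 1 ≤ h) (f : ℤ → ℝ) :
    ∑ d ∈ allowed (2 * h) (-h), digitWeight (2 * h) d * f d =
      ∑ d ∈ Finset.Icc (-(h : ℤ) + 1) 0, f d := by
  rw [sum_allowed_neg]
  simp only [digitWeight_neg]
  rw [sum_allowed_pos h1 (fun d => f (-d))]
  refine Finset.sum_nbij' (fun d => -d) (fun d => -d) (fun d hd => ?_) (fun d hd => ?_)
    (fun _ _ => neg_neg _) (fun _ _ => neg_neg _) (fun d _ => rfl)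
  all_goals
    rw [Finset.mem_Icc] at hd ⊢
    omega

/-- The part of the transition sum where the next digit of the second word runs over the digits
that may follow an interior digit. -/
lemma sum_val_interior (h1 : 1 ≤ h) {y : ℤ} (hy : |y| < h) (a x' : ℤ)
    (G : DigitClass → SumClass → ℤ → ℝ) :
    ∑ y' ∈ allowed (2 * h) y, digitWeight (2 * h) y' * val h a (G (digitClass h y')) (x' + y') =
      ∑ y' ∈ Finset.Icc (-(h : ℤ) + 1) (h - 1), val h a (G .inner) (x' + y') +
        (val h a (G .plus) (x' + h) + val h a (G .minus) (x' + -h)) / 2 := by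
  rw [sum_allowed_interior h1 hy (fun y' => val h a (G (digitClass h y')) (x' + y')),
    digitClass_pos, digitClass_neg h1]
  congr 1
  exact Finset.sum_congr rfl fun y' hy' => by rw [digitClass_of_mem hy']

lemma transitionSum_interior_interior (h1 : 1 ≤ h) {x y : ℤ} (hx : |x| < h) (hy : |y| < h) (a : ℤ)
    (Φ : DigitClass → DigitClass → SumClass → ℤ → ℝ) :
    transitionSum h x y a Φ =
      ∑ x' ∈ Finset.Icc (-(h : ℤ) + 1) (h - 1), ∑ y' ∈ Finset.Icc (-(h : ℤ) + 1) (h - 1),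
        val h a (Φ .inner .inner) (x' + y') +
      ((∑ x' ∈ Finset.Icc (-(h : ℤ) + 1) (h - 1), val h a (Φ .inner .plus) (x' + h) +
        ∑ x' ∈ Finset.Icc (-(h : ℤ) + 1) (h - 1), val h a (Φ .inner .minus) (x' + -h)) / 2 +
      (∑ y' ∈ Finset.Icc (-(h : ℤ) + 1) (h - 1), val h a (Φ .plus .inner) (h + y') +
        ∑ y' ∈ Finset.Icc (-(h : ℤ) + 1) (h - 1), val h a (Φ .minus .inner) (-h + y')) / 2 +
      (val h a (Φ .plus .plus) (h + h) + val h a (Φ .plus .minus) (h + -h) +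
        val h a (Φ .minus .plus) (-h + h) + val h a (Φ .minus .minus) (-h + -h)) / 4) := by
  simp only [transitionSum, fun x' => sum_val_interior h1 hy a x' (Φ (digitClass h x'))]
  rw [sum_allowed_interior h1 hx (fun x' => ∑ y' ∈ Finset.Icc (-(h : ℤ) + 1) (h - 1),
    val h a (Φ (digitClass h x') .inner) (x' + y') + (val h a (Φ (digitClass h x') .plus) (x' + h) +
      val h a (Φ (digitClass h x') .minus) (x' + -h)) / 2), digitClass_pos, digitClass_neg h1]
  rw [Finset.sum_congr rfl fun x' hx' => by rw [digitClass_of_mem hx'], Finset.sum_add_distrib,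
    ← Finset.sum_div, Finset.sum_add_distrib]
  ring

lemma transitionSum_pos_interior (h1 : 1 ≤ h) {y : ℤ} (hy : |y| < h) (a : ℤ)
    (Φ : DigitClass → DigitClass → SumClass → ℤ → ℝ) :
    transitionSum h h y a Φ =
      ∑ x' ∈ Finset.Icc (0 : ℤ) (h - 1), ∑ y' ∈ Finset.Icc (-(h : ℤ) + 1) (h - 1),
        val h a (Φ .inner .inner) (x' + y') +
      (∑ x' ∈ Finset.Icc (0 : ℤ) (h - 1), val h a (Φ .inner .plus) (x' + h) +
        ∑ x' ∈ Finset.Icc (0 : ℤ) (h - 1), val h a (Φ .inner .minus) (x' + -h)) / 2 := by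
  simp only [transitionSum, fun x' => sum_val_interior h1 hy a x' (Φ (digitClass h x'))]
  rw [sum_allowed_pos h1]
  rw [Finset.sum_congr rfl fun x' hx' => by
    rw [digitClass_of_mem (Finset.Icc_subset_Icc (by omega) le_rfl hx')], Finset.sum_add_distrib,
    ← Finset.sum_div, Finset.sum_add_distrib]

lemma transitionSum_pos_pos (h1 : 1 ≤ h) (a : ℤ)
    (Φ : DigitClass → DigitClass → SumClass → ℤ → ℝ) :
    transitionSum h h h a Φ =
      ∑ x' ∈ Finset.Icc (0 : ℤ) (h - 1), ∑ y' ∈ Finset.Icc (0 : ℤ) (h - 1),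
        val h a (Φ .inner .inner) (x' + y') := by
  simp only [transitionSum]
  rw [sum_allowed_pos h1]
  refine Finset.sum_congr rfl fun x' hx' => ?_
  rw [sum_allowed_pos h1 (fun y' => val h a (Φ (digitClass h x') (digitClass h y')) (x' + y'))]
  refine Finset.sum_congr rfl fun y' hy' => ?_
  rw [digitClass_of_mem (Finset.Icc_subset_Icc (by omega) le_rfl hx'),
    digitClass_of_mem (Finset.Icc_subset_Icc (by omega) le_rfl hy')]

lemma transitionSum_pos_neg (h1 : 1 ≤ h) (a : ℤ)
    (Φ : DigitClass → DigitClass → SumClass → ℤ → ℝ) :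
    transitionSum h h (-h) a Φ =
      ∑ x' ∈ Finset.Icc (0 : ℤ) (h - 1), ∑ y' ∈ Finset.Icc (-(h : ℤ) + 1) 0,
        val h a (Φ .inner .inner) (x' + y') := by
  simp only [transitionSum]
  rw [sum_allowed_pos h1]
  refine Finset.sum_congr rfl fun x' hx' => ?_
  rw [sum_allowed_minus h1 (fun y' => val h a (Φ (digitClass h x') (digitClass h y')) (x' + y'))]
  refine Finset.sum_congr rfl fun y' hy' => ?_
  rw [digitClass_of_mem (Finset.Icc_subset_Icc (by omega) le_rfl hx'),
    digitClass_of_mem (Finset.Icc_subset_Icc le_rfl (by omega) hy')]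

/-- In this and the seven following formulas the coefficients are the numbers of digit pairs leading
to the given classes and carry, each digit `±h` contributing a factor 1/2. -/
lemma transitionSum_interior_interior_inner (h1 : 1 ≤ h) {x : ℤ} (hx : |x| < h) {y : ℤ} (hy : |y| < h) {a : ℤ}
    (ha : |a| < h) (Φ : DigitClass → DigitClass → SumClass → ℤ → ℝ) :
    transitionSum h x y a Φ =
      (1 / 2 * h ^ 2 - 3 / 2 * h + 1) * Φ .inner .inner .above 0 +
      (1 / 2 * h ^ 2 - 3 / 2 * h + 1) * Φ .inner .inner .below 0 +
      (3 * h ^ 2 - 3 * h + 1) * Φ .inner .inner .inner 0 +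
      (h - 1) * Φ .inner .inner .lower 0 +
      (h - 1) * Φ .inner .inner .upper 0 +
      (1 / 2 * h - 1 / 2) * Φ .inner .minus .below 0 +
      (1 / 2 * h - 1 / 2) * Φ .inner .minus .inner 0 +
      (1 / 2) * Φ .inner .minus .lower 0 +
      (1 / 2 * h - 1 / 2) * Φ .inner .plus .above 0 +
      (1 / 2 * h - 1 / 2) * Φ .inner .plus .inner 0 +
      (1 / 2) * Φ .inner .plus .upper 0 +
      (1 / 2 * h - 1 / 2) * Φ .minus .inner .below 0 +
      (1 / 2 * h - 1 / 2) * Φ .minus .inner .inner 0 +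
      (1 / 2) * Φ .minus .inner .lower 0 +
      (1 / 4) * Φ .minus .minus .below 0 +
      (1 / 4) * Φ .minus .plus .inner 0 +
      (1 / 2 * h - 1 / 2) * Φ .plus .inner .above 0 +
      (1 / 2 * h - 1 / 2) * Φ .plus .inner .inner 0 +
      (1 / 2) * Φ .plus .inner .upper 0 +
      (1 / 4) * Φ .plus .minus .inner 0 +
      (1 / 4) * Φ .plus .plus .above 0 := by
  rw [transitionSum_interior_interior h1 hx hy]
  simp only [val_of_inner ha]
  simp only [Finset.sum_add_distrib, ← Finset.mul_sum, Finset.sum_const, nsmul_eq_mul,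
    Int.card_Icc]
  simp (disch := omega) only [sum_sum_step]
  simp (disch := omega) only [sum_step, sum_step', tri_of_nonneg, tri_of_le_one,
    ramp_of_nonneg, ramp_of_nonpos, step_of_le, step_of_lt, toNat_cast_of_nonneg]
  push_cast
  ring

lemma transitionSum_interior_interior_upper (h1 : 1 ≤ h) {x : ℤ} (hx : |x| < h) {y : ℤ} (hy : |y| < h) {a : ℤ}
    (ha : a = h) (Φ : DigitClass → DigitClass → SumClass → ℤ → ℝ) :
    transitionSum h x y a Φ =
      (1 / 2 * h ^ 2 - 1 / 2 * h) * Φ .inner .inner .above 1 +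
      (1 / 2 * h ^ 2 - 3 / 2 * h + 1) * Φ .inner .inner .below 0 +
      (3 / 2 * h ^ 2 - 1 / 2 * h) * Φ .inner .inner .inner 0 +
      (3 / 2 * h ^ 2 - 3 / 2 * h) * Φ .inner .inner .inner 1 +
      (1 / 2 * h - 1 / 2) * Φ .inner .minus .below 0 +
      (1 / 2 * h) * Φ .inner .minus .inner 1 +
      (1 / 2 * h) * Φ .inner .plus .above 1 +
      (1 / 2 * h - 1 / 2) * Φ .inner .plus .inner 0 +
      (1 / 2 * h - 1 / 2) * Φ .minus .inner .below 0 +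
      (1 / 2 * h) * Φ .minus .inner .inner 1 +
      (1 / 4) * Φ .minus .minus .below 0 +
      (1 / 4) * Φ .minus .plus .inner 0 +
      (1 / 2 * h) * Φ .plus .inner .above 1 +
      (1 / 2 * h - 1 / 2) * Φ .plus .inner .inner 0 +
      (1 / 4) * Φ .plus .minus .inner 0 +
      (1 / 4) * Φ .plus .plus .above 0 := by
  rw [transitionSum_interior_interior h1 hx hy]
  simp only [val_of_upper h1 ha]
  simp only [Finset.sum_add_distrib, ← Finset.mul_sum, Finset.sum_const, nsmul_eq_mul,
    Int.card_Icc]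
  simp (disch := omega) only [sum_sum_step]
  simp (disch := omega) only [sum_step, sum_step', tri_of_nonneg, tri_of_le_one,
    ramp_of_nonneg, ramp_of_nonpos, step_of_le, step_of_lt, toNat_cast_of_nonneg]
  push_cast
  ring

/-- The formula fails for `h = 1`, where some coefficients are negative. That case is not needed:
then interior digits are 0 and the sum is at most 1. -/
lemma transitionSum_interior_interior_above (h2 : 2 ≤ h) {x : ℤ} (hx : |x| < h) {y : ℤ} (hy : |y| < h) {a : ℤ}
    (ha : h < a) (Φ : DigitClass → DigitClass → SumClass → ℤ → ℝ) :
    transitionSum h x y a Φ =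
      (1 / 2 * h ^ 2 - 1 / 2 * h) * Φ .inner .inner .above 1 +
      (1 / 2 * h ^ 2 - 5 / 2 * h + 3) * Φ .inner .inner .below 1 +
      (3 * h ^ 2 - 3 * h) * Φ .inner .inner .inner 1 +
      (h - 2) * Φ .inner .inner .lower 1 +
      (h) * Φ .inner .inner .upper 1 +
      (1 / 2 * h - 1) * Φ .inner .minus .below 1 +
      (1 / 2 * h) * Φ .inner .minus .inner 1 +
      (1 / 2) * Φ .inner .minus .lower 1 +
      (1 / 2 * h) * Φ .inner .plus .above 1 +
      (1 / 2 * h - 1) * Φ .inner .plus .inner 1 +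
      (1 / 2) * Φ .inner .plus .upper 1 +
      (1 / 2 * h - 1) * Φ .minus .inner .below 1 +
      (1 / 2 * h) * Φ .minus .inner .inner 1 +
      (1 / 2) * Φ .minus .inner .lower 1 +
      (1 / 4) * Φ .minus .minus .below 1 +
      (1 / 4) * Φ .minus .plus .inner 1 +
      (1 / 2 * h) * Φ .plus .inner .above 1 +
      (1 / 2 * h - 1) * Φ .plus .inner .inner 1 +
      (1 / 2) * Φ .plus .inner .upper 1 +
      (1 / 4) * Φ .plus .minus .inner 1 +
      (1 / 4) * Φ .plus .plus .above 1 := by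
  have h1 : 1 ≤ h := by omega
  rw [transitionSum_interior_interior h1 hx hy]
  simp only [val_of_above h1 ha]
  simp only [Finset.sum_add_distrib, ← Finset.mul_sum, Finset.sum_const, nsmul_eq_mul,
    Int.card_Icc]
  simp (disch := omega) only [sum_sum_step]
  simp (disch := omega) only [sum_step, sum_step', tri_of_nonneg, tri_of_le_one,
    ramp_of_nonneg, ramp_of_nonpos, step_of_le, step_of_lt, toNat_cast_of_nonneg]
  push_cast
  ring

lemma transitionSum_pos_interior_inner (h1 : 1 ≤ h) {y : ℤ} (hy : |y| < h) {a : ℤ}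
    (ha : |a| < h) (Φ : DigitClass → DigitClass → SumClass → ℤ → ℝ) :
    transitionSum h h y a Φ =
      (1 / 2 * h ^ 2 - 3 / 2 * h + 1) * Φ .inner .inner .above 0 +
      (3 / 2 * h ^ 2 - 1 / 2 * h) * Φ .inner .inner .inner 0 +
      (h - 1) * Φ .inner .inner .upper 0 +
      (1 / 2 * h - 1 / 2) * Φ .inner .minus .inner 0 +
      (1 / 2) * Φ .inner .minus .lower 0 +
      (1 / 2 * h - 1 / 2) * Φ .inner .plus .above 0 +
      (1 / 2) * Φ .inner .plus .upper 0 := by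
  rw [transitionSum_pos_interior h1 hy]
  simp only [val_of_inner ha]
  simp only [Finset.sum_add_distrib, ← Finset.mul_sum, Finset.sum_const, nsmul_eq_mul,
    Int.card_Icc]
  simp (disch := omega) only [sum_sum_step]
  simp (disch := omega) only [sum_step', tri_of_nonneg, tri_of_le_one,
    ramp_of_nonneg, ramp_of_nonpos, toNat_cast_of_nonneg]
  push_cast
  ring

lemma transitionSum_pos_interior_upper (h1 : 1 ≤ h) {y : ℤ} (hy : |y| < h) {a : ℤ}
    (ha : a = h) (Φ : DigitClass → DigitClass → SumClass → ℤ → ℝ) :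
    transitionSum h h y a Φ =
      (1 / 2 * h ^ 2 - 1 / 2 * h) * Φ .inner .inner .above 1 +
      (h ^ 2) * Φ .inner .inner .inner 0 +
      (1 / 2 * h ^ 2 - 1 / 2 * h) * Φ .inner .inner .inner 1 +
      (1 / 2 * h) * Φ .inner .minus .inner 1 +
      (1 / 2 * h) * Φ .inner .plus .above 1 := by
  rw [transitionSum_pos_interior h1 hy]
  simp only [val_of_upper h1 ha]
  simp only [Finset.sum_add_distrib, ← Finset.mul_sum, Finset.sum_const, nsmul_eq_mul,
    Int.card_Icc]
  simp (disch := omega) only [sum_sum_step]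
  simp (disch := omega) only [sum_step', tri_of_nonneg, tri_of_le_one,
    ramp_of_nonneg, ramp_of_nonpos, toNat_cast_of_nonneg]
  push_cast
  ring

lemma transitionSum_pos_interior_above (h1 : 1 ≤ h) {y : ℤ} (hy : |y| < h) {a : ℤ}
    (ha : h < a) (Φ : DigitClass → DigitClass → SumClass → ℤ → ℝ) :
    transitionSum h h y a Φ =
      (1 / 2 * h ^ 2 - 1 / 2 * h) * Φ .inner .inner .above 1 +
      (3 / 2 * h ^ 2 - 3 / 2 * h) * Φ .inner .inner .inner 1 +
      (h) * Φ .inner .inner .upper 1 +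
      (1 / 2 * h) * Φ .inner .minus .inner 1 +
      (1 / 2 * h) * Φ .inner .plus .above 1 := by
  rw [transitionSum_pos_interior h1 hy]
  simp only [val_of_above h1 ha]
  simp only [Finset.sum_add_distrib, ← Finset.mul_sum, Finset.sum_const, nsmul_eq_mul,
    Int.card_Icc]
  simp (disch := omega) only [sum_sum_step]
  simp (disch := omega) only [sum_step', tri_of_nonneg, tri_of_le_one,
    ramp_of_nonneg, ramp_of_nonpos, toNat_cast_of_nonneg]
  push_cast
  ring

lemma transitionSum_pos_pos_above (h1 : 1 ≤ h)  {a : ℤ}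
    (ha : h < a) (Φ : DigitClass → DigitClass → SumClass → ℤ → ℝ) :
    transitionSum h h h a Φ =
      (1 / 2 * h ^ 2 - 1 / 2 * h) * Φ .inner .inner .above 1 +
      (1 / 2 * h ^ 2 - 1 / 2 * h) * Φ .inner .inner .inner 1 +
      (h) * Φ .inner .inner .upper 1 := by
  rw [transitionSum_pos_pos h1]
  simp only [val_of_above h1 ha]
  simp only [Finset.sum_add_distrib, ← Finset.mul_sum, Finset.sum_const, nsmul_eq_mul,
    Int.card_Icc]
  simp (disch := omega) only [sum_sum_step]
  simp (disch := omega) only [tri_of_nonneg, tri_of_le_one, toNat_cast_of_nonneg]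
  push_cast
  ring

lemma transitionSum_pos_neg_inner (h1 : 1 ≤ h)  {a : ℤ}
    (ha : |a| < h) (Φ : DigitClass → DigitClass → SumClass → ℤ → ℝ) :
    transitionSum h h (-h) a Φ =
      (h ^ 2) * Φ .inner .inner .inner 0 := by
  rw [transitionSum_pos_neg h1]
  simp only [val_of_inner ha]
  simp only [Finset.sum_add_distrib, ← Finset.mul_sum, Finset.sum_const, nsmul_eq_mul,
    Int.card_Icc]
  simp (disch := omega) only [sum_sum_step]
  simp (disch := omega) only [tri_of_nonneg, tri_of_le_one, toNat_cast_of_nonneg]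
  push_cast
  ring

end

/-! ### Explicit correctors and their equations. -/

section

variable {h : ℕ}

/-- The class of the negated digit. -/
def DigitClass.neg : DigitClass → DigitClass
  | .minus => .plus
  | .inner => .inner
  | .plus => .minus

/-- The class of the negated sum. -/
def SumClass.neg : SumClass → SumClass
  | .below => .above
  | .lower => .upper
  | .inner => .inner
  | .upper => .lower
  | .above => .below

lemma DigitClass.neg_neg (X : DigitClass) : X.neg.neg = X := by cases X <;> rfl

lemma SumClass.neg_neg (A : SumClass) : A.neg.neg = A := by cases A <;> rfl

lemma digitClass_neg_eq (h1 : 1 ≤ h) (x : ℤ) : digitClass h (-x) = (digitClass h x).neg := by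
  simp only [digitClass]
  split_ifs <;> first | rfl | omega

lemma sumClass_neg_eq (h1 : 1 ≤ h) (a : ℤ) : sumClass h (-a) = (sumClass h a).neg := by
  simp only [sumClass]
  split_ifs <;> first | rfl | omega

lemma transitionSum_neg (h1 : 1 ≤ h) (x y a : ℤ)
    (Φ : DigitClass → DigitClass → SumClass → ℤ → ℝ) :
    transitionSum h (-x) (-y) (-a) Φ =
      transitionSum h x y a (fun X Y A c => Φ X.neg Y.neg A.neg (-c)) := by
  simp only [transitionSum]
  rw [sum_allowed_neg]
  refine Finset.sum_congr rfl fun x' _ => ?_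
  rw [sum_allowed_neg, digitWeight_neg]
  refine congrArg _ (Finset.sum_congr rfl fun y' _ => ?_)
  rw [digitWeight_neg, val, val, digitClass_neg_eq h1, digitClass_neg_eq h1,
    show -x' + -y' = -(x' + y') by ring, nextCarry_neg (by omega), ← sumClass_neg_eq h1]
  congr 2
  ring_nf

lemma transitionSum_swap (x y a : ℤ) (Φ : DigitClass → DigitClass → SumClass → ℤ → ℝ) :
    transitionSum h y x a Φ = transitionSum h x y a (fun X Y => Φ Y X) := by
  simp only [transitionSum, Finset.mul_sum]
  rw [Finset.sum_comm]
  refine Finset.sum_congr rfl fun x' _ => Finset.sum_congr rfl fun y' _ => ?_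
  rw [add_comm y' x']
  simp only [val]
  ring

/-- The numerator, over the denominator `8 (q - 1) (q + 1) ^ 2`, of the first order corrector of the
number of carries equal to `1`. -/
def corrM (q : ℝ) : DigitClass → DigitClass → SumClass → ℝ
  | .plus, .plus, .above => 11 * q ^ 3 + 13 * q ^ 2 - 8 * q - 8
  | .plus, .minus, .inner => -q ^ 3 - q ^ 2 - 2 * q + 4
  | .plus, .inner, .inner => q ^ 3 - 2 * q ^ 2 - 3 * q + 2
  | .plus, .inner, .above => 9 * q ^ 3 + 14 * q ^ 2 - 3 * q - 6
  | .plus, .inner, .upper => 5 * q ^ 3 + 6 * q ^ 2 - 5 * q - 2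
  | .minus, .plus, .inner => -q ^ 3 - q ^ 2 - 2 * q + 4
  | .minus, .minus, .below => -q ^ 3 - 3 * q ^ 2 - 4 * q
  | .minus, .inner, .inner => -q ^ 3 - 2 * q ^ 2 + 3 * q + 6
  | .minus, .inner, .lower => -q ^ 3 - 2 * q ^ 2 - 3 * q + 2
  | .minus, .inner, .below => -q ^ 3 - 2 * q ^ 2 - 5 * q - 2
  | .inner, .plus, .inner => q ^ 3 - 2 * q ^ 2 - 3 * q + 2
  | .inner, .plus, .above => 9 * q ^ 3 + 14 * q ^ 2 - 3 * q - 6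
  | .inner, .plus, .upper => 5 * q ^ 3 + 6 * q ^ 2 - 5 * q - 2
  | .inner, .minus, .inner => -q ^ 3 - 2 * q ^ 2 + 3 * q + 6
  | .inner, .minus, .lower => -q ^ 3 - 2 * q ^ 2 - 3 * q + 2
  | .inner, .minus, .below => -q ^ 3 - 2 * q ^ 2 - 5 * q - 2
  | .inner, .inner, .above => 8 * q ^ 3 + 12 * q ^ 2 + 4 * q
  | .inner, .inner, .lower => -2 * q ^ 2 - 4 * q
  | .inner, .inner, .below => -4 * q ^ 2 - 4 * q
  | .inner, .inner, .upper => 4 * q ^ 3 + 6 * q ^ 2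
  -- The default covers the class `(inner, inner, inner)` of the base state, a normalisation of the
  -- additive constant in the corrector, and classes that contain no reachable state. The same holds
  -- for the two tables below.
  | _, _, _ => 0

/-- The numerator, over the denominator `64 (q - 1) ^ 2 (q + 1) ^ 5 (q ^ 2 + 1)`, of the second order
corrector of the number of carries equal to `1`. -/
def corrMM (q : ℝ) : DigitClass → DigitClass → SumClass → ℝ
  | .plus, .plus, .above => 9 * q ^ 9 + 51 * q ^ 8 + 130 * q ^ 7 + 250 * q ^ 6 + 109 * q ^ 5 -
    253 * q ^ 4 - 272 * q ^ 3 - 236 * q ^ 2 - 132 * q - 40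
  | .plus, .minus, .inner => -7 * q ^ 9 - 41 * q ^ 8 - 118 * q ^ 7 - 10 * q ^ 6 + 65 * q ^ 5 -
    5 * q ^ 4 + 172 * q ^ 3 - 44 * q ^ 2 - 4 * q - 8
  | .plus, .inner, .inner => 5 * q ^ 9 + 13 * q ^ 8 - 21 * q ^ 7 - 121 * q ^ 6 - 241 * q ^ 5 -
    13 * q ^ 4 + 389 * q ^ 3 + 229 * q ^ 2 + 28 * q - 20
  | .plus, .inner, .above => 5 * q ^ 9 + 45 * q ^ 8 + 123 * q ^ 7 + 231 * q ^ 6 + 199 * q ^ 5 -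
    29 * q ^ 4 - 203 * q ^ 3 - 443 * q ^ 2 - 348 * q - 100
  | .plus, .inner, .upper => 37 * q ^ 9 + 125 * q ^ 8 + 139 * q ^ 7 + 139 * q ^ 6 - 5 * q ^ 5 -
    269 * q ^ 4 - 167 * q ^ 3 - 143 * q ^ 2 + 4 * q + 12
  | .minus, .plus, .inner => -7 * q ^ 9 - 41 * q ^ 8 - 118 * q ^ 7 - 10 * q ^ 6 + 65 * q ^ 5 -
    5 * q ^ 4 + 172 * q ^ 3 - 44 * q ^ 2 - 4 * q - 8
  | .minus, .minus, .below => -7 * q ^ 9 - 53 * q ^ 8 - 190 * q ^ 7 - 222 * q ^ 6 - 83 * q ^ 5 +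
    43 * q ^ 4 + 112 * q ^ 3 - 84 * q ^ 2 - 116 * q - 40
  | .minus, .inner, .inner => -7 * q ^ 9 - 47 * q ^ 8 - 89 * q ^ 7 + 115 * q ^ 6 + 331 * q ^ 5 +
    127 * q ^ 4 - 119 * q ^ 3 - 135 * q ^ 2 + 44 * q + 28
  | .minus, .inner, .lower => -7 * q ^ 9 - 47 * q ^ 8 - 153 * q ^ 7 - 113 * q ^ 6 - q ^ 5 +
    31 * q ^ 4 + 157 * q ^ 3 - 51 * q ^ 2 - 52 * q - 20
  | .minus, .inner, .below => -7 * q ^ 9 - 47 * q ^ 8 - 169 * q ^ 7 - 205 * q ^ 6 -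
    157 * q ^ 5 - 177 * q ^ 4 + 25 * q ^ 3 + 121 * q ^ 2 + 84 * q + 12
  | .inner, .plus, .inner => 5 * q ^ 9 + 13 * q ^ 8 - 21 * q ^ 7 - 121 * q ^ 6 - 241 * q ^ 5 -
    13 * q ^ 4 + 389 * q ^ 3 + 229 * q ^ 2 + 28 * q - 20
  | .inner, .plus, .above => 5 * q ^ 9 + 45 * q ^ 8 + 123 * q ^ 7 + 231 * q ^ 6 + 199 * q ^ 5 -
    29 * q ^ 4 - 203 * q ^ 3 - 443 * q ^ 2 - 348 * q - 100
  | .inner, .plus, .upper => 37 * q ^ 9 + 125 * q ^ 8 + 139 * q ^ 7 + 139 * q ^ 6 - 5 * q ^ 5 -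
    269 * q ^ 4 - 167 * q ^ 3 - 143 * q ^ 2 + 4 * q + 12
  | .inner, .minus, .inner => -7 * q ^ 9 - 47 * q ^ 8 - 89 * q ^ 7 + 115 * q ^ 6 + 331 * q ^ 5 +
    127 * q ^ 4 - 119 * q ^ 3 - 135 * q ^ 2 + 44 * q + 28
  | .inner, .minus, .lower => -7 * q ^ 9 - 47 * q ^ 8 - 153 * q ^ 7 - 113 * q ^ 6 - q ^ 5 +
    31 * q ^ 4 + 157 * q ^ 3 - 51 * q ^ 2 - 52 * q - 20
  | .inner, .minus, .below => -7 * q ^ 9 - 47 * q ^ 8 - 169 * q ^ 7 - 205 * q ^ 6 -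
    157 * q ^ 5 - 177 * q ^ 4 + 25 * q ^ 3 + 121 * q ^ 2 + 84 * q + 12
  | .inner, .inner, .above => 24 * q ^ 8 + 152 * q ^ 7 + 384 * q ^ 6 + 344 * q ^ 5 -
    208 * q ^ 4 - 720 * q ^ 3 - 568 * q ^ 2 - 144 * q
  | .inner, .inner, .lower => -16 * q ^ 8 - 92 * q ^ 7 - 156 * q ^ 6 - 192 * q ^ 5 -
    84 * q ^ 4 + 220 * q ^ 3 + 184 * q ^ 2 + 64 * q
  | .inner, .inner, .below => -24 * q ^ 8 - 136 * q ^ 7 - 336 * q ^ 6 - 328 * q ^ 5 +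
    224 * q ^ 4 + 720 * q ^ 3 + 536 * q ^ 2 + 144 * q
  | .inner, .inner, .upper => 24 * q ^ 9 + 104 * q ^ 8 + 156 * q ^ 7 + 204 * q ^ 6 +
    184 * q ^ 5 - 76 * q ^ 4 - 284 * q ^ 3 - 304 * q ^ 2 - 80 * q
  | _, _, _ => 0

/-- The numerator, over the denominator `64 (q - 1) ^ 2 (q + 1) ^ 5`, of the mixed second order
corrector. -/
def corrMN (q : ℝ) : DigitClass → DigitClass → SumClass → ℝ
  | .plus, .plus, .above => q ^ 7 + 7 * q ^ 6 - 7 * q ^ 5 + 47 * q ^ 4 + 92 * q ^ 3 -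
    48 * q ^ 2 - 68 * q - 24
  | .plus, .minus, .inner => q ^ 7 + 23 * q ^ 6 + 9 * q ^ 5 + 47 * q ^ 4 + 40 * q ^ 3 -
    132 * q ^ 2 + 4 * q + 8
  | .plus, .inner, .inner => q ^ 7 + 9 * q ^ 6 + 6 * q ^ 5 + 26 * q ^ 4 - 3 * q ^ 3 -
    83 * q ^ 2 - 20 * q - 4
  | .plus, .inner, .above => q ^ 7 + 9 * q ^ 6 - 10 * q ^ 5 + 26 * q ^ 4 + 101 * q ^ 3 -
    3 * q ^ 2 - 44 * q - 20
  | .plus, .inner, .upper => q ^ 7 + 9 * q ^ 6 - 18 * q ^ 5 + 18 * q ^ 4 + 45 * q ^ 3 -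
    83 * q ^ 2 - 8 * q + 4
  | .minus, .plus, .inner => q ^ 7 + 23 * q ^ 6 + 9 * q ^ 5 + 47 * q ^ 4 + 40 * q ^ 3 -
    132 * q ^ 2 + 4 * q + 8
  | .minus, .minus, .below => q ^ 7 + 7 * q ^ 6 - 7 * q ^ 5 + 47 * q ^ 4 + 92 * q ^ 3 -
    48 * q ^ 2 - 68 * q - 24
  | .minus, .inner, .inner => q ^ 7 + 9 * q ^ 6 + 6 * q ^ 5 + 26 * q ^ 4 - 3 * q ^ 3 -
    83 * q ^ 2 - 20 * q - 4
  | .minus, .inner, .lower => q ^ 7 + 9 * q ^ 6 - 18 * q ^ 5 + 18 * q ^ 4 + 45 * q ^ 3 -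
    83 * q ^ 2 - 8 * q + 4
  | .minus, .inner, .below => q ^ 7 + 9 * q ^ 6 - 10 * q ^ 5 + 26 * q ^ 4 + 101 * q ^ 3 -
    3 * q ^ 2 - 44 * q - 20
  | .inner, .plus, .inner => q ^ 7 + 9 * q ^ 6 + 6 * q ^ 5 + 26 * q ^ 4 - 3 * q ^ 3 -
    83 * q ^ 2 - 20 * q - 4
  | .inner, .plus, .above => q ^ 7 + 9 * q ^ 6 - 10 * q ^ 5 + 26 * q ^ 4 + 101 * q ^ 3 -
    3 * q ^ 2 - 44 * q - 20
  | .inner, .plus, .upper => q ^ 7 + 9 * q ^ 6 - 18 * q ^ 5 + 18 * q ^ 4 + 45 * q ^ 3 -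
    83 * q ^ 2 - 8 * q + 4
  | .inner, .minus, .inner => q ^ 7 + 9 * q ^ 6 + 6 * q ^ 5 + 26 * q ^ 4 - 3 * q ^ 3 -
    83 * q ^ 2 - 20 * q - 4
  | .inner, .minus, .lower => q ^ 7 + 9 * q ^ 6 - 18 * q ^ 5 + 18 * q ^ 4 + 45 * q ^ 3 -
    83 * q ^ 2 - 8 * q + 4
  | .inner, .minus, .below => q ^ 7 + 9 * q ^ 6 - 10 * q ^ 5 + 26 * q ^ 4 + 101 * q ^ 3 -
    3 * q ^ 2 - 44 * q - 20
  | .inner, .inner, .above => 8 * q ^ 5 + 24 * q ^ 4 - 16 * q ^ 2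
  | .inner, .inner, .lower => -4 * q ^ 7 - 4 * q ^ 6 - 12 * q ^ 5 + 12 * q ^ 4 + 24 * q ^ 3 -
    44 * q ^ 2 - 8 * q
  | .inner, .inner, .below => 8 * q ^ 5 + 24 * q ^ 4 - 16 * q ^ 2
  | .inner, .inner, .upper => -4 * q ^ 7 - 4 * q ^ 6 - 12 * q ^ 5 + 12 * q ^ 4 + 24 * q ^ 3 -
    44 * q ^ 2 - 8 * q
  | _, _, _ => 0

lemma corrM_swap (q : ℝ) (X Y : DigitClass) (A : SumClass) : corrM q X Y A = corrM q Y X A := by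
  cases X <;> cases Y <;> cases A <;> rfl

lemma corrMM_swap (q : ℝ) (X Y : DigitClass) (A : SumClass) :
    corrMM q X Y A = corrMM q Y X A := by
  cases X <;> cases Y <;> cases A <;> rfl

lemma corrMN_swap (q : ℝ) (X Y : DigitClass) (A : SumClass) :
    corrMN q X Y A = corrMN q Y X A := by
  cases X <;> cases Y <;> cases A <;> rfl

lemma corrMN_neg (q : ℝ) (X Y : DigitClass) (A : SumClass) :
    corrMN q X.neg Y.neg A.neg = corrMN q X Y A := by
  cases X <;> cases Y <;> cases A <;> rfl

/-- The numerator of the increment of the compensated number of carries equal to `1` in a move from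
the class `(X, Y, A)` to the class `(X', Y', A')` with carry `c`. -/
def incM (q : ℝ) (X Y : DigitClass) (A : SumClass) (X' Y' : DigitClass) (A' : SumClass) (c : ℤ) :
    ℝ :=
  (if c = 1 then 8 * (q - 1) * (q + 1) ^ 2 else 0) - (q ^ 2 + 2 * q + 4) * (q - 1) +
    corrM q X' Y' A' - corrM q X Y A

/-- The analogue of `incM` for the carries equal to `-1`. -/
def incN (q : ℝ) (X Y : DigitClass) (A : SumClass) (X' Y' : DigitClass) (A' : SumClass) (c : ℤ) :
    ℝ :=
  (if c = -1 then 8 * (q - 1) * (q + 1) ^ 2 else 0) - (q ^ 2 + 2 * q + 4) * (q - 1) +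
    corrM q X'.neg Y'.neg A'.neg - corrM q X.neg Y.neg A.neg

/-- The numerator of `varConst`. -/
def varNum (q : ℝ) : ℝ :=
  7 * q ^ 6 + 48 * q ^ 5 + 159 * q ^ 4 + 128 * q ^ 3 - 48 * q ^ 2 - 12 * q - 8

/-- The numerator of `covConst`. -/
def covNum (q : ℝ) : ℝ :=
  -(q ^ 6 + 24 * q ^ 5 + 33 * q ^ 4 + 80 * q ^ 3 + 120 * q ^ 2 - 12 * q - 8)

/-- The corrector equations at a class of states, for the transition sum `T` from that class with
total weight `W`. -/
structure Balanced (q W : ℝ) (X Y : DigitClass) (A : SumClass)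
    (T : (DigitClass → DigitClass → SumClass → ℤ → ℝ) → ℝ) : Prop where
  meanM : T (incM q X Y A) = 0
  meanN : T (incN q X Y A) = 0
  -- Denominators are cleared: `(q + 1) * (q ^ 2 + 1)` is the quotient of the denominator of
  -- `corrMM` by the square of that of `corrM`. In `cov` the quotient is `q + 1`.
  varM : T (fun X' Y' A' c => incM q X Y A X' Y' A' c ^ 2 * ((q + 1) * (q ^ 2 + 1)) +
    corrMM q X' Y' A') = W * (varNum q * (q - 1) * (q ^ 2 + 1) + corrMM q X Y A)
  varN : T (fun X' Y' A' c => incN q X Y A X' Y' A' c ^ 2 * ((q + 1) * (q ^ 2 + 1)) +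
    corrMM q X'.neg Y'.neg A'.neg) =
      W * (varNum q * (q - 1) * (q ^ 2 + 1) + corrMM q X.neg Y.neg A.neg)
  cov : T (fun X' Y' A' c => incM q X Y A X' Y' A' c * incN q X Y A X' Y' A' c * (q + 1) +
    corrMN q X' Y' A') = W * (covNum q * (q - 1) + corrMN q X Y A)

/-- The corrector equations at the states with digits `x` and `y` and sum `a`. -/
def BalancedAt (h : ℕ) (x y a : ℤ) : Prop :=
  Balanced (2 * h) ((2 * h) ^ 2 * (digitWeight (2 * h) x * digitWeight (2 * h) y))
    (digitClass h x) (digitClass h y) (sumClass h a) (transitionSum h x y a)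

/-- Negating both summands exchanges the carries 1 and -1, so the equations for the two counts trade
places and the mixed one is preserved. -/
lemma BalancedAt.neg (h1 : 1 ≤ h) {x y a : ℤ} (H : BalancedAt h x y a) :
    BalancedAt h (-x) (-y) (-a) := by
  have e : ∀ c : ℤ, (-c = 1) ↔ c = -1 := fun c => by omega
  have e' : ∀ c : ℤ, (-c = -1) ↔ c = 1 := fun c => by omega
  have hM : ∀ q X Y A X' Y' A' c, incM q X.neg Y.neg A.neg (DigitClass.neg X') (DigitClass.neg Y')
      (SumClass.neg A') (-c) = incN q X Y A X' Y' A' c := fun _ _ _ _ _ _ _ c => by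
    simp only [incM, incN, e]
  have hN : ∀ q X Y A X' Y' A' c, incN q (DigitClass.neg X) (DigitClass.neg Y) (SumClass.neg A)
      (DigitClass.neg X') (DigitClass.neg Y') (SumClass.neg A') (-c) = incM q X Y A X' Y' A' c :=
    fun _ _ _ _ _ _ _ c => by
      simp only [incM, incN, e', DigitClass.neg_neg, SumClass.neg_neg]
  rw [BalancedAt, digitWeight_neg, digitWeight_neg, digitClass_neg_eq h1, digitClass_neg_eq h1,
    sumClass_neg_eq h1]
  refine ⟨?_, ?_, ?_, ?_, ?_⟩ <;> rw [transitionSum_neg h1] <;>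
    simp only [hM, hN, corrMN_neg, DigitClass.neg_neg, SumClass.neg_neg]
  · exact H.meanN
  · exact H.meanM
  · exact H.varN
  · exact H.varM
  · simp only [mul_comm (incN _ _ _ _ _ _ _ _)]
    exact H.cov

lemma BalancedAt.swap {x y a : ℤ} (H : BalancedAt h x y a) : BalancedAt h y x a := by
  have hM : ∀ q X Y A X' Y' A' c, incM q Y X A Y' X' A' c = incM q X Y A X' Y' A' c :=
    fun q X Y A X' Y' A' c => by simp only [incM, corrM_swap q Y, corrM_swap q Y']
  have hN : ∀ q X Y A X' Y' A' c, incN q Y X A Y' X' A' c = incN q X Y A X' Y' A' c :=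
    fun q X Y A X' Y' A' c => by
      simp only [incN, corrM_swap q (DigitClass.neg Y), corrM_swap q (DigitClass.neg Y')]
  rw [BalancedAt, mul_comm (digitWeight _ _)]
  refine ⟨?_, ?_, ?_, ?_, ?_⟩ <;> rw [transitionSum_swap x y a]
  · exact (congrArg _ (by funext X' Y' A' c; exact hM _ _ _ _ _ _ _ _)).trans H.meanM
  · exact (congrArg _ (by funext X' Y' A' c; exact hN _ _ _ _ _ _ _ _)).trans H.meanN
  · rw [corrMM_swap]
    exact (congrArg _ (by funext X' Y' A' c; rw [hM, corrMM_swap])).trans H.varM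
  · rw [corrMM_swap]
    exact (congrArg _ (by funext X' Y' A' c; rw [hN, corrMM_swap])).trans H.varN
  · rw [corrMN_swap]
    exact (congrArg _ (by funext X' Y' A' c; rw [hM, hN, corrMN_swap])).trans H.cov

lemma digitClass_of_abs_lt {x : ℤ} (hx : |x| < h) : digitClass h x = .inner := by
  rw [abs_lt] at hx
  rw [digitClass, if_neg (by omega), if_neg (by omega)]

lemma digitWeight_of_abs_lt {x : ℤ} (hx : |x| < h) : digitWeight (2 * h) x = 1 := by
  rw [digitWeight, two_mul_ediv, if_neg (by omega)]

lemma digitWeight_self : digitWeight (2 * h) h = 1 / 2 := by simp [digitWeight]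

lemma sumClass_of_abs_lt {a : ℤ} (ha : |a| < h) : sumClass h a = .inner := by
  rw [abs_lt] at ha
  rw [sumClass, if_neg (by omega), if_neg (by omega), if_neg (by omega), if_neg (by omega)]

lemma sumClass_self (h1 : 1 ≤ h) : sumClass h h = .upper := by
  rw [sumClass, if_neg (by omega), if_neg (by omega), if_pos rfl]

lemma sumClass_of_lt {a : ℤ} (ha : h < a) : sumClass h a = .above := if_pos ha

/-- Inserting the tables into the transition counts leaves five polynomial identities in `h`; so in
the seven cases that follow. -/
lemma balancedAt_interior_interior_inner (h1 : 1 ≤ h) {x : ℤ} (hx : |x| < h) {y : ℤ} (hy : |y| < h) {a : ℤ} (ha : |a| < h) :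
    BalancedAt h x y a := by
  rw [BalancedAt, digitClass_of_abs_lt hx, digitWeight_of_abs_lt hx, digitClass_of_abs_lt hy, digitWeight_of_abs_lt hy, sumClass_of_abs_lt ha]
  constructor <;> rw [transitionSum_interior_interior_inner h1 hx hy ha] <;>
    simp only [incM, incN, corrM, corrMM, corrMN, varNum, covNum, DigitClass.neg, SumClass.neg,
      Int.reduceEq, if_false] <;>
    ring

lemma balancedAt_interior_interior_upper (h1 : 1 ≤ h) {x : ℤ} (hx : |x| < h) {y : ℤ} (hy : |y| < h) {a : ℤ} (ha : a = h) :
    BalancedAt h x y a := by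
  subst ha
  rw [BalancedAt, digitClass_of_abs_lt hx, digitWeight_of_abs_lt hx, digitClass_of_abs_lt hy, digitWeight_of_abs_lt hy, sumClass_self h1]
  constructor <;> rw [transitionSum_interior_interior_upper h1 hx hy rfl] <;>
    simp only [incM, incN, corrM, corrMM, corrMN, varNum, covNum, DigitClass.neg, SumClass.neg,
      Int.reduceEq, if_true, if_false] <;>
    ring

lemma balancedAt_interior_interior_above (h2 : 2 ≤ h) {x : ℤ} (hx : |x| < h) {y : ℤ} (hy : |y| < h) {a : ℤ} (ha : h < a) :
    BalancedAt h x y a := by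
  rw [BalancedAt, digitClass_of_abs_lt hx, digitWeight_of_abs_lt hx, digitClass_of_abs_lt hy, digitWeight_of_abs_lt hy, sumClass_of_lt ha]
  constructor <;> rw [transitionSum_interior_interior_above h2 hx hy ha] <;>
    simp only [incM, incN, corrM, corrMM, corrMN, varNum, covNum, DigitClass.neg, SumClass.neg,
      Int.reduceEq, if_true, if_false] <;>
    ring

lemma balancedAt_pos_interior_inner (h1 : 1 ≤ h) {y : ℤ} (hy : |y| < h) {a : ℤ} (ha : |a| < h) :
    BalancedAt h h y a := by
  rw [BalancedAt, digitClass_pos, digitWeight_self, digitClass_of_abs_lt hy, digitWeight_of_abs_lt hy, sumClass_of_abs_lt ha]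
  constructor <;> rw [transitionSum_pos_interior_inner h1 hy ha] <;>
    simp only [incM, incN, corrM, corrMM, corrMN, varNum, covNum, DigitClass.neg, SumClass.neg,
      Int.reduceEq, if_false] <;>
    ring

lemma balancedAt_pos_interior_upper (h1 : 1 ≤ h) {y : ℤ} (hy : |y| < h) {a : ℤ} (ha : a = h) :
    BalancedAt h h y a := by
  subst ha
  rw [BalancedAt, digitClass_pos, digitWeight_self, digitClass_of_abs_lt hy, digitWeight_of_abs_lt hy, sumClass_self h1]
  constructor <;> rw [transitionSum_pos_interior_upper h1 hy rfl] <;>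
    simp only [incM, incN, corrM, corrMM, corrMN, varNum, covNum, DigitClass.neg, SumClass.neg,
      Int.reduceEq, if_true, if_false] <;>
    ring

lemma balancedAt_pos_interior_above (h1 : 1 ≤ h) {y : ℤ} (hy : |y| < h) {a : ℤ} (ha : h < a) :
    BalancedAt h h y a := by
  rw [BalancedAt, digitClass_pos, digitWeight_self, digitClass_of_abs_lt hy, digitWeight_of_abs_lt hy, sumClass_of_lt ha]
  constructor <;> rw [transitionSum_pos_interior_above h1 hy ha] <;>
    simp only [incM, incN, corrM, corrMM, corrMN, varNum, covNum, DigitClass.neg, SumClass.neg,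
      Int.reduceEq, if_true, if_false] <;>
    ring

lemma balancedAt_pos_pos_above (h1 : 1 ≤ h) {a : ℤ} (ha : h < a) :
    BalancedAt h h h a := by
  rw [BalancedAt, digitClass_pos, digitWeight_self, sumClass_of_lt ha]
  constructor <;> rw [transitionSum_pos_pos_above h1 ha] <;>
    simp only [incM, incN, corrM, corrMM, corrMN, varNum, covNum, DigitClass.neg, SumClass.neg,
      Int.reduceEq, if_true, if_false] <;>
    ring

lemma balancedAt_pos_neg_inner (h1 : 1 ≤ h) {a : ℤ} (ha : |a| < h) :
    BalancedAt h h (-h) a := by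
  rw [BalancedAt, digitClass_pos, digitWeight_self, digitClass_neg h1, digitWeight_neg, sumClass_of_abs_lt ha]
  constructor <;> rw [transitionSum_pos_neg_inner h1 ha] <;>
    simp only [incM, incN, corrM, corrMM, corrMN, varNum, covNum, DigitClass.neg, SumClass.neg,
      Int.reduceEq, if_false] <;>
    ring

end

/-! ### The corrector equations at all reachable states. -/

section

variable {h : ℕ}

lemma balancedAt_of_abs_lt (h1 : 1 ≤ h) {x y c : ℤ} (hs : (x, y, c) ∈ reachable h)
    (hx : |x| < h) (hy : |y| < h) : BalancedAt h x y (x + y + c) := by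
  obtain ⟨-, -, hc, -⟩ := hs
  simp only at hc
  rw [abs_le] at hc
  -- For `h = 1` both digits vanish, and a carry alone cannot exceed `h`.
  have two : ∀ a : ℤ, (h : ℤ) < |a| → a = x + y + c → 2 ≤ h := fun a ha e => by
    rcases Nat.lt_or_ge h 2 with h2 | h2
    · obtain rfl : h = 1 := by omega
      have hx0 : x = 0 := Int.abs_lt_one_iff.1 (by simpa using hx)
      have hy0 : y = 0 := Int.abs_lt_one_iff.1 (by simpa using hy)
      rw [lt_abs] at ha
      push_cast at ha
      omega
    · exact h2
  generalize ha : x + y + c = a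
  rcases lt_trichotomy |a| (h : ℤ) with h2 | h2 | h2
  · exact balancedAt_interior_interior_inner h1 hx hy h2
  · rcases (abs_eq (by omega)).1 h2 with h3 | h3
    · exact balancedAt_interior_interior_upper h1 hx hy h3
    · have := (balancedAt_interior_interior_upper h1 (x := -x) (y := -y) (a := -a)
        (by rwa [abs_neg]) (by rwa [abs_neg]) (by omega)).neg h1
      simpa using this
  · have h4 := two a h2 ha.symm
    rcases lt_abs.1 h2 with h3 | h3
    · exact balancedAt_interior_interior_above h4 hx hy h3
    · have := (balancedAt_interior_interior_above h4 (x := -x) (y := -y) (a := -a)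
        (by rwa [abs_neg]) (by rwa [abs_neg]) (by omega)).neg h1
      simpa using this

lemma balancedAt_pos_interior (h1 : 1 ≤ h) {y c : ℤ} (hc : |c| ≤ 1) (hy : |y| < h) :
    BalancedAt h h y (h + y + c) := by
  have hy' := abs_lt.1 hy
  rw [abs_le] at hc
  generalize ha : (h : ℤ) + y + c = a
  rcases lt_trichotomy a (h : ℤ) with h2 | h2 | h2
  · exact balancedAt_pos_interior_inner h1 hy (abs_lt.2 ⟨by omega, h2⟩)
  · exact balancedAt_pos_interior_upper h1 hy h2
  · exact balancedAt_pos_interior_above h1 hy h2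

lemma balancedAt_boundary_interior (h1 : 1 ≤ h) {x y c : ℤ} (hc : |c| ≤ 1) (hx : |x| = h)
    (hy : |y| < h) : BalancedAt h x y (x + y + c) := by
  rcases (abs_eq (by omega)).1 hx with rfl | rfl
  · exact balancedAt_pos_interior h1 hc hy
  · have := (balancedAt_pos_interior h1 (y := -y) (c := -c) (by rwa [abs_neg])
      (by rwa [abs_neg])).neg h1
    rw [neg_neg, show -((h : ℤ) + -y + -c) = -h + y + c by ring] at this
    exact this

/-- The corrector equations hold at all states that can occur. -/
lemma balancedAt_of_reachable (h1 : 1 ≤ h) {x y c : ℤ} (hs : (x, y, c) ∈ reachable h) :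
    BalancedAt h x y (x + y + c) := by
  obtain ⟨hx, hy, hc, h4⟩ := id hs
  simp only at hx hy hc h4
  rcases hx.lt_or_eq with hx | hx <;> rcases hy.lt_or_eq with hy | hy
  · exact balancedAt_of_abs_lt h1 hs hx hy
  · rw [add_comm x y]
    exact (balancedAt_boundary_interior h1 hc hy hx).swap
  · exact balancedAt_boundary_interior h1 hc hx hy
  -- Either alternative puts `2 * h + c` above `h` and `c` strictly between `-h` and `h`. For `h =
  -- 1` this relies on the last condition in `reachable`.
  · have hc' : (2 ≤ h ∧ -1 ≤ c ∧ c ≤ 1) ∨ (h = 1 ∧ c = 0) := by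
      rw [abs_le] at hc
      rcases Nat.lt_or_ge h 2 with h2 | h2
      · obtain rfl : h = 1 := by omega
        exact Or.inr ⟨rfl, h4 rfl (by simpa using hx) (by simpa using hy)⟩
      · exact Or.inl ⟨h2, hc⟩
    rcases (abs_eq (by omega)).1 hx with rfl | rfl <;> rcases (abs_eq (by omega)).1 hy with rfl | rfl
    · exact balancedAt_pos_pos_above h1 (by omega)
    · exact balancedAt_pos_neg_inner h1 (by rw [abs_lt]; omega)
    · exact (balancedAt_pos_neg_inner h1 (by rw [abs_lt]; omega)).swap
    · have := (balancedAt_pos_pos_above h1 (a := -(-(h : ℤ) + -h + c)) (by omega)).neg h1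
      rwa [neg_neg] at this

/-- A function of the class of a state, as a function of the state. -/
def atState (h : ℕ) (F : DigitClass → DigitClass → SumClass → ℝ) (s : ℤ × ℤ × ℤ) : ℝ :=
  F (digitClass h s.1) (digitClass h s.2.1) (sumClass h (s.1 + s.2.1 + s.2.2))

lemma exists_bound (F : DigitClass → DigitClass → SumClass → ℝ) :
    ∃ B, ∀ X Y A, |F X Y A| ≤ B := by
  have b1 : ∀ f : SumClass → ℝ, ∃ B, ∀ A, |f A| ≤ B := fun f =>
    ⟨|f .below| + |f .lower| + |f .inner| + |f .upper| + |f .above|, fun A => by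
      have := fun A => abs_nonneg (f A)
      have t1 := this .below
      have t2 := this .lower
      have t3 := this .inner
      have t4 := this .upper
      have t5 := this .above
      cases A <;> linarith⟩
  have b2 : ∀ f : DigitClass → ℝ, ∃ B, ∀ X, f X ≤ B := fun f =>
    ⟨|f .minus| + |f .inner| + |f .plus|, fun X => (le_abs_self _).trans (by
      have := fun X => abs_nonneg (f X)
      have t1 := this .minus
      have t2 := this .inner
      have t3 := this .plus
      cases X <;> linarith)⟩
  choose B0 hB0 using fun X Y => b1 (F X Y)
  choose B1 hB1 using fun X => b2 (B0 X)
  obtain ⟨B, hB⟩ := b2 B1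
  exact ⟨B, fun X Y A => (hB0 X Y A).trans ((hB1 X Y).trans (hB X))⟩

lemma avg_eq_transitionSum (h1 : 1 ≤ h) (s : ℤ × ℤ × ℤ)
    (Φ : DigitClass → DigitClass → SumClass → ℤ → ℝ) :
    (carryChain h h1).avg s (fun i => Φ (digitClass h i.1) (digitClass h i.2)
      (sumClass h (i.1 + i.2 + nextCarry (2 * h) (s.1 + s.2.1 + s.2.2) (i.1 + i.2)))
      (nextCarry (2 * h) (s.1 + s.2.1 + s.2.2) (i.1 + i.2))) =
    transitionSum h s.1 s.2.1 (s.1 + s.2.1 + s.2.2) Φ /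
      ((2 * h) ^ 2 * (digitWeight (2 * h) s.1 * digitWeight (2 * h) s.2.1)) := by
  have e1 : (carryChain h h1).moves s = allowed (2 * h) s.1 ×ˢ allowed (2 * h) s.2.1 := rfl
  have e3 : ∀ i, (carryChain h h1).weight s i = digitWeight (2 * h) i.1 * digitWeight (2 * h) i.2 /
    ((2 * h) ^ 2 * (digitWeight (2 * h) s.1 * digitWeight (2 * h) s.2.1)) := fun _ => rfl
  simp only [Chain.avg, e1, e3, transitionSum, val, Finset.sum_product, Finset.mul_sum,
    Finset.sum_div, smul_eq_mul]
  refine Finset.sum_congr rfl fun x' _ => Finset.sum_congr rfl fun y' _ => ?_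
  ring

/-- The increment of a linear combination of the compensated numbers of carries. -/
def carryValue (e t₁ t₂ : ℝ) (c : ℤ) : ℝ :=
  t₁ * ((if c = 1 then 1 else 0) - e) + t₂ * ((if c = -1 then 1 else 0) - e)

/-- The contribution of the last carry. -/
def lastCarryValue (t₁ t₂ : ℝ) (c : ℤ) : ℝ :=
  t₁ * (if c = 1 then 1 else 0) + t₂ * (if c = -1 then 1 else 0)

/-- The first order corrector of a linear combination of the numbers of carries. -/
def corr₁ (q t₁ t₂ : ℝ) (X Y : DigitClass) (A : SumClass) : ℝ :=
  (t₁ * corrM q X Y A + t₂ * corrM q X.neg Y.neg A.neg) / (8 * (q - 1) * (q + 1) ^ 2)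

/-- The second order corrector of a linear combination of the numbers of carries. -/
def corr₂ (q t₁ t₂ : ℝ) (X Y : DigitClass) (A : SumClass) : ℝ :=
  (t₁ ^ 2 * corrMM q X Y A + 2 * (t₁ * t₂) * ((q ^ 2 + 1) * corrMN q X Y A) +
    t₂ ^ 2 * corrMM q X.neg Y.neg A.neg) / (64 * (q - 1) ^ 2 * (q + 1) ^ 5 * (q ^ 2 + 1))

lemma carryValue_add_corr₁ {q : ℕ} (hq : 2 ≤ q) (t₁ t₂ : ℝ) (X Y : DigitClass) (A : SumClass)
    (X' Y' : DigitClass) (A' : SumClass) (c : ℤ) :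
    carryValue (meanConst q) t₁ t₂ c + corr₁ q t₁ t₂ X' Y' A' - corr₁ q t₁ t₂ X Y A =
      (t₁ * incM q X Y A X' Y' A' c + t₂ * incN q X Y A X' Y' A' c) /
        (8 * ((q : ℝ) - 1) * ((q : ℝ) + 1) ^ 2) := by
  have hq' : (2 : ℝ) ≤ q := by exact_mod_cast hq
  have d1 : (q : ℝ) - 1 ≠ 0 := by linarith
  have d2 : (q : ℝ) + 1 ≠ 0 := by linarith
  simp only [carryValue, corr₁, incM, incN, meanConst]
  generalize corrM q X Y A = a1
  generalize corrM q X' Y' A' = a2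
  generalize corrM q X.neg Y.neg A.neg = a3
  generalize corrM q X'.neg Y'.neg A'.neg = a4
  split_ifs <;> field_simp <;> ring

/-- The variance of the limit distribution of a linear combination of the numbers of carries. -/
def sigma2 (q : ℕ) (t₁ t₂ : ℝ) : ℝ :=
  t₁ ^ 2 * varConst q + 2 * (t₁ * t₂) * covConst q + t₂ ^ 2 * varConst q

lemma corrector_mean (h1 : 1 ≤ h) (t₁ t₂ : ℝ) {s : ℤ × ℤ × ℤ} (hs : s ∈ reachable h) :
    (carryChain h h1).avg s (fun i =>
      carryValue (meanConst (2 * h)) t₁ t₂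
        (nextCarry (2 * h) (s.1 + s.2.1 + s.2.2) (i.1 + i.2)) +
      atState h (corr₁ (2 * h : ℕ) t₁ t₂) ((carryChain h h1).next s i) -
      atState h (corr₁ (2 * h : ℕ) t₁ t₂) s) = 0 := by
  have H := balancedAt_of_reachable h1 hs
  have e := carryValue_add_corr₁ (q := 2 * h) (by omega) t₁ t₂
  have e2 : ∀ i, (carryChain h h1).next s i =
    (i.1, i.2, nextCarry (2 * h) (s.1 + s.2.1 + s.2.2) (i.1 + i.2)) := fun _ => rfl
  have hM := avg_eq_transitionSum h1 s (incM (2 * h) (digitClass h s.1) (digitClass h s.2.1)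
    (sumClass h (s.1 + s.2.1 + s.2.2)))
  have hN := avg_eq_transitionSum h1 s (incN (2 * h) (digitClass h s.1) (digitClass h s.2.1)
    (sumClass h (s.1 + s.2.1 + s.2.2)))
  rw [H.meanM, zero_div] at hM
  rw [H.meanN, zero_div] at hN
  simp only [atState, e, e2, div_eq_mul_inv]
  rw [Chain.avg_mul_const, Chain.avg_add, Chain.avg_const_mul, Chain.avg_const_mul]
  push_cast
  rw [hM, hN]
  ring

/-- The second order equation is quadratic in `(t₁, t₂)`; the coefficients of `t₁ ^ 2`, `t₁ * t₂`
and `t₂ ^ 2` are the equations `varM`, `cov` and `varN`. -/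
lemma corrector_var (h1 : 1 ≤ h) (t₁ t₂ : ℝ) {s : ℤ × ℤ × ℤ} (hs : s ∈ reachable h) :
    (carryChain h h1).avg s (fun i =>
      (carryValue (meanConst (2 * h)) t₁ t₂
        (nextCarry (2 * h) (s.1 + s.2.1 + s.2.2) (i.1 + i.2)) +
      atState h (corr₁ (2 * h : ℕ) t₁ t₂) ((carryChain h h1).next s i) -
      atState h (corr₁ (2 * h : ℕ) t₁ t₂) s) ^ 2 +
      atState h (corr₂ (2 * h : ℕ) t₁ t₂) ((carryChain h h1).next s i)) =
    sigma2 (2 * h) t₁ t₂ + atState h (corr₂ (2 * h : ℕ) t₁ t₂) s := by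
  have H := balancedAt_of_reachable h1 hs
  have e := carryValue_add_corr₁ (q := 2 * h) (by omega) t₁ t₂
  have e2 : ∀ i, (carryChain h h1).next s i =
    (i.1, i.2, nextCarry (2 * h) (s.1 + s.2.1 + s.2.2) (i.1 + i.2)) := fun _ => rfl
  have hq' : (1 : ℝ) ≤ h := by exact_mod_cast h1
  have W0 : ((2 * h : ℝ) ^ 2 * (digitWeight (2 * h) s.1 * digitWeight (2 * h) s.2.1)) ≠ 0 := by
    have a1 := digitWeight_pos (2 * h) s.1
    have a2 := digitWeight_pos (2 * h) s.2.1
    positivity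
  have hMM := avg_eq_transitionSum h1 s (fun X' Y' A' c => incM (2 * h) (digitClass h s.1)
    (digitClass h s.2.1) (sumClass h (s.1 + s.2.1 + s.2.2)) X' Y' A' c ^ 2 *
    ((2 * h + 1) * ((2 * h) ^ 2 + 1)) + corrMM (2 * h) X' Y' A')
  have hNN := avg_eq_transitionSum h1 s (fun X' Y' A' c => incN (2 * h) (digitClass h s.1)
    (digitClass h s.2.1) (sumClass h (s.1 + s.2.1 + s.2.2)) X' Y' A' c ^ 2 *
    ((2 * h + 1) * ((2 * h) ^ 2 + 1)) + corrMM (2 * h) X'.neg Y'.neg A'.neg)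
  have hMN := avg_eq_transitionSum h1 s (fun X' Y' A' c => incM (2 * h) (digitClass h s.1)
    (digitClass h s.2.1) (sumClass h (s.1 + s.2.1 + s.2.2)) X' Y' A' c * incN (2 * h)
    (digitClass h s.1) (digitClass h s.2.1) (sumClass h (s.1 + s.2.1 + s.2.2)) X' Y' A' c *
    (2 * h + 1) + corrMN (2 * h) X' Y' A')
  rw [H.varM, mul_div_cancel_left₀ _ W0] at hMM
  rw [H.varN, mul_div_cancel_left₀ _ W0] at hNN
  rw [H.cov, mul_div_cancel_left₀ _ W0] at hMN
  have d1 : (2 * h : ℝ) - 1 ≠ 0 := by linarith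
  have d2 : (2 * h : ℝ) + 1 ≠ 0 := by linarith
  have d3 : (2 * h : ℝ) ^ 2 + 1 ≠ 0 := by positivity
  have split : ∀ m n a b c : ℝ, ((t₁ * m + t₂ * n) / (8 * (2 * h - 1) * (2 * h + 1) ^ 2)) ^ 2 +
      (t₁ ^ 2 * a + 2 * (t₁ * t₂) * (((2 * h) ^ 2 + 1) * b) + t₂ ^ 2 * c) /
        (64 * (2 * h - 1) ^ 2 * (2 * h + 1) ^ 5 * ((2 * h) ^ 2 + 1)) =
      (t₁ ^ 2 * (m ^ 2 * ((2 * h + 1) * ((2 * h) ^ 2 + 1)) + a) +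
      2 * (t₁ * t₂) * ((2 * h) ^ 2 + 1) * (m * n * (2 * h + 1) + b) +
      t₂ ^ 2 * (n ^ 2 * ((2 * h + 1) * ((2 * h) ^ 2 + 1)) + c)) *
        (64 * (2 * h - 1) ^ 2 * (2 * h + 1) ^ 5 * ((2 * h) ^ 2 + 1) : ℝ)⁻¹ := by
    intro m n a b c
    field_simp
    ring
  simp only [atState, e, e2, corr₂]
  push_cast
  simp only [split]
  rw [Chain.avg_mul_const, Chain.avg_add, Chain.avg_add, Chain.avg_const_mul, Chain.avg_const_mul,
    Chain.avg_const_mul, hMM, hNN, hMN, sigma2, varConst, covConst, varNum, covNum]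
  push_cast
  generalize corrMM (2 * h) _ _ _ = a1
  generalize corrMM (2 * h) _ _ _ = a2
  generalize corrMN (2 * h) _ _ _ = a3
  field_simp
  ring

end

/-! ### Positive definiteness, and averages over pairs of expansions. -/

section

lemma varConst_add_covConst_pos {q : ℕ} (hq : 2 ≤ q) : 0 < varConst q + covConst q := by
  have hq' : (2 : ℝ) ≤ q := by exact_mod_cast hq
  have d1 : 0 < (q : ℝ) - 1 := by linarith
  have d2 : 0 < (q : ℝ) + 1 := by linarith
  rw [varConst, covConst, ← sub_eq_add_neg, ← sub_div]
  refine div_pos ?_ (by positivity)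
  -- Expanded in `x = q - 2 ≥ 0`, the numerator has only positive coefficients.
  obtain ⟨x, hx⟩ : ∃ x : ℝ, (q : ℝ) = x + 2 := ⟨q - 2, by ring⟩
  have hx0 : 0 ≤ x := by linarith
  rw [hx]
  ring_nf
  positivity

lemma varConst_sub_covConst_pos {q : ℕ} (hq : 2 ≤ q) : 0 < varConst q - covConst q := by
  have hq' : (2 : ℝ) ≤ q := by exact_mod_cast hq
  have d1 : 0 < (q : ℝ) - 1 := by linarith
  have d2 : 0 < (q : ℝ) + 1 := by linarith
  rw [varConst, covConst, sub_neg_eq_add, ← add_div]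
  refine div_pos ?_ (by positivity)
  obtain ⟨x, hx⟩ : ∃ x : ℝ, (q : ℝ) = x + 2 := ⟨q - 2, by ring⟩
  have hx0 : 0 ≤ x := by linarith
  rw [hx]
  ring_nf
  positivity

/-- Diagonalisation in the eigenvectors `(1, 1)` and `(1, -1)` of the covariance matrix, with
eigenvalues `v + c` and `v - c`. -/
lemma sigma2_eq (q : ℕ) (t₁ t₂ : ℝ) : sigma2 q t₁ t₂ =
    (varConst q + covConst q) * (t₁ + t₂) ^ 2 / 2 +
      (varConst q - covConst q) * (t₁ - t₂) ^ 2 / 2 := by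
  rw [sigma2]
  ring

lemma sigma2_nonneg {q : ℕ} (hq : 2 ≤ q) (t₁ t₂ : ℝ) : 0 ≤ sigma2 q t₁ t₂ := by
  have h1 := varConst_add_covConst_pos hq
  have h2 := varConst_sub_covConst_pos hq
  rw [sigma2_eq]
  positivity

lemma dotProduct_covMatrix_mulVec (q : ℕ) (x : Fin 2 → ℝ) :
    dotProduct x ((covMatrix q).mulVec x) = sigma2 q (x 0) (x 1) := by
  simp [covMatrix, Matrix.mulVec, dotProduct, Fin.sum_univ_two, sigma2]
  ring

lemma posDef_covMatrix {q : ℕ} (hq : 2 ≤ q) : (covMatrix q).PosDef := by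
  have h1 := varConst_add_covConst_pos hq
  have h2 := varConst_sub_covConst_pos hq
  refine Matrix.PosDef.of_dotProduct_mulVec_pos ?_ fun x hx => ?_
  · ext i j
    fin_cases i <;> fin_cases j <;> simp [covMatrix]
  · rw [star_trivial, dotProduct_covMatrix_mulVec, sigma2_eq]
    by_cases hs : x 0 + x 1 = 0
    · have hd : x 0 - x 1 ≠ 0 := fun hd => hx <| by
        funext i
        fin_cases i <;> simp <;> linarith
      positivity
    · positivity

variable {h : ℕ}

lemma card_words_pos {q : ℕ} (hq : 2 ≤ q) (ℓ : ℕ) (x : ℤ) : 0 < (words q ℓ x).card := by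
  rw [Finset.card_pos]
  induction ℓ generalizing x with
  | zero => exact Finset.univ_nonempty
  | succ ℓ ih =>
    obtain ⟨w, hw⟩ := ih 0
    refine ⟨Fin.cons (α := fun _ => ℤ) 0 w, mem_words_succ.2 ?_⟩
    simpa using ⟨zero_mem_allowed hq x, hw⟩

/-- The average over all pairs of expansions of length `ℓ`. -/
def pairAvg (q ℓ : ℕ) {V : Type*} [AddCommGroup V] [Module ℝ V]
    (F : (Fin ℓ → ℤ) → (Fin ℓ → ℤ) → V) : V :=
  (((words q ℓ 0).card : ℝ) ^ 2)⁻¹ • ∑ u ∈ words q ℓ 0, ∑ v ∈ words q ℓ 0, F u v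

/-- A linear combination of the centred numbers of carries. -/
def centredCarries (q : ℕ) (t₁ t₂ : ℝ) {ℓ : ℕ} (u v : Fin ℓ → ℤ) : ℝ :=
  t₁ * (numCarries q 1 u v - meanConst q * ℓ) + t₂ * (numCarries q (-1) u v - meanConst q * ℓ)

/-- The number of pairs is itself a path sum, that of the constant 1, so the factor `(q ^ 2) ^ ℓ`
cancels in the quotient. -/
lemma pairAvg_eq_pathSum (h1 : 1 ≤ h) {V : Type*} [AddCommGroup V] [Module ℝ V] (t₁ t₂ : ℝ)
    (ℓ : ℕ) (φ : ℝ → V) :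
    pairAvg (2 * h) ℓ (fun u v => φ (centredCarries (2 * h) t₁ t₂ u v)) =
      ((carryChain h h1).pathSum
        (fun s i => carryValue (meanConst (2 * h)) t₁ t₂
          (nextCarry (2 * h) (s.1 + s.2.1 + s.2.2) (i.1 + i.2)))
        (fun s => (digitWeight (2 * h) s.1 * digitWeight (2 * h) s.2.1)⁻¹)
        (fun s => lastCarryValue t₁ t₂ (nextCarry (2 * h) (s.1 + s.2.1 + s.2.2) 0)) ℓ (0, 0, 0)
        (fun _ => (1 : ℝ)))⁻¹ •
      (carryChain h h1).pathSum
        (fun s i => carryValue (meanConst (2 * h)) t₁ t₂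
          (nextCarry (2 * h) (s.1 + s.2.1 + s.2.2) (i.1 + i.2)))
        (fun s => (digitWeight (2 * h) s.1 * digitWeight (2 * h) s.2.1)⁻¹)
        (fun s => lastCarryValue t₁ t₂ (nextCarry (2 * h) (s.1 + s.2.1 + s.2.2) 0)) ℓ (0, 0, 0)
        φ := by
  have hq : 2 ≤ 2 * h := by omega
  have h0 : (h : ℝ) ≠ 0 := by exact_mod_cast (by omega : h ≠ 0)
  have e0 := fun u v : Fin ℓ → ℤ => carryTotal_words hq (meanConst (2 * h)) t₁ t₂ u v
  have e1 := sum_words_eq_pathSum h1 (carryValue (meanConst (2 * h)) t₁ t₂)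
    (lastCarryValue t₁ t₂) ℓ 0 0 0 φ
  have e2 := sum_words_eq_pathSum h1 (carryValue (meanConst (2 * h)) t₁ t₂)
    (lastCarryValue t₁ t₂) ℓ 0 0 0 (fun _ => (1 : ℝ))
  rw [digitWeight_zero hq, mul_one, mul_one] at e1 e2
  have e3 : ∑ u ∈ words (2 * h) ℓ 0, ∑ v ∈ words (2 * h) ℓ 0, (1 : ℝ) =
      ((words (2 * h) ℓ 0).card : ℝ) ^ 2 := by simp [sq]
  rw [e3, smul_eq_mul] at e2
  rw [pairAvg, e2, mul_inv]
  have e4 : ∑ u ∈ words (2 * h) ℓ 0, ∑ v ∈ words (2 * h) ℓ 0,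
      φ (centredCarries (2 * h) t₁ t₂ u v) = ∑ u ∈ words (2 * h) ℓ 0, ∑ v ∈ words (2 * h) ℓ 0,
      φ (carryTotal (2 * h) (carryValue (meanConst (2 * h)) t₁ t₂) (lastCarryValue t₁ t₂) ℓ 0
        fun j => pad (Fin.cons (α := fun _ => ℤ) 0 u) j +
          pad (Fin.cons (α := fun _ => ℤ) 0 v) j) :=
    Finset.sum_congr rfl fun u _ => Finset.sum_congr rfl fun v _ => congrArg φ (e0 u v).symm
  rw [e4, e1, smul_smul, mul_right_comm, inv_mul_cancel₀ (by positivity), one_mul]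

/-- Mean, second moment and limiting characteristic function of linear combinations of the numbers
of carries. -/
theorem pairAvg_asymptotics (h1 : 1 ≤ h) (t₁ t₂ : ℝ) :
    (∃ D : ℝ, ∀ ℓ : ℕ,
      |pairAvg (2 * h) ℓ (fun u v => centredCarries (2 * h) t₁ t₂ u v)| ≤ D ∧
      |pairAvg (2 * h) ℓ (fun u v => centredCarries (2 * h) t₁ t₂ u v ^ 2) -
        sigma2 (2 * h) t₁ t₂ * ℓ| ≤ D) ∧
    Tendsto (fun ℓ : ℕ => pairAvg (2 * h) ℓ (fun u v =>
      Complex.exp (((√(ℓ : ℝ))⁻¹ * centredCarries (2 * h) t₁ t₂ u v : ℝ) * Complex.I)))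
      atTop (𝓝 (Real.exp (-sigma2 (2 * h) t₁ t₂ / 2) : ℝ)) := by
  obtain ⟨B₁, hB₁⟩ := exists_bound (corr₁ (2 * h : ℕ) t₁ t₂)
  obtain ⟨B₂, hB₂⟩ := exists_bound (corr₂ (2 * h : ℕ) t₁ t₂)
  set e := meanConst (2 * h) with he
  set B := |t₁| * (1 + |e|) + |t₂| * (1 + |e|) with hB
  have hB0 : 0 ≤ B := by positivity
  have hB10 : 0 ≤ B₁ := (abs_nonneg _).trans (hB₁ .inner .inner .inner)
  have hB20 : 0 ≤ B₂ := (abs_nonneg _).trans (hB₂ .inner .inner .inner)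
  have ind : ∀ (p : Prop) [Decidable p], |(if p then (1 : ℝ) else 0)| ≤ 1 := fun p _ => by
    split_ifs <;> simp
  have cv : ∀ c, |carryValue e t₁ t₂ c| ≤ B := fun c => by
    refine (abs_add_le _ _).trans (add_le_add ?_ ?_) <;> rw [abs_mul] <;>
      exact mul_le_mul_of_nonneg_left ((abs_sub _ _).trans (add_le_add (ind _) le_rfl))
        (abs_nonneg _)
  have lv : ∀ c, |lastCarryValue t₁ t₂ c| ≤ B := fun c => by
    refine (abs_add_le _ _).trans (add_le_add ?_ ?_) <;> rw [abs_mul] <;>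
      exact mul_le_mul_of_nonneg_left ((ind _).trans (by linarith [abs_nonneg e])) (abs_nonneg _)
  have g1 : ∀ s, |atState h (corr₁ (2 * h : ℕ) t₁ t₂) s| ≤ B₁ := fun s => hB₁ _ _ _
  have g2 : ∀ s, |atState h (corr₂ (2 * h : ℕ) t₁ t₂) s| ≤ B₂ := fun s => hB₂ _ _ _
  have key := Chain.asymptotics (C := carryChain h h1)
    (ζ := fun s i => carryValue e t₁ t₂ (nextCarry (2 * h) (s.1 + s.2.1 + s.2.2) (i.1 + i.2)))
    (r := fun s => (digitWeight (2 * h) s.1 * digitWeight (2 * h) s.2.1)⁻¹)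
    (b := fun s => lastCarryValue t₁ t₂ (nextCarry (2 * h) (s.1 + s.2.1 + s.2.2) 0))
    -- One constant for all hypotheses; the 4 bounds the terminal weight, as both digit weights are
    -- at least 1/2.
    (K := B + B₁ + B₁ + B₂ + 4) (σ2 := sigma2 (2 * h) t₁ t₂)
    (g₁ := atState h (corr₁ (2 * h : ℕ) t₁ t₂)) (g₂ := atState h (corr₂ (2 * h : ℕ) t₁ t₂))
    (fun s _ i _ => (abs_sub _ _).trans (by
      linarith [abs_add_le (carryValue e t₁ t₂ (nextCarry (2 * h) (s.1 + s.2.1 + s.2.2)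
        (i.1 + i.2))) (atState h (corr₁ (2 * h : ℕ) t₁ t₂) ((carryChain h h1).next s i)),
        cv (nextCarry (2 * h) (s.1 + s.2.1 + s.2.2) (i.1 + i.2)),
        g1 ((carryChain h h1).next s i), g1 s]))
    (fun s _ => (abs_sub _ _).trans (by
      linarith [lv (nextCarry (2 * h) (s.1 + s.2.1 + s.2.2) 0), g1 s]))
    (fun s _ => by linarith [g1 s]) (fun s _ => by linarith [g2 s])
    (fun s _ => by
      have w1 := half_le_digitWeight (2 * h) s.1
      have w2 := half_le_digitWeight (2 * h) s.2.1
      have w3 := digitWeight_le_one (2 * h) s.1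
      have w4 := digitWeight_le_one (2 * h) s.2.1
      have w5 : 1 / 4 ≤ digitWeight (2 * h) s.1 * digitWeight (2 * h) s.2.1 := by nlinarith
      refine ⟨one_le_inv_iff₀.2 ⟨by linarith, mul_le_one₀ w3 (by linarith) w4⟩, ?_⟩
      have := inv_anti₀ (by norm_num) w5
      norm_num at this
      simp only [mul_inv]
      linarith)
    (fun s hs => corrector_mean h1 t₁ t₂ hs) (fun s hs => corrector_var h1 t₁ t₂ hs)
    (sigma2_nonneg (by omega) t₁ t₂) (carryChain h h1).base_mem
  obtain ⟨⟨D, hD⟩, hlim⟩ := key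
  refine ⟨⟨D, fun ℓ => ?_⟩, ?_⟩
  · rw [pairAvg_eq_pathSum h1 t₁ t₂ ℓ (fun z => z), pairAvg_eq_pathSum h1 t₁ t₂ ℓ (fun z => z ^ 2),
      smul_eq_mul, smul_eq_mul, ← div_eq_inv_mul, ← div_eq_inv_mul]
    exact hD ℓ
  · refine hlim.congr fun ℓ => ?_
    rw [pairAvg_eq_pathSum h1 t₁ t₂ ℓ
      (fun z => Complex.exp (((√(ℓ : ℝ))⁻¹ * z : ℝ) * Complex.I)), div_eq_inv_mul,
      Complex.real_smul, Complex.ofReal_inv]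
    rfl

end

/-! ### Random expansions: expectations, variances and covariances. -/

/-- Expectations of functions of two independent uniformly distributed random expansions are
averages. -/
lemma integral_eq_pairAvg {q ℓ : ℕ} (hq : 2 ≤ q) {Ω : Type*} [MeasurableSpace Ω] {P : Measure Ω}
    [IsProbabilityMeasure P] {X Y : Ω → Fin ℓ → ℤ} (hX : HasLaw X (uniformOn (expansions q ℓ)) P)
    (hY : HasLaw Y (uniformOn (expansions q ℓ)) P) (hXY : IndepFun X Y P)
    {V : Type*} [NormedAddCommGroup V] [NormedSpace ℝ V] [CompleteSpace V]
    (F : (Fin ℓ → ℤ) → (Fin ℓ → ℤ) → V) :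
    ∫ ω, F (X ω) (Y ω) ∂P = pairAvg q ℓ F := by
  classical
  set E := words q ℓ 0 with hE
  rw [← coe_words_zero hq, ← hE] at hX hY
  have hlaw : P.map (fun ω => (X ω, Y ω)) =
      (uniformOn (E : Set (Fin ℓ → ℤ))).prod (uniformOn (E : Set (Fin ℓ → ℤ))) := by
    rw [(indepFun_iff_map_prod_eq_prod_map_map hX.aemeasurable hY.aemeasurable).1 hXY, hX.map_eq,
      hY.map_eq]
  have hsf : IsProbabilityMeasure (uniformOn (E : Set (Fin ℓ → ℤ))) :=
    isProbabilityMeasure_uniformOn E.finite_toSet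
      (Finset.coe_nonempty.2 (Finset.card_pos.1 (card_words_pos hq ℓ 0)))
  set ν := (uniformOn (E : Set (Fin ℓ → ℤ))).prod (uniformOn (E : Set (Fin ℓ → ℤ))) with hν
  have h1 : ∫ ω, F (X ω) (Y ω) ∂P = ∫ p, F p.1 p.2 ∂ν := by
    rw [← hlaw, integral_map (hX.aemeasurable.prodMk hY.aemeasurable)]
    exact StronglyMeasurable.of_discrete.aestronglyMeasurable
  have hpt : ∀ u ∈ E, uniformOn (E : Set (Fin ℓ → ℤ)) {u} = (E.card : ENNReal)⁻¹ := fun u hu => by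
    rw [← Finset.coe_singleton, uniformOn_apply_finset, Finset.inter_singleton_of_mem hu,
      Finset.card_singleton, Nat.cast_one, one_div]
  have hfull : ν (↑(E ×ˢ E) : Set _)ᶜ = 0 := by
    rw [prob_compl_eq_zero_iff (Finset.measurableSet _), Finset.coe_product, hν, Measure.prod_prod,
      uniformOn_self E.finite_toSet
        (Finset.coe_nonempty.2 (Finset.card_pos.1 (card_words_pos hq ℓ 0))), one_mul]
  rw [h1, ← setIntegral_eq_integral_of_ae_compl_eq_zero (s := (↑(E ×ˢ E) : Set _)),
    setIntegral_finset _ (IntegrableOn.finset), Finset.sum_product, pairAvg, Finset.smul_sum]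
  · refine Finset.sum_congr rfl fun u hu => ?_
    rw [Finset.smul_sum]
    refine Finset.sum_congr rfl fun v hv => ?_
    congr 1
    rw [Measure.real, ← Set.singleton_prod_singleton, hν, Measure.prod_prod, hpt u hu, hpt v hv]
    simp [sq, hE]
  · filter_upwards [compl_mem_ae_iff.2 hfull] with p hp hp'
    exact absurd (by simpa using hp) hp'

lemma numCarries_le (q : ℕ) (c : ℤ) {ℓ : ℕ} (x y : Fin ℓ → ℤ) : numCarries q c x y ≤ ℓ := by
  rw [numCarries]
  exact (Finset.card_filter_le _ _).trans (by simp)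

lemma aemeasurable_pair {ℓ : ℕ} {Ω β : Type*} [MeasurableSpace Ω] [MeasurableSpace β]
    {P : Measure Ω} {X Y : Ω → Fin ℓ → ℤ} (hX : AEMeasurable X P) (hY : AEMeasurable Y P)
    (F : (Fin ℓ → ℤ) → (Fin ℓ → ℤ) → β) : AEMeasurable (fun ω => F (X ω) (Y ω)) P :=
  (measurable_of_countable (Function.uncurry F)).comp_aemeasurable (hX.prodMk hY)

lemma memLp_numCarries {q ℓ : ℕ} (c : ℤ) {Ω : Type*} [MeasurableSpace Ω] {P : Measure Ω}
    [IsProbabilityMeasure P] {X Y : Ω → Fin ℓ → ℤ} (hX : AEMeasurable X P) (hY : AEMeasurable Y P) :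
    MemLp (fun ω => (numCarries q c (X ω) (Y ω) : ℝ)) 2 P := by
  have hm : AEMeasurable (fun ω => (numCarries q c (X ω) (Y ω) : ℝ)) P :=
    aemeasurable_pair hX hY fun x y => (numCarries q c x y : ℝ)
  refine MemLp.of_bound hm.aestronglyMeasurable ℓ (ae_of_all _ fun ω => ?_)
  rw [Real.norm_of_nonneg (Nat.cast_nonneg _)]
  exact_mod_cast numCarries_le q c _ _

/-- Variances and covariances of the numbers of carries in terms of second moments of the centred
linear combinations. -/
lemma variance_eq_of_shift {Ω : Type*} [MeasurableSpace Ω] {P : Measure Ω} [IsProbabilityMeasure P]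
    {M : Ω → ℝ} (hM : MemLp M 2 P) (a : ℝ) :
    variance M P = ∫ ω, (M ω - a) ^ 2 ∂P - (∫ ω, (M ω - a) ∂P) ^ 2 := by
  rw [← variance_sub_const hM.aestronglyMeasurable a]
  exact variance_eq_sub (hM.sub (memLp_const a))

/-- Polarisation: second moments of linear combinations determine the covariance, so no separate
analysis of the product of the two counts is needed. -/
lemma covariance_eq_of_shift {Ω : Type*} [MeasurableSpace Ω] {P : Measure Ω}
    [IsProbabilityMeasure P] {M N : Ω → ℝ} (hM : MemLp M 2 P) (hN : MemLp N 2 P) (a : ℝ) :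
    covariance M N P = (∫ ω, (M ω - a + (N ω - a)) ^ 2 ∂P - ∫ ω, (M ω - a) ^ 2 ∂P -
      ∫ ω, (N ω - a) ^ 2 ∂P) / 2 - (∫ ω, (M ω - a) ∂P) * ∫ ω, (N ω - a) ∂P := by
  have h1 := variance_fun_add hM hN
  have hs : variance (fun ω => M ω + N ω) P =
      ∫ ω, (M ω - a + (N ω - a)) ^ 2 ∂P - (∫ ω, (M ω - a + (N ω - a)) ∂P) ^ 2 := by
    have hr : ∀ ω, M ω + N ω - 2 * a = M ω - a + (N ω - a) := fun ω => by ring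
    have hv := variance_eq_of_shift (hM.add hN) (2 * a)
    simp only [Pi.add_apply, hr] at hv
    exact hv
  have hi : ∀ {F : Ω → ℝ}, MemLp F 2 P → Integrable (fun ω => F ω - a) P := fun hF =>
    (hF.integrable one_le_two).sub (integrable_const a)
  rw [hs, variance_eq_of_shift hM a, variance_eq_of_shift hN a,
    integral_add (hi hM) (hi hN)] at h1
  linarith

lemma isBigO_one_of_bound {f : ℕ → ℝ} {D : ℝ} (hf : ∀ ℓ, |f ℓ| ≤ D) :
    f =O[atTop] (fun _ => (1 : ℝ)) :=
  IsBigO.of_bound D (Eventually.of_forall fun ℓ => by simpa using hf ℓ)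

end SSDE

end

/-! ### Assembly of moments and limit law. -/

theorem mainTheorem2 (q : ℕ) (hq : 2 ≤ q) (hqe : Even q)
    {Ω : ℕ → Type*} [∀ ℓ, MeasurableSpace (Ω ℓ)]
    (P : ∀ ℓ, Measure (Ω ℓ)) [∀ ℓ, IsProbabilityMeasure (P ℓ)]
    (X Y : ∀ ℓ, Ω ℓ → (Fin ℓ → ℤ))
    (hX : ∀ ℓ, HasLaw (X ℓ) (uniformOn (SSDE.expansions q ℓ)) (P ℓ))
    (hY : ∀ ℓ, HasLaw (Y ℓ) (uniformOn (SSDE.expansions q ℓ)) (P ℓ))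
    (hXY : ∀ ℓ, IndepFun (X ℓ) (Y ℓ) (P ℓ))
    (M N : ∀ ℓ, Ω ℓ → ℝ)
    (hM : ∀ ℓ ω, M ℓ ω = (SSDE.numCarries q 1 (X ℓ ω) (Y ℓ ω) : ℝ))
    (hN : ∀ ℓ ω, N ℓ ω = (SSDE.numCarries q (-1) (X ℓ ω) (Y ℓ ω) : ℝ)) :
    ((fun ℓ : ℕ => (∫ ω, M ℓ ω ∂(P ℓ)) - SSDE.meanConst q * ℓ) =O[atTop]
      (fun _ => (1 : ℝ))) ∧
    ((fun ℓ : ℕ => variance (M ℓ) (P ℓ) - SSDE.varConst q * ℓ) =O[atTop]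
      (fun _ => (1 : ℝ))) ∧
    ((fun ℓ : ℕ => (∫ ω, N ℓ ω ∂(P ℓ)) - SSDE.meanConst q * ℓ) =O[atTop]
      (fun _ => (1 : ℝ))) ∧
    ((fun ℓ : ℕ => variance (N ℓ) (P ℓ) - SSDE.varConst q * ℓ) =O[atTop]
      (fun _ => (1 : ℝ))) ∧
    ((fun ℓ : ℕ => covariance (M ℓ) (N ℓ) (P ℓ) - SSDE.covConst q * ℓ) =O[atTop]
      (fun _ => (1 : ℝ))) ∧
    (SSDE.covMatrix q).PosDef ∧
    TendstoInDistribution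
      (fun (ℓ : ℕ) (ω : Ω ℓ) =>
        (Real.sqrt ℓ)⁻¹ •
          !₂[M ℓ ω - SSDE.meanConst q * ℓ, N ℓ ω - SSDE.meanConst q * ℓ])
      atTop (id : EuclideanSpace ℝ (Fin 2) → EuclideanSpace ℝ (Fin 2))
      P (multivariateGaussian 0 (SSDE.covMatrix q)) := by
  obtain ⟨h, rfl⟩ := even_iff_two_dvd.1 hqe
  have h1 : 1 ≤ h := by omega
  set e := SSDE.meanConst (2 * h) with he
  have memM : ∀ ℓ, MemLp (M ℓ) 2 (P ℓ) := fun ℓ => by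
    rw [funext (hM ℓ)]
    exact SSDE.memLp_numCarries 1 (hX ℓ).aemeasurable (hY ℓ).aemeasurable
  have memN : ∀ ℓ, MemLp (N ℓ) 2 (P ℓ) := fun ℓ => by
    rw [funext (hN ℓ)]
    exact SSDE.memLp_numCarries (-1) (hX ℓ).aemeasurable (hY ℓ).aemeasurable
  have hlin : ∀ t₁ t₂ ℓ ω, t₁ * (M ℓ ω - e * ℓ) + t₂ * (N ℓ ω - e * ℓ) =
      SSDE.centredCarries (2 * h) t₁ t₂ (X ℓ ω) (Y ℓ ω) := fun t₁ t₂ ℓ ω => by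
    rw [hM, hN]; rfl
  have moments : ∀ t₁ t₂ : ℝ, ∃ D : ℝ, ∀ ℓ : ℕ,
      |∫ ω, (t₁ * (M ℓ ω - e * ℓ) + t₂ * (N ℓ ω - e * ℓ)) ∂(P ℓ)| ≤ D ∧
      |∫ ω, (t₁ * (M ℓ ω - e * ℓ) + t₂ * (N ℓ ω - e * ℓ)) ^ 2 ∂(P ℓ) -
        SSDE.sigma2 (2 * h) t₁ t₂ * ℓ| ≤ D := fun t₁ t₂ => by
    obtain ⟨⟨D, hD⟩, -⟩ := SSDE.pairAvg_asymptotics h1 t₁ t₂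
    refine ⟨D, fun ℓ => ?_⟩
    simp only [hlin]
    rw [SSDE.integral_eq_pairAvg hq (hX ℓ) (hY ℓ) (hXY ℓ)
        (fun u v => SSDE.centredCarries (2 * h) t₁ t₂ u v),
      SSDE.integral_eq_pairAvg hq (hX ℓ) (hY ℓ) (hXY ℓ)
        (fun u v => SSDE.centredCarries (2 * h) t₁ t₂ u v ^ 2)]
    exact hD ℓ
  -- The directions `(1, 0)`, `(0, 1)` and `(1, 1)` have limiting variances `v`, `v` and `2 * v + 2
  -- * c`, from which polarisation recovers `c`.
  obtain ⟨D₁, hD₁⟩ := moments 1 0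
  obtain ⟨D₂, hD₂⟩ := moments 0 1
  obtain ⟨D₃, hD₃⟩ := moments 1 1
  simp only [one_mul, zero_mul, add_zero, zero_add, SSDE.sigma2] at hD₁ hD₂ hD₃
  norm_num at hD₁ hD₂ hD₃
  have mean : ∀ ℓ (F : Ω ℓ → ℝ), MemLp F 2 (P ℓ) →
      ∫ ω, (F ω - e * ℓ) ∂(P ℓ) = ∫ ω, F ω ∂(P ℓ) - e * ℓ := fun ℓ F hF => by
    rw [integral_sub (hF.integrable one_le_two) (integrable_const _)]
    simp
  have sqle : ∀ {x D : ℝ}, |x| ≤ D → |x ^ 2| ≤ D ^ 2 := fun {x D} hx => by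
    rw [abs_pow]
    exact pow_le_pow_left₀ (abs_nonneg _) hx 2
  have D1nn : 0 ≤ D₁ := (abs_nonneg _).trans (hD₁ 0).1
  refine ⟨SSDE.isBigO_one_of_bound (D := D₁) fun ℓ => ?_,
    SSDE.isBigO_one_of_bound (D := D₁ + D₁ ^ 2) fun ℓ => ?_,
    SSDE.isBigO_one_of_bound (D := D₂) fun ℓ => ?_,
    SSDE.isBigO_one_of_bound (D := D₂ + D₂ ^ 2) fun ℓ => ?_,
    SSDE.isBigO_one_of_bound (D := D₃ + D₁ + D₂ + D₁ * D₂) fun ℓ => ?_,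
    SSDE.posDef_covMatrix hq, ?_⟩
  · rw [← mean ℓ _ (memM ℓ)]
    exact (hD₁ ℓ).1
  · rw [SSDE.variance_eq_of_shift (memM ℓ) (e * ℓ), sub_right_comm]
    exact (abs_sub _ _).trans (add_le_add (hD₁ ℓ).2 (sqle (hD₁ ℓ).1))
  · rw [← mean ℓ _ (memN ℓ)]
    exact (hD₂ ℓ).1
  · rw [SSDE.variance_eq_of_shift (memN ℓ) (e * ℓ), sub_right_comm]
    exact (abs_sub _ _).trans (add_le_add (hD₂ ℓ).2 (sqle (hD₂ ℓ).1))
  · rw [SSDE.covariance_eq_of_shift (memM ℓ) (memN ℓ) (e * ℓ)]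
    have b1 := abs_le.1 (hD₁ ℓ).2
    have b2 := abs_le.1 (hD₂ ℓ).2
    have b3 := abs_le.1 (hD₃ ℓ).2
    have b4 : |(∫ ω, (M ℓ ω - e * ℓ) ∂(P ℓ)) * ∫ ω, (N ℓ ω - e * ℓ) ∂(P ℓ)| ≤ D₁ * D₂ := by
      rw [abs_mul]
      exact mul_le_mul (hD₁ ℓ).1 (hD₂ ℓ).1 (abs_nonneg _) D1nn
    rw [abs_le] at b4 ⊢
    constructor <;> nlinarith
  · have hAE : ∀ ℓ, AEMeasurable (fun ω : Ω ℓ => (Real.sqrt ℓ)⁻¹ •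
        !₂[M ℓ ω - e * ℓ, N ℓ ω - e * ℓ]) (P ℓ) := fun ℓ => by
      simp only [hM, hN]
      exact SSDE.aemeasurable_pair (hX ℓ).aemeasurable (hY ℓ).aemeasurable fun u v =>
        (Real.sqrt ℓ)⁻¹ • !₂[(SSDE.numCarries (2 * h) 1 u v : ℝ) - e * ℓ,
          (SSDE.numCarries (2 * h) (-1) u v : ℝ) - e * ℓ]
    -- Lévy's continuity theorem: the characteristic function at `t` is that of the linear
    -- combination with coefficients `t 0` and `t 1`, and these limits are already known.
    refine ⟨hAE, aemeasurable_id, ProbabilityMeasure.tendsto_of_tendsto_charFun fun t => ?_⟩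
    have hlim := (SSDE.pairAvg_asymptotics h1 (t 0) (t 1)).2
    have hL : charFun ((multivariateGaussian 0 (SSDE.covMatrix (2 * h))).map id) t =
        ((Real.exp (-SSDE.sigma2 (2 * h) (t 0) (t 1) / 2) : ℝ) : ℂ) := by
      rw [Measure.map_id, charFun_multivariateGaussian (SSDE.posDef_covMatrix hq).posSemidef,
        SSDE.dotProduct_covMatrix_mulVec]
      push_cast
      rw [inner_zero_right]
      congr 1
      push_cast
      ring
    change Tendsto _ _ (𝓝 (charFun ((multivariateGaussian 0 (SSDE.covMatrix (2 * h))).map id) t))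
    rw [hL]
    refine hlim.congr fun ℓ => ?_
    rw [← SSDE.integral_eq_pairAvg hq (hX ℓ) (hY ℓ) (hXY ℓ) (fun u v =>
      Complex.exp (((Real.sqrt (ℓ : ℝ))⁻¹ * SSDE.centredCarries (2 * h) (t 0) (t 1) u v : ℝ) *
        Complex.I))]
    change _ = charFun ((P ℓ).map _) t
    rw [charFun_apply, integral_map (hAE ℓ) (by fun_prop)]
    refine integral_congr_ae (ae_of_all _ fun ω => ?_)
    simp only
    rw [← hlin, real_inner_smul_left]
    congr 4
    simp [PiLp.inner_apply, Fin.sum_univ_two]
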